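/- **Theorem (linear criterion for non-trivial solutions).** Let $V\in L^{3/2}(\mathbb R^3)$ be real-valued and even, $V(-x)=V(x)$, let $\mu\in\mathbb R$ and $0\le T<\infty$. Write $\hat f(p)=(2\pi)^{-3/2}\int_{\mathbb R^3} f(x)e^{-ip\cdot x}\,dx$ for the Fourier transform (extended to $L^1+L^2$, hence to $L^{3/2}$). Let $\mathcal D$ be the set of pairs $(\gamma,\alpha)$ with $\hat\gamma\in L^1(\mathbb R^3,(1+p^2)\,dp)$ real-valued, $\alpha\in H^1(\mathbb R^3)$ complex-valued and even, such that for almost every $p$ $$\Gamma(p)=\begin{pmatrix}\hat\gamma(p)&\hat\alpha(p)\\ \overline{\hat\alpha(p)}&1-\hat\gamma(-p)\end{pmatrix}\quad\text{satisfies}\quad 0\le\Gamma(p)\le 1 ,$$ and for $(\gamma,\alpha)\in\mathcal D$ let $$\mathcal F(\gamma,\alpha)=\int_{\mathbb R^3}(p^2-\mu)\hat\gamma(p)\,dp+\int_{\mathbb R^3}|\alpha(x)|^2V(x)\,dx+T\int_{\mathbb R^3}\mathrm{Tr}_{\mathbb C^2}\big[\Gamma(p)\ln\Gamma(p)\big]\,dp$$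 be the translation-invariant BCS functional. The normal state is $(\gamma_0,0)$ with $\hat\gamma_0(p)=(1+e^{(p^2-\mu)/T})^{-1}$ for $T>0$, and $\hat\gamma_0=\mathbb 1_{\{p^2<\mu\}}$ for $T=0$. For $\Delta:\mathbb R^3\to\mathbb C$ put $$E_\Delta(p)=\sqrt{(p^2-\mu)^2+|\Delta(p)|^2},\qquad K_T^\Delta(p)=\frac{E_\Delta(p)}{\tanh\big(E_\Delta(p)/2T\big)},\qquad K_T^0(p)=\frac{p^2-\mu}{\tanh\big((p^2-\mu)/2T\big)},$$ with the limiting values $K_0^\Delta=E_\Delta$, $K_0^0=|p^2-\mu|$ for $T=0$, and $2T$ for $T>0$ where the numerator vanishes. Then the following are equivalent. (i) The normal state is unstable under pair formation: $\inf_{(\gamma,\alpha)\in\mathcal D}\mathcal F(\gamma,\alpha)<\mathcal F(\gamma_0,0)$. (ii) The BCS gap equation has a non-trivial solution: there is $(\gamma,\alpha)\in\mathcal D$ with $\alpha\ne0$ such that $\Delta=2(2\pi)^{-3/2}\,\hat V*\hat\alpha$ does not vanish identically and satisfies $$\Delta=-\frac1{(2\pi)^{3/2}}\,\hat V*\frac{\Delta}{K_T^\Delta}.$$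 (iii) The self-adjoint operator $K_T^0+V$, defined as a form sum with form domain $H^1(\mathbb R^3)$, where $K_T^0$ is multiplication by $K_T^0(p)$ in Fourier space and $V$ is multiplication by $V(x)$ in position space, has a negative eigenvalue on the space of even functions in $L^2(\mathbb R^3)$. -/

import Mathlib

open MeasureTheory
open scoped FourierTransform ComplexConjugate ComplexOrder

namespace BCS

noncomputable section

/-- Three-dimensional Euclidean space (positions as well as momenta). -/
abbrev R3 : Type := EuclideanSpace ℝ (Fin 3)

/-- The complex Hilbert space `L²(ℝ³)`. -/
abbrev L2 : Type := Lp ℂ 2 (volume : Measure R3)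

/-! ### Fourier transforms in the unitary convention
`f̂(p) = (2π)^(-3/2) ∫ f(x) e^{-i p·x} dx` -/

/-- Passage from Mathlib's convention `∫ f(x) e^{-2π i x·ξ} dx` to the unitary one:
if `g` is the former transform of `f`, then `(2π)^(-3/2) g(p / 2π)` is the latter. -/
def unitaryConvention (g : R3 → ℂ) (p : R3) : ℂ :=
  (((2 * Real.pi) ^ (-(3 / 2) : ℝ) : ℝ) : ℂ) * g ((2 * Real.pi)⁻¹ • p)

/-- The (Plancherel) Fourier transform `f̂` of `f ∈ L²(ℝ³)`, unitary convention. -/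
def hatL2 (f : L2) : R3 → ℂ := unitaryConvention (𝓕 f : L2)

/-- The Fourier transform of an integrable function, unitary convention. -/
def hatL1 (f : R3 → ℂ) : R3 → ℂ := unitaryConvention (𝓕 f)

/-- The part of `V` where `|V| > 1`; it is integrable when `V ∈ L^{3/2}`. -/
def largePart (V : R3 → ℝ) (x : R3) : ℂ := if |V x| ≤ 1 then 0 else (V x : ℂ)

/-- The part of `V` where `|V| ≤ 1`; it is square integrable when `V ∈ L^{3/2}`. -/
def smallPart (V : R3 → ℝ) (x : R3) : ℂ := if |V x| ≤ 1 then (V x : ℂ) else 0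

theorem memLp_smallPart {V : R3 → ℝ} (hV : MemLp V (3 / 2) volume) :
    MemLp (smallPart V) 2 volume := by
  have hmeas : AEStronglyMeasurable (smallPart V) volume := by
    have ht : Measurable (fun y : ℝ => if |y| ≤ 1 then (y : ℂ) else 0) :=
      Measurable.ite (measurableSet_le (by fun_prop) (by fun_prop)) (by fun_prop) (by fun_prop)
    exact (ht.comp_aemeasurable hV.aestronglyMeasurable.aemeasurable).aestronglyMeasurable
  have h32 : ((3 / 2 : ENNReal)).toReal = 3 / 2 := by simp
  have hI : Integrable (fun x => ‖V x‖ ^ (3 / 2 : ℝ)) volume := by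
    have h := hV.integrable_norm_rpow (by simp)
      (ENNReal.div_ne_top (by simp) (by simp))
    rwa [h32] at h
  rw [memLp_two_iff_integrable_sq_norm hmeas]
  refine hI.mono' (by fun_prop) (Filter.Eventually.of_forall fun x => ?_)
  rw [Real.norm_of_nonneg (by positivity)]
  unfold smallPart
  split_ifs with h
  · rw [Complex.norm_real, Real.norm_eq_abs, ← Real.rpow_natCast]
    exact Real.rpow_le_rpow_of_exponent_ge_of_imp (abs_nonneg _) h (by norm_num) (by norm_num)
  · have h0 : (0 : ℝ) ≤ ‖V x‖ ^ (3 / 2 : ℝ) := by positivity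
    simpa using h0

/-- The Fourier transform `V̂` of `V ∈ L^{3/2}(ℝ³) ⊆ L¹ + L²`, as a function: the sum of the
transforms of the two parts of `V`. It represents the Fourier transform of `V` as a tempered
distribution. -/
def hatV {V : R3 → ℝ} (hV : MemLp V (3 / 2) volume) (p : R3) : ℂ :=
  hatL1 (largePart V) p + hatL2 ((memLp_smallPart hV).toLp (smallPart V)) p

/-- The convolution `(V̂ ∗ g)(p) = ∫ V̂(p - q) g(q) dq`. -/
def convHatV {V : R3 → ℝ} (hV : MemLp V (3 / 2) volume) (g : R3 → ℂ) (p : R3) : ℂ :=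
  ∫ q, hatV hV (p - q) * g q

/-! ### Admissible states and the free energy -/

/-- The Sobolev space `H¹(ℝ³)`, as a predicate on `L²(ℝ³)`. -/
def MemH1 (f : L2) : Prop :=
  TemperedDistribution.MemSobolev 1 2 (f : TemperedDistribution R3 ℂ)

/-- `f` is invariant under the reflection `x ↦ -x`. -/
def IsEven (f : L2) : Prop := ∀ᵐ x : R3, f (-x) = f x

/-- The matrix `Γ(p)` with rows `(γ̂(p), α̂(p))` and `(conj α̂(p), 1 - γ̂(-p))`.
The argument `γ` stands for the momentum distribution `γ̂`. -/
def stateMatrix (γ : R3 → ℝ) (α : L2) (p : R3) : Matrix (Fin 2) (Fin 2) ℂ :=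
  !![(γ p : ℂ), hatL2 α p; conj (hatL2 α p), 1 - (γ (-p) : ℂ)]

/-- The set `𝒟` of admissible translation-invariant states: `γ̂ ∈ L¹((1+p²)dp)`, `α ∈ H¹`,
`α̂(p) = α̂(-p)` (equivalently `α(x) = α(-x)`), and `0 ≤ Γ(p) ≤ 1`. -/
def admissible : Set ((R3 → ℝ) × L2) :=
  {s | Integrable (fun p => (1 + ‖p‖ ^ 2) * s.1 p) volume ∧ MemH1 s.2 ∧ IsEven s.2 ∧
    ∀ᵐ p : R3, (stateMatrix s.1 s.2 p).PosSemidef ∧ (1 - stateMatrix s.1 s.2 p).PosSemidef}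

/-- The entropy `S(Γ) = -∫ Tr[Γ(p) ln Γ(p)] dp`, where `-Γ ln Γ` is formed by functional
calculus from `negMulLog x = -x ln x`. -/
def entropy (γ : R3 → ℝ) (α : L2) : ℝ :=
  ∫ p, (Matrix.trace (cfc Real.negMulLog (stateMatrix γ α p))).re

/-- The translation-invariant BCS functional
`∫ (p² - μ) γ̂(p) dp + ∫ |α(x)|² V(x) dx - T S(Γ)`. -/
def freeEnergy (V : R3 → ℝ) (μ T : ℝ) (s : (R3 → ℝ) × L2) : ℝ :=
  (∫ p, (‖p‖ ^ 2 - μ) * s.1 p) + (∫ x, ‖s.2 x‖ ^ 2 * V x) - T * entropy s.1 s.2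

/-- The momentum distribution of the normal state: the Fermi-Dirac distribution, and for `T = 0`
the indicator function of the Fermi ball. -/
def normalGamma (μ T : ℝ) (p : R3) : ℝ :=
  if T = 0 then (if ‖p‖ ^ 2 < μ then 1 else 0) else (1 + Real.exp ((‖p‖ ^ 2 - μ) / T))⁻¹

/-! ### The gap equation and the linear operator -/

/-- The function `e ↦ e / tanh (e / 2T)`, with its limiting values `2T` at `e = 0` and, for
`T = 0`, `|e|`. -/
def thermal (T e : ℝ) : ℝ :=
  if T = 0 then |e| else if e = 0 then 2 * T else e / Real.tanh (e / (2 * T))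

/-- `K_T^Δ(p) = E_Δ(p) / tanh (E_Δ(p) / 2T)` with `E_Δ(p) = √((p² - μ)² + |Δ(p)|²)`. -/
def KDelta (μ T : ℝ) (Δ : R3 → ℂ) (p : R3) : ℝ :=
  thermal T (Real.sqrt ((‖p‖ ^ 2 - μ) ^ 2 + ‖Δ p‖ ^ 2))

/-- `K_T^0(p) = (p² - μ) / tanh ((p² - μ) / 2T)`. -/
def KZero (μ T : ℝ) (p : R3) : ℝ := thermal T (‖p‖ ^ 2 - μ)

/-- `Δ = 2 (2π)^(-3/2) V̂ ∗ α̂`. -/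
def gapFunction {V : R3 → ℝ} (hV : MemLp V (3 / 2) volume) (α : L2) (p : R3) : ℂ :=
  2 * (((2 * Real.pi) ^ (-(3 / 2) : ℝ) : ℝ) : ℂ) * convHatV hV (hatL2 α) p

/-- The BCS gap equation `Δ = - (2π)^(-3/2) V̂ ∗ (Δ / K_T^Δ)`. -/
def GapEquation {V : R3 → ℝ} (hV : MemLp V (3 / 2) volume) (μ T : ℝ) (Δ : R3 → ℂ) : Prop :=
  ∀ p, Δ p = -((((2 * Real.pi) ^ (-(3 / 2) : ℝ) : ℝ) : ℂ) *
    convHatV hV (fun q => Δ q / (KDelta μ T Δ q : ℂ)) p)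

/-- The quadratic form of `K_T^0 + V` with form domain `H¹(ℝ³)`, as a sesquilinear form:
`∫ K_T^0(p) conj φ̂(p) ψ̂(p) dp + ∫ V(x) conj φ(x) ψ(x) dx`. -/
def linForm (V : R3 → ℝ) (μ T : ℝ) (φ ψ : L2) : ℂ :=
  (∫ p, (KZero μ T p : ℂ) * (conj (hatL2 φ p) * hatL2 ψ p)) +
    ∫ x, (V x : ℂ) * (conj (φ x) * ψ x)

/-- The graph of the self-adjoint operator `K_T^0 + V` on `L²(ℝ³)` (form sum): `ψ` is in the domain
and is mapped to `η` iff `ψ ∈ H¹` and the form satisfies `q(φ, ψ) = ⟨φ, η⟩` for all `φ ∈ H¹`. -/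
def LinOpGraph (V : R3 → ℝ) (μ T : ℝ) (ψ η : L2) : Prop :=
  MemH1 ψ ∧ ∀ φ : L2, MemH1 φ → linForm V μ T φ ψ = inner ℂ φ η

/-- `K_T^0 + V`, acting on the reflection-symmetric functions in `L²(ℝ³)` (the space of the pair
wavefunctions, invariant under the operator when `V` is even), has a negative eigenvalue. -/
def HasNegativeEigenvalue (V : R3 → ℝ) (μ T : ℝ) : Prop :=
  ∃ e : ℝ, e < 0 ∧ ∃ ψ : L2, ψ ≠ 0 ∧ IsEven ψ ∧ LinOpGraph V μ T ψ ((e : ℂ) • ψ)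

end

end BCS

namespace BCS

/-! ### Scalar inequalities for the thermal weight and the pressure -/

section Scalar

/-! Write ξ = p² - μ, E = √(ξ² + |Δ|²), and P(e) = T ln(2 cosh(e/2T)) for `pressure`. A pair
function α ∈ H¹ is parametrized by f ∈ L² through α̂ = (1+p²)^{-1/2} f (`bessel`); the forms of
K_T^0 and V then become bounded operators (`kinOp`, `vOp`).

Three scalar facts carry the energy estimates: P is convex in E with P'(E) = E/(2K); P is concave in
E² with slope 1/(4K); and K is strictly increasing in E ≥ 0. They persist for T = 0, where P = |E|/2
and K = |E|, so zero temperature is treated together with T > 0. On the analytic side, H¹ ⊆ L⁶ makes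
V infinitesimally form bounded, and ∫V|α|² is weakly continuous on bounded sequences
(`tendsto_potQuad`); this feeds the direct method (`exists_minimizer`), which is used twice.

(i) ⇒ (ii). The Gibbs variational principle removes γ: for every even g, F(γ,α) ≥ F(γ₀,0) + ∫V|α|² +
Re⟨g,f⟩ - W(g), where W = `condensation` is the total gain in pressure (`le_freeEnergy`). Thus every
state gives a point in the epigraph of the Legendre transform W*, and instability says that W* +
∫V|α|² takes a negative value. The epigraph is convex and weakly closed, so a minimizer f exists,
nonzero because the minimum is negative. Varying along segments of the epigraph gives -2Vf ∈ ∂W*(f),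
hence f ∈ ∂W(-2Vf) by Fenchel duality, and ∂W consists of the derivative alone (`eq_dualField`). In
momentum space this reads α̂ = -Δ/(2K_T^Δ), and convolution with V̂ produces the gap equation.

(ii) ⇒ (iii). Test K_T^0 + V with the function φ whose transform is Δ/K_T^Δ. The gap equation says
that the transform of Vφ is -Δ, so the form equals -∫(K_T^Δ - K_T^0)|Δ|²/(K_T^Δ)², which is negative
since K_T^Δ > K_T^0 wherever Δ ≠ 0. Minimizing the form over even functions of norm at most one
turns the negative value into an eigenvalue.

(iii) ⇒ (i). An eigenfunction makes the form negative. For a thermal state with pairing field d the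
Gibbs inequality is an equality, and concavity of P in E² bounds its energy excess by ∫V|α|² +
½Re⟨d,f⟩. Letting d tend to zero along a suitable sequence recovers the quadratic form in the limit,
without any second derivative of F. -/

theorem lt_sinh_mul_cosh {t : ℝ} (ht : 0 < t) : t < Real.sinh t * Real.cosh t := by
  have h1 := Real.self_lt_sinh_iff.2 ht
  have h2 := Real.one_le_cosh t
  nlinarith

theorem tanh_pos {t : ℝ} (ht : 0 < t) : 0 < Real.tanh t := by
  rw [Real.tanh_eq_sinh_div_cosh]
  exact div_pos (Real.sinh_pos_iff.2 ht) (Real.cosh_pos t)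

theorem hasDerivAt_div_tanh {t : ℝ} (ht : 0 < t) :
    HasDerivAt (fun x => x / Real.tanh x)
      ((Real.sinh t * Real.cosh t - t) / Real.sinh t ^ 2) t := by
  have hs : Real.sinh t ≠ 0 := (Real.sinh_pos_iff.2 ht).ne'
  have h := ((hasDerivAt_id t).mul (Real.hasDerivAt_cosh t)).div (Real.hasDerivAt_sinh t) hs
  refine (h.congr_of_eventuallyEq ?_).congr_deriv ?_
  · filter_upwards with x
    simp [Real.tanh_eq_sinh_div_cosh, div_div_eq_mul_div]
  · have := Real.cosh_sq t
    simp only [id_eq, Pi.mul_apply]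
    congr 1
    linear_combination (-t) * this

/-- The numerator of the derivative is sinh t cosh t - t > 0. Both the monotonicity of K in E and
the concavity of log cosh in the square of its argument come from here. -/
theorem strictMonoOn_div_tanh : StrictMonoOn (fun x => x / Real.tanh x) (Set.Ioi 0) := by
  refine strictMonoOn_of_deriv_pos (convex_Ioi 0)
    (fun t ht => (hasDerivAt_div_tanh ht).continuousAt.continuousWithinAt) fun t ht => ?_
  rw [interior_Ioi] at ht
  rw [(hasDerivAt_div_tanh ht).deriv]
  have := lt_sinh_mul_cosh ht
  exact div_pos (by linarith) (pow_pos (Real.sinh_pos_iff.2 ht) 2)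

theorem hasDerivAt_log_cosh (t : ℝ) :
    HasDerivAt (fun x => Real.log (Real.cosh x)) (Real.tanh t) t := by
  rw [Real.tanh_eq_sinh_div_cosh]
  exact (Real.hasDerivAt_cosh t).log (Real.cosh_pos t).ne'

theorem tanh_le_self {t : ℝ} (ht : 0 ≤ t) : Real.tanh t ≤ t := by
  have hd (x : ℝ) : HasDerivAt (fun x => x - Real.tanh x) (Real.tanh x ^ 2) x := by
    have hc := (Real.cosh_pos x).ne'
    have h := (hasDerivAt_id x).sub ((Real.hasDerivAt_sinh x).div (Real.hasDerivAt_cosh x) hc)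
    refine (h.congr_of_eventuallyEq ?_).congr_deriv ?_
    · filter_upwards with y
      simp [Real.tanh_eq_sinh_div_cosh]
    · rw [Real.tanh_eq_sinh_div_cosh]
      field_simp
      ring
  have hm : Monotone (fun x => x - Real.tanh x) :=
    monotone_of_hasDerivAt_nonneg hd fun x => by positivity
  have := hm ht
  simp at this
  linarith

/-- Strictness is obtained by comparing t with t/2: the quotient t / tanh t is at least one at t/2
and increases strictly. -/
theorem tanh_lt_self {t : ℝ} (ht : 0 < t) : Real.tanh t < t := by
  have h := strictMonoOn_div_tanh (Set.mem_Ioi.2 (half_pos ht)) (Set.mem_Ioi.2 ht)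
    (half_lt_self ht)
  have h1 : 1 ≤ (t / 2) / Real.tanh (t / 2) := by
    rw [one_le_div (tanh_pos (half_pos ht))]
    exact tanh_le_self (half_pos ht).le
  have h2 := h1.trans_lt h
  rwa [one_lt_div (tanh_pos ht)] at h2

theorem continuous_tanh : Continuous Real.tanh := by
  have : Real.tanh = fun x => Real.sinh x / Real.cosh x := by
    ext x; exact Real.tanh_eq_sinh_div_cosh x
  rw [this]
  exact Real.continuous_sinh.div Real.continuous_cosh fun x => (Real.cosh_pos x).ne'

/-- `log cosh` lies above its tangent lines. -/
theorem log_cosh_tangent_le (x y : ℝ) :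
    Real.log (Real.cosh x) + Real.tanh x * (y - x) ≤ Real.log (Real.cosh y) := by
  have hm : ConvexOn ℝ Set.univ (fun x => Real.log (Real.cosh x)) := by
    refine MonotoneOn.convexOn_of_deriv convex_univ
      (fun t _ => (hasDerivAt_log_cosh t).continuousAt.continuousWithinAt)
      (fun t _ => (hasDerivAt_log_cosh t).differentiableAt.differentiableWithinAt) ?_
    have : deriv (fun x => Real.log (Real.cosh x)) = Real.tanh :=
      funext fun t => (hasDerivAt_log_cosh t).deriv
    rw [this]
    refine Monotone.monotoneOn ?_ _
    have hd (x : ℝ) : HasDerivAt Real.tanh (1 / Real.cosh x ^ 2) x := by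
      have hc := (Real.cosh_pos x).ne'
      have h := (Real.hasDerivAt_sinh x).div (Real.hasDerivAt_cosh x) hc
      refine (h.congr_of_eventuallyEq ?_).congr_deriv ?_
      · filter_upwards with y
        simp [Real.tanh_eq_sinh_div_cosh]
      · have := Real.cosh_sq x
        congr 1
        linear_combination this
    exact monotone_of_hasDerivAt_nonneg hd fun x => by positivity
  rcases lt_trichotomy x y with h | h | h
  · have := hm.le_slope_of_hasDerivAt (Set.mem_univ x) (Set.mem_univ y) h (hasDerivAt_log_cosh x)
    rw [slope_def_field, le_div_iff₀ (by linarith)] at this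
    linarith
  · simp [h]
  · have := hm.slope_le_of_hasDerivAt (Set.mem_univ y) (Set.mem_univ x) h (hasDerivAt_log_cosh x)
    rw [slope_def_field, div_le_iff₀ (by linarith)] at this
    linarith

/-- `log cosh` is concave as a function of the square of its argument. -/
theorem log_cosh_sub_le {x y : ℝ} (hx : 0 < x) (hy : 0 ≤ y) :
    Real.log (Real.cosh y) - Real.log (Real.cosh x) ≤
      (y ^ 2 - x ^ 2) * (Real.tanh x / (2 * x)) := by
  set c := Real.tanh x / x with hc
  -- The derivative is t (tanh t / t - c). As tanh t / t decreases and equals c at x, the function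
  -- increases up to x and decreases afterwards, so its maximum over t ≥ 0 is at x.
  have hd (t : ℝ) : HasDerivAt (fun t => Real.log (Real.cosh t) - t ^ 2 * (c / 2))
      (Real.tanh t - t * c) t := by
    refine ((hasDerivAt_log_cosh t).sub (((hasDerivAt_id t).pow 2).mul_const (c / 2))).congr_deriv ?_
    simp only [id_eq]; ring
  have hcont : Continuous (fun t => Real.log (Real.cosh t) - t ^ 2 * (c / 2)) :=
    continuous_iff_continuousAt.2 fun t => (hd t).continuousAt
  have key : Real.log (Real.cosh y) - y ^ 2 * (c / 2) ≤
      Real.log (Real.cosh x) - x ^ 2 * (c / 2) := by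
    rcases le_total y x with hyx | hxy
    · refine monotoneOn_of_deriv_nonneg (convex_Icc 0 x) hcont.continuousOn
        (fun t _ => (hd t).differentiableAt.differentiableWithinAt) (fun t ht => ?_)
        ⟨hy, hyx⟩ ⟨hx.le, le_rfl⟩ hyx
      rw [interior_Icc] at ht
      rw [(hd t).deriv]
      have h := strictMonoOn_div_tanh.monotoneOn (Set.mem_Ioi.2 ht.1) (Set.mem_Ioi.2 hx) ht.2.le
      beta_reduce at h
      rw [div_le_div_iff₀ (tanh_pos ht.1) (tanh_pos hx)] at h
      rw [hc, sub_nonneg, ← mul_div_assoc, div_le_iff₀ hx]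
      linarith
    · refine antitoneOn_of_deriv_nonpos (convex_Ici x) hcont.continuousOn
        (fun t _ => (hd t).differentiableAt.differentiableWithinAt) (fun t ht => ?_)
        (Set.mem_Ici.2 le_rfl) hxy hxy
      rw [interior_Ici] at ht
      rw [(hd t).deriv]
      have ht0 : 0 < t := hx.trans ht
      have h := strictMonoOn_div_tanh.monotoneOn (Set.mem_Ioi.2 hx) (Set.mem_Ioi.2 ht0) ht.le
      beta_reduce at h
      rw [div_le_div_iff₀ (tanh_pos hx) (tanh_pos ht0)] at h
      rw [hc, sub_nonpos, ← mul_div_assoc, le_div_iff₀ hx]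
      linarith
  have : Real.tanh x / (2 * x) = c / 2 := by rw [hc]; field_simp
  rw [this]
  linarith

/-- The case x = 0 of the preceding bound, where the slope tanh x / (2x) has the limit 1/2. -/
theorem log_cosh_le (y : ℝ) : Real.log (Real.cosh y) ≤ y ^ 2 / 2 := by
  rw [Real.log_le_iff_le_exp (Real.cosh_pos y)]
  exact Real.cosh_le_exp_half_sq y

/-! #### The thermal weight -/

theorem thermal_neg (T e : ℝ) : thermal T (-e) = thermal T e := by
  unfold thermal
  simp only [abs_neg, neg_eq_zero, neg_div, Real.tanh_neg, div_neg, neg_neg]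

theorem thermal_abs (T e : ℝ) : thermal T |e| = thermal T e := by
  rcases abs_choice e with h | h <;> rw [h]
  exact thermal_neg T e

theorem thermal_zero_left (e : ℝ) : thermal 0 e = |e| := by simp [thermal]

theorem thermal_of_pos {T e : ℝ} (hT : 0 < T) (he : 0 < e) :
    thermal T e = 2 * T * ((e / (2 * T)) / Real.tanh (e / (2 * T))) := by
  unfold thermal
  rw [if_neg hT.ne', if_neg he.ne']
  field_simp

theorem thermal_zero_right (T : ℝ) : thermal T 0 = 2 * T := by
  simp only [thermal, if_true]
  split_ifs with h
  · simp [h]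
  · rfl

theorem strictMonoOn_thermal {T : ℝ} (hT : 0 ≤ T) : StrictMonoOn (thermal T) (Set.Ici 0) := by
  intro a ha b hb hab
  rw [Set.mem_Ici] at ha hb
  rcases hT.eq_or_lt with rfl | hT
  · simpa [thermal_zero_left, abs_of_nonneg ha, abs_of_nonneg hb] using hab
  have hb0 : 0 < b := ha.trans_lt hab
  have hb' : 0 < b / (2 * T) := by positivity
  rcases ha.eq_or_lt with rfl | ha
  · rw [thermal_zero_right, thermal_of_pos hT hb0]
    have := (one_lt_div (tanh_pos hb')).2 (tanh_lt_self hb')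
    nlinarith
  · rw [thermal_of_pos hT ha, thermal_of_pos hT hb0]
    have ha' : 0 < a / (2 * T) := by positivity
    have := strictMonoOn_div_tanh (Set.mem_Ioi.2 ha') (Set.mem_Ioi.2 hb')
      (div_lt_div_of_pos_right hab (by positivity))
    simp only at this
    exact mul_lt_mul_of_pos_left this (by positivity)

/-- From |tanh| < 1. This is the source of K ≥ p² - μ, of the slope bound on the pressure, and of
|α̂| ≤ 1/2 for solutions of the gap equation. -/
theorem abs_le_thermal {T : ℝ} (hT : 0 ≤ T) (e : ℝ) : |e| ≤ thermal T e := by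
  rw [← thermal_abs]
  rcases hT.eq_or_lt with rfl | hT
  · simp [thermal_zero_left]
  rcases (abs_nonneg e).eq_or_lt with h | h
  · rw [← h, thermal_zero_right]; positivity
  · unfold thermal
    rw [if_neg hT.ne', if_neg h.ne', le_div_iff₀ (tanh_pos (by positivity))]
    have := Real.tanh_lt_one (|e| / (2 * T))
    nlinarith

theorem thermal_nonneg {T : ℝ} (hT : 0 ≤ T) (e : ℝ) : 0 ≤ thermal T e :=
  (abs_nonneg e).trans (abs_le_thermal hT e)

theorem thermal_pos {T : ℝ} (hT : 0 ≤ T) {e : ℝ} (he : e ≠ 0) : 0 < thermal T e :=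
  (abs_pos.2 he).trans_le (abs_le_thermal hT e)

/-- Together with the lower bound this shows that K_T^0 grows like p², so that its form is defined
on all of H¹. -/
theorem thermal_le {T : ℝ} (hT : 0 ≤ T) (e : ℝ) : thermal T e ≤ |e| + 2 * T := by
  rw [← thermal_abs]
  rcases hT.eq_or_lt with rfl | hT
  · simp [thermal_zero_left]
  rcases (abs_nonneg e).eq_or_lt with h | h
  · rw [← h, thermal_zero_right]; simp
  · rw [thermal_of_pos hT h]
    set x := |e| / (2 * T) with hx
    have hx0 : 0 < x := by positivity
    have he : |e| = 2 * T * x := by rw [hx]; field_simp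
    rw [he, ← mul_add_one]
    refine mul_le_mul_of_nonneg_left ?_ (by positivity)
    rw [div_le_iff₀ (tanh_pos hx0), Real.tanh_eq_sinh_div_cosh, ← mul_div_assoc,
      le_div_iff₀ (Real.cosh_pos x)]
    -- `x (cosh x - sinh x) = x e^{-x} ≤ sinh x`
    have h1 : Real.cosh x - Real.sinh x = Real.exp (-x) := Real.cosh_sub_sinh x
    have h2 := Real.self_le_sinh_iff.2 hx0.le
    have h3 : Real.exp (-x) ≤ 1 := Real.exp_le_one_iff.2 (by linarith)
    nlinarith

theorem measurable_thermal (T : ℝ) : Measurable (thermal T) := by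
  unfold thermal
  refine Measurable.ite (by simp) (by fun_prop) (Measurable.ite (by simp) (by fun_prop) ?_)
  exact measurable_id.div (continuous_tanh.measurable.comp (by fun_prop))

/-! #### The pressure -/

/-- `T ln (2 cosh (e / 2T))`, with its limiting value `|e| / 2` for `T = 0`. -/
noncomputable def pressure (T e : ℝ) : ℝ :=
  if T = 0 then |e| / 2 else T * Real.log (2 * Real.cosh (e / (2 * T)))

theorem pressure_zero_left (e : ℝ) : pressure 0 e = |e| / 2 := by simp [pressure]

theorem pressure_of_pos {T : ℝ} (hT : 0 < T) (e : ℝ) :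
    pressure T e = T * Real.log 2 + T * Real.log (Real.cosh (e / (2 * T))) := by
  unfold pressure
  rw [if_neg hT.ne', Real.log_mul (by norm_num) (Real.cosh_pos _).ne']
  ring

theorem pressure_neg (T e : ℝ) : pressure T (-e) = pressure T e := by
  simp [pressure, neg_div]

theorem pressure_abs (T e : ℝ) : pressure T |e| = pressure T e := by
  rcases abs_choice e with h | h <;> rw [h]
  exact pressure_neg T e

theorem measurable_pressure (T : ℝ) : Measurable (pressure T) := by
  unfold pressure
  exact Measurable.ite (by simp) (by fun_prop) (by fun_prop)

/-- Concavity of the pressure in E², whose slope there is 1/(4K). For T = 0 the bound is (E' - E)² ≥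
0; for E = 0 < T it is log cosh y ≤ y²/2. -/
theorem pressure_sub_le {T : ℝ} (hT : 0 ≤ T) {E E' : ℝ} (hE : 0 ≤ E) (hE' : 0 ≤ E')
    (hK : 0 < thermal T E) :
    pressure T E' - pressure T E ≤ (E' ^ 2 - E ^ 2) / (4 * thermal T E) := by
  rcases hT.eq_or_lt with rfl | hT
  · rw [thermal_zero_left, abs_of_nonneg hE] at *
    rw [pressure_zero_left, pressure_zero_left, abs_of_nonneg hE, abs_of_nonneg hE',
      le_div_iff₀ (by linarith)]
    nlinarith [sq_nonneg (E' - E)]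
  · rw [pressure_of_pos hT, pressure_of_pos hT]
    rcases hE.eq_or_lt with rfl | hE
    · have := log_cosh_le (E' / (2 * T))
      rw [thermal_zero_right]
      have h2 : (E' ^ 2 - 0 ^ 2) / (4 * (2 * T)) = T * ((E' / (2 * T)) ^ 2 / 2) := by
        field_simp; ring
      rw [h2]
      simp
      nlinarith
    · have h := log_cosh_sub_le (x := E / (2 * T)) (y := E' / (2 * T)) (by positivity)
        (by positivity)
      have h2 : (E' ^ 2 - E ^ 2) / (4 * thermal T E) = T * (((E' / (2 * T)) ^ 2 -
          (E / (2 * T)) ^ 2) * (Real.tanh (E / (2 * T)) / (2 * (E / (2 * T))))) := by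
        rw [thermal_of_pos hT hE]
        have := tanh_pos (t := E / (2 * T)) (by positivity)
        field_simp
        ring
      rw [h2]
      nlinarith

/-- Convexity of the pressure in E: the graph lies above its tangent, of slope E/(2K) =
tanh(E/2T)/2. At T = 0 it is an equality. -/
theorem pressure_tangent_le {T : ℝ} (hT : 0 ≤ T) {E E' : ℝ} (hE : 0 ≤ E) (hE' : 0 ≤ E')
    (hK : 0 < thermal T E) :
    E * (E' - E) / (2 * thermal T E) ≤ pressure T E' - pressure T E := by
  rcases hT.eq_or_lt with rfl | hT
  · rw [thermal_zero_left, abs_of_nonneg hE] at *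
    rw [pressure_zero_left, pressure_zero_left, abs_of_nonneg hE, abs_of_nonneg hE']
    apply le_of_eq
    field_simp
  · rw [pressure_of_pos hT, pressure_of_pos hT]
    have h := log_cosh_tangent_le (E / (2 * T)) (E' / (2 * T))
    have h2 : E * (E' - E) / (2 * thermal T E) =
        T * (Real.tanh (E / (2 * T)) * (E' / (2 * T) - E / (2 * T))) := by
      rcases hE.eq_or_lt with rfl | hE
      · simp
      rw [thermal_of_pos hT hE]
      have := tanh_pos (t := E / (2 * T)) (by positivity)
      field_simp
    rw [h2]
    nlinarith

theorem pressure_mono {T : ℝ} (hT : 0 ≤ T) {E E' : ℝ} (hE : 0 ≤ E) (h : E ≤ E') :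
    pressure T E ≤ pressure T E' := by
  rcases (thermal_nonneg hT E).eq_or_lt with h0 | hK
  · rcases hT.eq_or_lt with rfl | hT
    · rw [pressure_zero_left, pressure_zero_left, abs_of_nonneg hE, abs_of_nonneg (hE.trans h)]
      linarith
    · rcases hE.eq_or_lt with rfl | hE
      · rw [thermal_zero_right] at h0; linarith
      · exact absurd h0 (thermal_pos hT.le hE.ne').ne
  · have := pressure_tangent_le hT hE (hE.trans h) hK
    have h2 : 0 ≤ E * (E' - E) / (2 * thermal T E) :=
      div_nonneg (mul_nonneg hE (by linarith)) (by linarith)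
    linarith

/-- The slope E/(2K) never exceeds 1/2. This linear bound replaces the quadratic one near the Fermi
surface, where 1/K may blow up. -/
theorem pressure_sub_le_half {T : ℝ} (hT : 0 ≤ T) {E E' : ℝ} (hE : 0 ≤ E) (h : E ≤ E') :
    pressure T E' - pressure T E ≤ (E' - E) / 2 := by
  rcases (hE.trans h).eq_or_lt with h0 | h0
  · obtain rfl : E' = 0 := h0.symm
    obtain rfl : E = 0 := le_antisymm h hE
    simp
  have hK := thermal_pos hT h0.ne'
  have h1 := pressure_tangent_le hT h0.le hE hK
  have h2 := abs_le_thermal hT E'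
  rw [abs_of_pos h0] at h2
  have h3 : (E - E') / 2 ≤ E' * (E - E') / (2 * thermal T E') := by
    rw [div_le_div_iff₀ (by norm_num) (by positivity)]
    nlinarith
  linarith

theorem pressure_nonneg {T : ℝ} (hT : 0 ≤ T) (e : ℝ) : 0 ≤ pressure T e := by
  rw [← pressure_abs]
  refine le_trans ?_ (pressure_mono hT le_rfl (abs_nonneg e))
  rcases hT.eq_or_lt with rfl | hT
  · simp [pressure]
  · rw [pressure_of_pos hT]
    have := Real.log_nonneg (x := 2) (by norm_num)
    simp; positivity

theorem pressure_le {T : ℝ} (hT : 0 ≤ T) (e : ℝ) : pressure T e ≤ |e| / 2 + T := by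
  have h := pressure_sub_le_half hT le_rfl (abs_nonneg e)
  rw [pressure_abs] at h
  have h0 : pressure T 0 ≤ T := by
    rcases hT.eq_or_lt with rfl | hT
    · simp [pressure]
    · rw [pressure_of_pos hT]
      have := Real.log_two_lt_d9
      simp; nlinarith
  linarith

/-- The left side is cosh(x/T) / cosh(E/2T): P is the logarithm of the partition function of the
levels ±E/2, and moving the levels closer together decreases that function. -/
theorem exp_neg_pressure_add_le {T : ℝ} (hT : 0 < T) {x E : ℝ} (hx : |x| ≤ E / 2) :
    Real.exp (-(pressure T E + x) / T) + Real.exp (-(pressure T E - x) / T) ≤ 1 := by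
  have h1 : Real.exp (-(pressure T E) / T) = (2 * Real.cosh (E / (2 * T)))⁻¹ := by
    unfold pressure
    rw [if_neg hT.ne', ← mul_neg, mul_div_cancel_left₀ _ hT.ne', Real.exp_neg,
      Real.exp_log (mul_pos two_pos (Real.cosh_pos _))]
  have h2 : Real.exp (-(pressure T E + x) / T) + Real.exp (-(pressure T E - x) / T) =
      Real.exp (-(pressure T E) / T) * (2 * Real.cosh (x / T)) := by
    rw [Real.cosh_eq, mul_div_cancel₀ _ two_ne_zero, mul_add, ← Real.exp_add, ← Real.exp_add,
      add_comm]
    congr 2 <;> ring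
  rw [h2, h1, inv_mul_le_iff₀ (mul_pos two_pos (Real.cosh_pos _)), mul_one]
  refine mul_le_mul_of_nonneg_left ?_ two_pos.le
  rw [Real.cosh_le_cosh, abs_div, abs_of_pos hT, div_le_iff₀ hT]
  have : |E / (2 * T)| * T = |E| / 2 := by
    rw [abs_div, abs_of_pos (by positivity : (0:ℝ) < 2 * T)]; field_simp
  rw [this]
  exact hx.trans (div_le_div_of_nonneg_right (le_abs_self E) two_pos.le)

theorem div_thermal {T : ℝ} (hT : 0 < T) (e : ℝ) : e / thermal T e = Real.tanh (e / (2 * T)) := by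
  by_cases he : e = 0
  · simp [he]
  · unfold thermal
    rw [if_neg hT.ne', if_neg he]
    field_simp

/-- The occupation numbers of a quasi-particle are (1 ∓ tanh(E/2T))/2 = e^{∓x}/(2 cosh x) with x =
E/2T, so their logarithms are explicit. At T = 0 they are 0 and 1 and both sides vanish. -/
theorem entropy_thermal {T : ℝ} (hT : 0 ≤ T) {E : ℝ} (hE : 0 ≤ E) (hK : 0 < thermal T E) :
    T * (Real.negMulLog ((1 - E / thermal T E) / 2) +
      Real.negMulLog (1 - (1 - E / thermal T E) / 2)) =
      pressure T E - E ^ 2 / (2 * thermal T E) := by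
  rcases hT.eq_or_lt with rfl | hT
  · rw [thermal_zero_left, abs_of_nonneg hE] at *
    rw [pressure_zero_left, abs_of_nonneg hE]
    field_simp
    simp
  · set x := E / (2 * T) with hx
    have h2 : E ^ 2 / (2 * thermal T E) = T * (x * Real.tanh x) := by
      rw [← div_thermal hT E, hx]; field_simp
    have hc : (0 : ℝ) < 2 * Real.cosh x := mul_pos two_pos (Real.cosh_pos x)
    have h3 : (1 - E / thermal T E) / 2 = Real.exp (-x) / (2 * Real.cosh x) := by
      rw [div_thermal hT, ← hx, Real.tanh_eq_sinh_div_cosh, ← Real.cosh_sub_sinh]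
      have := (Real.cosh_pos x).ne'
      field_simp
    have h4 : 1 - (1 - E / thermal T E) / 2 = Real.exp x / (2 * Real.cosh x) := by
      rw [h3, ← Real.cosh_sub_sinh x, ← Real.cosh_add_sinh x]
      have := (Real.cosh_pos x).ne'
      field_simp
      ring
    have h5 : pressure T E = T * Real.log (2 * Real.cosh x) := by
      rw [hx]; unfold pressure; rw [if_neg hT.ne']
    rw [h2, h4, h3, h5, Real.negMulLog, Real.negMulLog, Real.log_div (Real.exp_ne_zero _) hc.ne',
      Real.log_div (Real.exp_ne_zero _) hc.ne', Real.log_exp, Real.log_exp]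
    have h6 : Real.exp x / (2 * Real.cosh x) = 1 - Real.exp (-x) / (2 * Real.cosh x) := by
      rw [← h4, h3]
    have h7 : Real.tanh x = 1 - 2 * (Real.exp (-x) / (2 * Real.cosh x)) := by
      rw [← h3, div_thermal hT, ← hx]; ring
    rw [h6, h7]
    ring

/-- Exhibits the normal state as the thermal state with zero pairing field. The hypothesis excludes
the Fermi sphere at T = 0, where 0/0 = 0 would give the value 1/2. -/
theorem normalGamma_eq {T : ℝ} (hT : 0 ≤ T) (μ : ℝ) (p : R3)
    (hK : 0 < thermal T (‖p‖ ^ 2 - μ)) :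
    normalGamma μ T p = (1 - (‖p‖ ^ 2 - μ) / thermal T (‖p‖ ^ 2 - μ)) / 2 := by
  unfold normalGamma
  rcases hT.eq_or_lt with rfl | hT
  · rw [thermal_zero_left] at *
    have h0 := abs_pos.1 hK
    rw [if_pos rfl]
    split_ifs with h
    · rw [abs_of_neg (by linarith), div_neg, div_self h0]; norm_num
    · rw [abs_of_nonneg (by linarith), div_self h0]; norm_num
  · rw [if_neg hT.ne', div_thermal hT, Real.tanh_eq]
    set x := (‖p‖ ^ 2 - μ) / (2 * T) with hx
    have : (‖p‖ ^ 2 - μ) / T = x + x := by rw [hx]; field_simp; ring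
    rw [this, Real.exp_add, Real.exp_neg]
    have := Real.exp_pos x
    field_simp
    ring

end Scalar

/-! ### Entropy of Hermitian `2 × 2` matrices -/

section TwoByTwo

open Matrix

theorem trace_cfc {n : Type*} [Fintype n] [DecidableEq n] {A : Matrix n n ℂ} (hA : A.IsHermitian)
    (f : ℝ → ℝ) : (cfc f A).trace = ∑ i, (f (hA.eigenvalues i) : ℂ) := by
  rw [hA.cfc_eq, IsHermitian.cfc, Unitary.conjStarAlgAut_apply, Matrix.trace_mul_comm, ← mul_assoc]
  simp [Matrix.trace]

theorem hermitian_apply_eq_sum {n : Type*} [Fintype n] [DecidableEq n] {A : Matrix n n ℂ}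
    (hA : A.IsHermitian) (i j : n) :
    A i j = ∑ k, (hA.eigenvalues k : ℂ) *
      ((hA.eigenvectorUnitary : Matrix n n ℂ) i k *
        conj ((hA.eigenvectorUnitary : Matrix n n ℂ) j k)) := by
  conv_lhs => rw [hA.spectral_theorem, Unitary.conjStarAlgAut_apply]
  simp only [mul_apply, diagonal_apply, star_apply]
  refine Finset.sum_congr rfl fun k _ => ?_
  simp
  ring

theorem eigenvalues_mem_Icc {n : Type*} [Fintype n] [DecidableEq n] {A : Matrix n n ℂ}
    (hA : A.PosSemidef) (hA1 : (1 - A).PosSemidef) (i : n) :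
    hA.1.eigenvalues i ∈ Set.Icc (0 : ℝ) 1 := by
  refine ⟨hA.eigenvalues_nonneg i, ?_⟩
  set v := (hA.1.eigenvectorBasis i).ofLp with hv
  have h := hA1.dotProduct_mulVec_nonneg v
  have h1 : star v ⬝ᵥ v = 1 := by
    have := hA.1.eigenvectorBasis.orthonormal.1 i
    have h2 := inner_self_eq_norm_sq_to_K (𝕜 := ℂ) (hA.1.eigenvectorBasis i)
    rw [this, EuclideanSpace.inner_eq_star_dotProduct, dotProduct_comm] at h2
    simpa using h2
  rw [sub_mulVec, one_mulVec, dotProduct_sub, hA.1.mulVec_eigenvectorBasis, dotProduct_smul, h1] at h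
  rw [Complex.le_def] at h
  simpa using h.1

/-- Young's inequality for the conjugate pair a ln a and exp(y - 1), applied at -y; it allows a = 0.
-/
theorem negMulLog_le_mul_add_exp {a : ℝ} (ha : 0 ≤ a) (y : ℝ) :
    Real.negMulLog a ≤ a * y + Real.exp (-y - 1) := by
  rcases ha.eq_or_lt with rfl | ha
  · simp; positivity
  have h := Real.add_one_le_exp (-y - 1 - Real.log a)
  rw [Real.exp_sub, Real.exp_log ha, le_div_iff₀ ha] at h
  rw [Real.negMulLog]
  nlinarith

/-- **Gibbs variational principle** for `2 × 2` matrices `0 ≤ A ≤ 1` and the Hamiltonian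
with rows `(ξ, d)` and `(conj d, -ξ)`. -/
theorem mul_trace_negMulLog_le {T : ℝ} (hT : 0 ≤ T) {A : Matrix (Fin 2) (Fin 2) ℂ}
    (hA : A.PosSemidef) (hA1 : (1 - A).PosSemidef) (ξ : ℝ) (d : ℂ) :
    T * (cfc Real.negMulLog A).trace.re ≤
      ξ / 2 * ((A 0 0).re - (A 1 1).re) + (conj d * A 0 1).re +
        pressure T (Real.sqrt (ξ ^ 2 + ‖d‖ ^ 2)) * ((A 0 0).re + (A 1 1).re) +
        T * (1 - ((A 0 0).re + (A 1 1).re)) := by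
  set E := Real.sqrt (ξ ^ 2 + ‖d‖ ^ 2) with hE
  have hE2 : E ^ 2 = ξ ^ 2 + ‖d‖ ^ 2 := Real.sq_sqrt (by positivity)
  have hE0 : 0 ≤ E := Real.sqrt_nonneg _
  set l := hA.1.eigenvalues with hl
  set u := (hA.1.eigenvectorUnitary : Matrix (Fin 2) (Fin 2) ℂ) with hu
  have hl0 (i) := (eigenvalues_mem_Icc hA hA1 i).1
  have hUU : u * star u = 1 := Unitary.coe_mul_star_self _
  have hUU' : star u * u = 1 := Unitary.coe_star_mul_self _
  have e (i j : Fin 2) : A i j = l 0 * (u i 0 * conj (u j 0)) + l 1 * (u i 1 * conj (u j 1)) := by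
    rw [hermitian_apply_eq_sum hA.1 i j, Fin.sum_univ_two]
  have n (i) : Complex.normSq (u 0 i) + Complex.normSq (u 1 i) = 1 := by
    have := congrFun (congrFun hUU' i) i
    rw [mul_apply, Fin.sum_univ_two, one_apply_eq] at this
    simp only [star_apply, RCLike.star_def, Complex.normSq_eq_conj_mul_self.symm] at this
    exact_mod_cast this
  have r : Complex.normSq (u 0 0) + Complex.normSq (u 0 1) = 1 := by
    have := congrFun (congrFun hUU 0) 0
    rw [mul_apply, Fin.sum_univ_two, one_apply_eq] at this
    simp only [star_apply, RCLike.star_def, Complex.mul_conj] at this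
    exact_mod_cast this
  have o : u 0 0 * conj (u 1 0) + u 0 1 * conj (u 1 1) = 0 := by
    have := congrFun (congrFun hUU 0) 1
    rw [mul_apply, Fin.sum_univ_two, one_apply_ne (by decide)] at this
    simpa only [star_apply, RCLike.star_def] using this
  -- expectation of half the Hamiltonian in the eigenvectors of `A`
  let x : Fin 2 → ℝ := fun i => ξ / 2 * (Complex.normSq (u 0 i) - Complex.normSq (u 1 i)) +
    (conj d * (u 0 i * conj (u 1 i))).re
  -- The Hamiltonian is traceless, so its expectations in an orthonormal basis are opposite.
  have hx01 : x 1 = -x 0 := by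
    have h1 : (conj d * (u 0 0 * conj (u 1 0))).re + (conj d * (u 0 1 * conj (u 1 1))).re = 0 := by
      rw [← Complex.add_re, ← mul_add, o]; simp
    simp only [x]
    have n0 := n 0
    have n1 := n 1
    linear_combination h1 + ξ * r - ξ / 2 * n0 - ξ / 2 * n1
  -- For a unit eigenvector the pair (s, 2‖w‖) is a unit vector of the plane; the bound is
  -- Cauchy-Schwarz against (|ξ|, ‖d‖), whose length is E.
  have hxE : |x 0| ≤ E / 2 := by
    set s := Complex.normSq (u 0 0) - Complex.normSq (u 1 0) with hs
    set w := u 0 0 * conj (u 1 0) with hw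
    have h1 : s ^ 2 + 4 * ‖w‖ ^ 2 = 1 := by
      have : ‖w‖ ^ 2 = Complex.normSq (u 0 0) * Complex.normSq (u 1 0) := by
        rw [Complex.sq_norm, hw, Complex.normSq_mul, Complex.normSq_conj]
      rw [this]
      have n0 := n 0
      rw [hs]
      linear_combination (Complex.normSq (u 0 0) + Complex.normSq (u 1 0) + 1) * n0
    have h2 : |(conj d * w).re| ≤ ‖d‖ * ‖w‖ := by
      refine (Complex.abs_re_le_norm _).trans ?_
      rw [norm_mul, RCLike.norm_conj]
    have h3 : |x 0| ≤ |ξ| / 2 * |s| + ‖d‖ * ‖w‖ := by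
      refine (abs_add_le _ _).trans (add_le_add ?_ h2)
      rw [abs_mul, abs_div, abs_two]
    refine h3.trans ?_
    refine abs_le_of_sq_le_sq' ?_ (by positivity) |>.2
    rw [div_pow, hE2, ← sq_abs ξ]
    rw [← sq_abs s] at h1
    nlinarith [sq_nonneg (|ξ| * (2 * ‖w‖) - ‖d‖ * |s|)]
  have hA00 : (A 0 0).re = l 0 * Complex.normSq (u 0 0) + l 1 * Complex.normSq (u 0 1) := by
    rw [e, Complex.mul_conj, Complex.mul_conj]
    norm_cast
  have hA11 : (A 1 1).re = l 0 * Complex.normSq (u 1 0) + l 1 * Complex.normSq (u 1 1) := by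
    rw [e, Complex.mul_conj, Complex.mul_conj]
    norm_cast
  have hA01 : (conj d * A 0 1).re =
      l 0 * (conj d * (u 0 0 * conj (u 1 0))).re + l 1 * (conj d * (u 0 1 * conj (u 1 1))).re := by
    rw [e, ← Complex.re_ofReal_mul, ← Complex.re_ofReal_mul, ← Complex.add_re]
    congr 1; ring
  have htr : (A 0 0).re + (A 1 1).re = l 0 + l 1 := by
    rw [hA00, hA11]
    linear_combination l 0 * n 0 + l 1 * n 1
  have hH : ξ / 2 * ((A 0 0).re - (A 1 1).re) + (conj d * A 0 1).re = l 0 * x 0 + l 1 * x 1 := by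
    rw [hA00, hA11, hA01]; simp only [x]; ring
  rw [hH, htr, hx01, trace_cfc hA.1, Fin.sum_univ_two]
  simp only [Complex.add_re, Complex.ofReal_re]
  rw [← hl]
  -- At T = 0 the claim is l 0 (E/2 + x 0) + l 1 (E/2 - x 0) ≥ 0, where all factors are nonnegative.
  rcases hT.eq_or_lt with rfl | hT
  · rw [pressure_zero_left, abs_of_nonneg hE0]
    have := abs_le.1 hxE
    have h0 := hl0 0
    have h1 := hl0 1
    nlinarith
  · set P := pressure T E with hP
    have key := exp_neg_pressure_add_le hT hxE
    -- The slopes are chosen so that the two exponential terms are the Boltzmann weights normalized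
    -- by the pressure, whose sum is at most one by `key`.
    have h0 := negMulLog_le_mul_add_exp (hl0 0) ((P + x 0) / T - 1)
    have h1 := negMulLog_le_mul_add_exp (hl0 1) ((P - x 0) / T - 1)
    have e0 : -((P + x 0) / T - 1) - 1 = -(P + x 0) / T := by ring
    have e1 : -((P - x 0) / T - 1) - 1 = -(P - x 0) / T := by ring
    rw [e0] at h0
    rw [e1] at h1
    have h2 := mul_le_mul_of_nonneg_left (add_le_add h0 h1) hT.le
    have h3 := mul_le_mul_of_nonneg_left key hT.le
    have e2 : T * (l 0 * ((P + x 0) / T - 1) + Real.exp (-(P + x 0) / T) +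
        (l 1 * ((P - x 0) / T - 1) + Real.exp (-(P - x 0) / T))) =
        l 0 * (P + x 0 - T) + l 1 * (P - x 0 - T) +
        T * (Real.exp (-(P + x 0) / T) + Real.exp (-(P - x 0) / T)) := by
      field_simp; ring
    have h2' := h2.trans_eq e2
    linarith

/-- The trace of `f(A)` for a Hermitian `2 × 2` matrix of trace one and determinant
`l (1 - l)`. -/
theorem trace_cfc_of_trace_eq_one {A : Matrix (Fin 2) (Fin 2) ℂ} (hA : A.IsHermitian) (f : ℝ → ℝ)
    {l : ℝ} (htr : A.trace = 1) (hdet : A.det = ((l * (1 - l) : ℝ) : ℂ)) :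
    (cfc f A).trace.re = f l + f (1 - l) := by
  rw [trace_cfc hA, Fin.sum_univ_two]
  have h1 := hA.trace_eq_sum_eigenvalues
  have h2 := hA.det_eq_prod_eigenvalues
  rw [htr, Fin.sum_univ_two] at h1
  rw [hdet, Fin.prod_univ_two] at h2
  have h1' : hA.eigenvalues 0 + hA.eigenvalues 1 = 1 := by
    simpa using (congrArg Complex.re h1).symm
  have h2' : hA.eigenvalues 0 * hA.eigenvalues 1 = l * (1 - l) := by
    simpa using (congrArg Complex.re h2).symm
  -- Trace and determinant determine the unordered pair of eigenvalues as {l, 1 - l}.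
  have h3 : (hA.eigenvalues 0 - l) * (hA.eigenvalues 0 - (1 - l)) = 0 := by
    have : hA.eigenvalues 1 = 1 - hA.eigenvalues 0 := by linarith
    rw [this] at h2'
    linear_combination -h2'
  have h4 : hA.eigenvalues 1 = 1 - hA.eigenvalues 0 := by linarith
  rw [h4]
  simp only [Complex.add_re, Complex.ofReal_re]
  rcases mul_eq_zero.1 h3 with h | h
  · rw [sub_eq_zero.1 h]
  · rw [sub_eq_zero.1 h, add_comm]; simp

theorem posSemidef_fin_two {a d : ℝ} {z : ℂ} (ha : 0 ≤ a) (hd : 0 ≤ d) (h : ‖z‖ ^ 2 ≤ a * d) :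
    (!![(a : ℂ), z; conj z, (d : ℂ)] : Matrix (Fin 2) (Fin 2) ℂ).PosSemidef := by
  refine PosSemidef.of_dotProduct_mulVec_nonneg ?_ fun v => ?_
  · ext i j
    fin_cases i <;> fin_cases j <;> simp
  · have h1 : star v ⬝ᵥ (!![(a : ℂ), z; conj z, (d : ℂ)] *ᵥ v) =
        ((a * ‖v 0‖ ^ 2 + 2 * (conj (v 0) * z * v 1).re + d * ‖v 1‖ ^ 2 : ℝ) : ℂ) := by
      simp only [dotProduct, mulVec, Fin.sum_univ_two, Pi.star_apply, RCLike.star_def, of_apply,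
        cons_val_zero, cons_val_one]
      push_cast
      rw [← Complex.conj_mul', ← Complex.conj_mul', Complex.re_eq_add_conj]
      simp only [map_mul, Complex.conj_conj]
      ring
    rw [h1]
    norm_cast
    have h2 : |(conj (v 0) * z * v 1).re| ≤ ‖v 0‖ * ‖z‖ * ‖v 1‖ := by
      refine (Complex.abs_re_le_norm _).trans ?_
      rw [norm_mul, norm_mul, RCLike.norm_conj]
    have h3 := (abs_le.1 h2).1
    have h4 : ‖z‖ ≤ √a * √d := by
      rw [← Real.sqrt_mul ha]
      exact Real.le_sqrt_of_sq_le h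
    have h5 : ‖v 0‖ * ‖z‖ * ‖v 1‖ ≤ ‖v 0‖ * (√a * √d) * ‖v 1‖ := by gcongr
    have h6 := sq_nonneg (√a * ‖v 0‖ - √d * ‖v 1‖)
    have h7 : (√a * ‖v 0‖ - √d * ‖v 1‖) ^ 2 =
        a * ‖v 0‖ ^ 2 + d * ‖v 1‖ ^ 2 - 2 * (‖v 0‖ * (√a * √d) * ‖v 1‖) := by
      rw [sub_sq, mul_pow, mul_pow, Real.sq_sqrt ha, Real.sq_sqrt hd]; ring
    linarith

end TwoByTwo

/-! ### The Fourier transform on `L²(ℝ³)` in the unitary convention -/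

section Hat

theorem finrank_R3 : Module.finrank ℝ R3 = 3 := by simp

theorem quasiMeasurePreserving_smul_R3 {a : ℝ} (ha : a ≠ 0) :
    Measure.QuasiMeasurePreserving (fun p : R3 => a • p) volume volume :=
  ⟨measurable_const_smul a, by
    rw [Measure.map_addHaar_smul _ ha]
    exact Measure.smul_absolutelyContinuous⟩

theorem memLp_two_iff_integrable {f : R3 → ℂ} (hf : AEStronglyMeasurable f volume) :
    MemLp f 2 volume ↔ Integrable (fun x => ‖f x‖ ^ 2) volume :=
  memLp_two_iff_integrable_sq_norm hf

theorem norm_sq_eq_integral (f : L2) : ‖f‖ ^ 2 = ∫ x, ‖f x‖ ^ 2 := by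
  have h := inner_self_eq_norm_sq_to_K (𝕜 := ℂ) f
  rw [MeasureTheory.L2.inner_def] at h
  have h2 : ∀ x, inner ℂ (f x) (f x) = ((‖f x‖ ^ 2 : ℝ) : ℂ) := fun x => by
    rw [inner_self_eq_norm_sq_to_K]; norm_cast
  simp_rw [h2] at h
  rw [integral_complex_ofReal] at h
  have h3 := congrArg Complex.re h
  rw [Complex.ofReal_re] at h3
  rw [h3, ← RCLike.ofReal_pow]
  rfl

theorem integrable_norm_sq (f : L2) : Integrable (fun x => ‖f x‖ ^ 2) volume :=
  (memLp_two_iff_integrable (Lp.aestronglyMeasurable f)).1 (Lp.memLp f)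

/-- The dilation of a function on `ℝ³`, normalized to preserve the `L²` norm. -/
noncomputable def dilFun (a : ℝ) (f : R3 → ℂ) (p : R3) : ℂ :=
  ((|a| ^ (3 / 2 : ℝ) : ℝ) : ℂ) * f (a • p)

theorem memLp_dilFun {a : ℝ} (ha : a ≠ 0) (f : L2) : MemLp (dilFun a f) 2 volume := by
  have hm : AEStronglyMeasurable (fun p => f (a • p)) volume :=
    (Lp.aestronglyMeasurable f).comp_quasiMeasurePreserving (quasiMeasurePreserving_smul_R3 ha)
  refine MemLp.const_mul ((memLp_two_iff_integrable hm).2 ?_) _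
  exact (integrable_comp_smul_iff volume (fun x => ‖f x‖ ^ 2) ha).2 (integrable_norm_sq f)

theorem norm_dilFun {a : ℝ} (ha : a ≠ 0) (f : L2) : ‖(memLp_dilFun ha f).toLp‖ = ‖f‖ := by
  rw [← sq_eq_sq₀ (norm_nonneg _) (norm_nonneg _), norm_sq_eq_integral, norm_sq_eq_integral]
  have h1 : ∫ x, ‖(memLp_dilFun ha f).toLp (dilFun a f) x‖ ^ 2 = ∫ x, |a| ^ 3 * ‖f (a • x)‖ ^ 2 := by
    refine integral_congr_ae ?_
    filter_upwards [(memLp_dilFun ha f).coeFn_toLp] with x hx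
    rw [hx, dilFun, norm_mul, mul_pow, Complex.norm_real, Real.norm_of_nonneg (by positivity),
      ← Real.rpow_mul_natCast (abs_nonneg a), ← Real.rpow_natCast |a|]
    norm_num
  rw [h1, integral_const_mul, Measure.integral_comp_smul volume (fun x => ‖f x‖ ^ 2),
    finrank_R3, smul_eq_mul, ← mul_assoc, abs_inv, abs_pow, mul_inv_cancel₀ (by positivity), one_mul]

theorem dilFun_toLp_inv {a b : ℝ} (ha : a ≠ 0) (hb : b ≠ 0) (hab : a * b = 1) (f : L2) :
    (memLp_dilFun ha (memLp_dilFun hb f).toLp).toLp = f := by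
  refine Lp.ext ?_
  filter_upwards [(memLp_dilFun ha (memLp_dilFun hb f).toLp).coeFn_toLp,
    (quasiMeasurePreserving_smul_R3 ha).ae_eq (memLp_dilFun hb f).coeFn_toLp] with x h1 h2
  simp only [Function.comp_apply] at h2
  rw [h1, dilFun, h2, dilFun, ← mul_assoc, ← Complex.ofReal_mul,
    ← Real.mul_rpow (abs_nonneg _) (abs_nonneg _), ← abs_mul, hab, smul_smul, mul_comm b, hab]
  simp

/-- The dilation as a unitary operator. -/
noncomputable def dilation (a : ℝ) (ha : a ≠ 0) : L2 ≃ₗᵢ[ℂ] L2 where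
  toFun f := (memLp_dilFun ha f).toLp
  invFun f := (memLp_dilFun (inv_ne_zero ha) f).toLp
  left_inv f := dilFun_toLp_inv (inv_ne_zero ha) ha (inv_mul_cancel₀ ha) f
  right_inv f := dilFun_toLp_inv ha (inv_ne_zero ha) (mul_inv_cancel₀ ha) f
  map_add' f g := by
    refine Lp.ext ?_
    filter_upwards [(memLp_dilFun ha (f + g)).coeFn_toLp, (memLp_dilFun ha f).coeFn_toLp,
      (memLp_dilFun ha g).coeFn_toLp, (quasiMeasurePreserving_smul_R3 ha).ae_eq (Lp.coeFn_add f g),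
      Lp.coeFn_add (memLp_dilFun ha f).toLp (memLp_dilFun ha g).toLp] with x h1 h2 h3 h4 h5
    simp only [Function.comp_apply, Pi.add_apply] at h4
    rw [h1, h5, Pi.add_apply, h2, h3, dilFun, dilFun, dilFun, h4, mul_add]
  map_smul' c f := by
    refine Lp.ext ?_
    filter_upwards [(memLp_dilFun ha (c • f)).coeFn_toLp, (memLp_dilFun ha f).coeFn_toLp,
      (quasiMeasurePreserving_smul_R3 ha).ae_eq (Lp.coeFn_smul c f),
      Lp.coeFn_smul c (memLp_dilFun ha f).toLp] with x h1 h2 h4 h5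
    simp only [Function.comp_apply, Pi.smul_apply, smul_eq_mul] at h4
    simp only [RingHom.id_apply]
    rw [h1, h5, Pi.smul_apply, h2, dilFun, dilFun, h4, smul_eq_mul]
    ring
  norm_map' f := norm_dilFun ha f

theorem dilation_ae (a : ℝ) (ha : a ≠ 0) (f : L2) : dilation a ha f =ᵐ[volume] dilFun a f :=
  (memLp_dilFun ha f).coeFn_toLp

theorem two_pi_ne_zero : (2 * Real.pi) ≠ 0 := by positivity

/-- The prefactor (2π)^{-3/2} is exactly the L² normalization of the dilation by 1/2π, so the change
of convention is unitary. -/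
theorem unitaryConvention_eq (g : R3 → ℂ) :
    unitaryConvention g = dilFun (2 * Real.pi)⁻¹ g := by
  funext p
  rw [unitaryConvention, dilFun, abs_of_pos (by positivity), Real.inv_rpow (by positivity),
    ← Real.rpow_neg (by positivity)]

/-- The Fourier transform in the unitary convention, as a unitary operator. -/
noncomputable def hatEquiv : L2 ≃ₗᵢ[ℂ] L2 :=
  (Lp.fourierTransformₗᵢ R3 ℂ).trans (dilation (2 * Real.pi)⁻¹ (inv_ne_zero two_pi_ne_zero))

theorem hatEquiv_ae (f : L2) : hatEquiv f =ᵐ[volume] hatL2 f := by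
  rw [hatL2, unitaryConvention_eq]
  exact dilation_ae (2 * Real.pi)⁻¹ (inv_ne_zero two_pi_ne_zero) (𝓕 f : L2)

theorem memLp_hatL2 (f : L2) : MemLp (hatL2 f) 2 volume :=
  (memLp_congr_ae (hatEquiv_ae f)).1 (Lp.memLp _)

/-- The reflection `f ↦ f(-·)` on `L²(ℝ³)`. -/
noncomputable def reflect : L2 →ₗᵢ[ℂ] L2 :=
  Lp.compMeasurePreservingₗᵢ ℂ (fun x : R3 => -x) (Measure.measurePreserving_neg volume)

theorem reflect_ae (f : L2) : reflect f =ᵐ[volume] fun x => f (-x) :=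
  Lp.coeFn_compMeasurePreserving f (Measure.measurePreserving_neg volume)

theorem ae_neg {P : R3 → Prop} (h : ∀ᵐ x : R3, P x) : ∀ᵐ x : R3, P (-x) :=
  (Measure.measurePreserving_neg (volume : Measure R3)).quasiMeasurePreserving.ae h

theorem isEven_iff (f : L2) : IsEven f ↔ reflect f = f := by
  constructor
  · intro h
    refine Lp.ext ?_
    filter_upwards [reflect_ae f, h] with x h1 h2
    rw [h1, h2]
  · intro h
    have := reflect_ae f
    rw [h] at this
    filter_upwards [this] with x hx using hx.symm

theorem reflect_reflect (f : L2) : reflect (reflect f) = f := by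
  refine Lp.ext ?_
  filter_upwards [reflect_ae (reflect f), ae_neg (reflect_ae f)] with x h1 h2
  rw [h1, h2, neg_neg]

theorem inner_reflect (f g : L2) : inner ℂ (reflect f) g = inner ℂ f (reflect g) := by
  rw [← reflect.inner_map_map f (reflect g), reflect_reflect]

/-- Reflection as a map of Schwartz functions. -/
noncomputable def schwartzReflect : SchwartzMap R3 ℂ →L[ℂ] SchwartzMap R3 ℂ :=
  SchwartzMap.compCLMOfContinuousLinearEquiv ℂ (ContinuousLinearEquiv.neg ℝ (M := R3))

theorem schwartzReflect_apply (u : SchwartzMap R3 ℂ) (x : R3) : schwartzReflect u x = u (-x) := rfl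

theorem reflect_toLp (u : SchwartzMap R3 ℂ) : reflect (u.toLp 2) = (schwartzReflect u).toLp 2 := by
  refine Lp.ext ?_
  filter_upwards [reflect_ae (u.toLp 2), ae_neg (u.coeFn_toLp 2 volume),
    (schwartzReflect u).coeFn_toLp 2 volume] with x h1 h2 h3
  rw [h1, h2, h3, schwartzReflect_apply]

theorem fourier_schwartzReflect (u : SchwartzMap R3 ℂ) :
    𝓕 (schwartzReflect u) = schwartzReflect (𝓕 u) := by
  ext x
  rw [schwartzReflect_apply, SchwartzMap.fourier_coe, SchwartzMap.fourier_coe]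
  exact Real.fourier_comp_linearIsometry (LinearIsometryEquiv.neg ℝ (E := R3)) u x

/-- Both sides are continuous in f and agree on the dense set of Schwartz functions, where the
change of variables is classical. -/
theorem fourier_reflect (f : L2) : (𝓕 (reflect f) : L2) = reflect (𝓕 f : L2) := by
  have hc1 : Continuous fun f : L2 => (𝓕 (reflect f) : L2) :=
    (Lp.fourierTransformₗᵢ R3 ℂ).continuous.comp reflect.continuous
  have hc2 : Continuous fun f : L2 => reflect (𝓕 f : L2) :=
    reflect.continuous.comp (Lp.fourierTransformₗᵢ R3 ℂ).continuous
  have hd := SchwartzMap.denseRange_toLpCLM (E := R3) (F := ℂ) (p := 2) (μ := volume)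
    ENNReal.ofNat_ne_top
  refine congrFun (hd.equalizer hc1 hc2 (funext fun u => ?_)) f
  simp only [Function.comp_apply, SchwartzMap.toLpCLM_apply]
  rw [reflect_toLp, SchwartzMap.toLp_fourier_eq, SchwartzMap.toLp_fourier_eq, reflect_toLp,
    fourier_schwartzReflect]

theorem hatEquiv_reflect (f : L2) : hatEquiv (reflect f) = reflect (hatEquiv f) := by
  refine Lp.ext ?_
  have hq := quasiMeasurePreserving_smul_R3 (inv_ne_zero two_pi_ne_zero)
  filter_upwards [hatEquiv_ae (reflect f), reflect_ae (hatEquiv f), ae_neg (hatEquiv_ae f),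
    hq.ae (reflect_ae (𝓕 f : L2))] with x h1 h2 h3 h4
  rw [h1, h2, h3, hatL2, hatL2, unitaryConvention, unitaryConvention, fourier_reflect, h4, smul_neg]

theorem isEven_hatEquiv_iff (f : L2) : IsEven (hatEquiv f) ↔ IsEven f := by
  rw [isEven_iff, isEven_iff, ← hatEquiv_reflect]
  exact hatEquiv.injective.eq_iff

end Hat

/-! ### The Sobolev space `H¹` on the Fourier side -/

section Sobolev

/-- The weight `(1 + p²)^{1/2}`. -/
noncomputable def wt (p : R3) : ℝ := Real.sqrt (1 + ‖p‖ ^ 2)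

theorem wt_sq (p : R3) : wt p ^ 2 = 1 + ‖p‖ ^ 2 := Real.sq_sqrt (by positivity)

theorem one_le_wt (p : R3) : 1 ≤ wt p := Real.one_le_sqrt.2 (by nlinarith [sq_nonneg ‖p‖])

theorem wt_pos (p : R3) : 0 < wt p := zero_lt_one.trans_le (one_le_wt p)

theorem wt_ne (p : R3) : (wt p : ℂ) ≠ 0 := by exact_mod_cast (wt_pos p).ne'

theorem norm_le_wt (p : R3) : ‖p‖ ≤ wt p := Real.le_sqrt_of_sq_le (by linarith)

theorem wt_neg (p : R3) : wt (-p) = wt p := by simp [wt]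

@[fun_prop]
theorem continuous_wt : Continuous wt := by unfold wt; fun_prop

theorem wt_eq_rpow (p : R3) : wt p = (1 + ‖p‖ ^ 2) ^ ((1 : ℝ) / 2) := Real.sqrt_eq_rpow _

theorem locallyIntegrable_continuous_mul {g f : R3 → ℂ} (hg : Continuous g) (hf : MemLp f 2 volume) :
    LocallyIntegrable (fun x => g x * f x) volume := by
  rw [locallyIntegrable_iff]
  intro k hk
  have h1 := (hf.locallyIntegrable (by norm_num)).integrableOn_isCompact hk
  exact h1.continuousOn_mul hg.continuousOn hk

theorem ae_eq_of_integral_schwartz_mul {f f' : R3 → ℂ} (hf : LocallyIntegrable f volume)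
    (hf' : LocallyIntegrable f' volume)
    (h : ∀ g : SchwartzMap R3 ℂ, HasCompactSupport g → ∫ x, g x * f x = ∫ x, g x * f' x) :
    f =ᵐ[volume] f' := by
  refine ae_eq_of_integral_contDiff_smul_eq hf hf' fun g hg hc => ?_
  have hc' : HasCompactSupport (fun x => (g x : ℂ)) := hc.comp_left (g := fun y : ℝ => (y : ℂ)) (by simp)
  have := h (hc'.toSchwartzMap (Complex.ofRealCLM.contDiff.comp hg)) hc'
  simp only [Complex.real_smul]
  exact this

/-- The definition weighs the transform in the variable ξ = p/2π. The weights (1+|ξ|²)^{1/2} and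
(1+p²)^{1/2} bound each other up to the factor 2π, so they define the same space. -/
theorem memH1_iff (α : L2) : MemH1 α ↔ MemLp (fun p => (wt p : ℂ) * hatL2 α p) 2 volume := by
  have hw : (fun x : R3 => (((1 + ‖x‖ ^ 2) ^ ((1 : ℝ) / 2) : ℝ) : ℂ)) = fun x => (wt x : ℂ) := by
    funext x; rw [wt_eq_rpow]
  have hg : (fun x : R3 => (wt x : ℂ)).HasTemperateGrowth := by
    rw [← hw]; fun_prop
  have hpi : (1 : ℝ) ≤ 2 * Real.pi := by linarith [Real.pi_gt_three]
  rw [MemH1, TemperedDistribution.memSobolev_iff_exists_smulLeftCLM_fourier,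
    Lp.fourier_toTemperedDistribution_eq, hw]
  have hmeas : AEStronglyMeasurable (fun p => (wt p : ℂ) * hatL2 α p) volume :=
    (Complex.continuous_ofReal.comp continuous_wt).aestronglyMeasurable.mul
      (memLp_hatL2 α).aestronglyMeasurable
  constructor
  · rintro ⟨f', hf'⟩
    have h1 : (fun x => (wt x : ℂ) * (𝓕 α : L2) x) =ᵐ[volume] f' := by
      refine ae_eq_of_integral_schwartz_mul
        (locallyIntegrable_continuous_mul (by fun_prop) (Lp.memLp _))
        ((Lp.memLp f').locallyIntegrable (by norm_num)) fun g _ => ?_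
      have := congrArg (fun D => D g) hf'
      simp only [TemperedDistribution.smulLeftCLM_apply_apply, Lp.toTemperedDistribution_apply,
        SchwartzMap.smulLeftCLM_apply_apply hg, smul_eq_mul] at this
      rw [← this]
      congr 1 with x; ring
    have h2 := memLp_dilFun (inv_ne_zero two_pi_ne_zero) f'
    refine h2.of_le_mul (c := 2 * Real.pi) hmeas ?_
    filter_upwards [(quasiMeasurePreserving_smul_R3 (inv_ne_zero two_pi_ne_zero)).ae h1] with p hp
    rw [hatL2, unitaryConvention_eq, dilFun, dilFun, ← hp]
    simp only [norm_mul, Complex.norm_real, Real.norm_of_nonneg (wt_pos _).le]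
    have h3 : wt p ≤ 2 * Real.pi * wt ((2 * Real.pi)⁻¹ • p) := by
      refine abs_le_of_sq_le_sq' ?_ (by have := wt_pos ((2 * Real.pi)⁻¹ • p); positivity) |>.2
      rw [mul_pow, wt_sq, wt_sq, norm_smul, mul_pow _ ‖p‖, norm_inv, Real.norm_eq_abs, inv_pow, sq_abs,
        mul_add, mul_inv_cancel_left₀ (by positivity)]
      nlinarith
    have h4 : 0 ≤ ‖|(2 * Real.pi)⁻¹| ^ (3 / 2 : ℝ)‖ * ‖(𝓕 α : L2) ((2 * Real.pi)⁻¹ • p)‖ := by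
      positivity
    nlinarith
  · intro h
    set F : L2 := h.toLp with hF
    have h1 := memLp_dilFun two_pi_ne_zero F
    have h2 : MemLp (fun x => (wt x : ℂ) * (𝓕 α : L2) x) 2 volume := by
      refine h1.of_le ((Complex.continuous_ofReal.comp continuous_wt).aestronglyMeasurable.mul
        (Lp.aestronglyMeasurable _)) ?_
      filter_upwards [(quasiMeasurePreserving_smul_R3 two_pi_ne_zero).ae h.coeFn_toLp] with x hx
      rw [dilFun, hx, hatL2, unitaryConvention_eq, dilFun, inv_smul_smul₀ two_pi_ne_zero]
      simp only [norm_mul, Complex.norm_real, Real.norm_of_nonneg (wt_pos _).le]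
      have h3 : wt x ≤ wt ((2 * Real.pi) • x) := by
        refine Real.sqrt_le_sqrt ?_
        rw [norm_smul, mul_pow, Real.norm_eq_abs, sq_abs]
        have : 1 ≤ (2 * Real.pi) ^ 2 := one_le_pow₀ hpi
        nlinarith [sq_nonneg ‖x‖]
      have h5 : ‖|2 * Real.pi| ^ (3 / 2 : ℝ)‖ * ‖|(2 * Real.pi)⁻¹| ^ (3 / 2 : ℝ)‖ = 1 := by
        rw [← norm_mul, ← Real.mul_rpow (abs_nonneg _) (abs_nonneg _), ← abs_mul,
          mul_inv_cancel₀ two_pi_ne_zero]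
        simp
      have h4 : ‖|2 * Real.pi| ^ (3 / 2 : ℝ)‖ * (wt ((2 * Real.pi) • x) *
          (‖|(2 * Real.pi)⁻¹| ^ (3 / 2 : ℝ)‖ * ‖(𝓕 α : L2) x‖)) =
          wt ((2 * Real.pi) • x) * ‖(𝓕 α : L2) x‖ := by
        linear_combination (wt ((2 * Real.pi) • x) * ‖(𝓕 α : L2) x‖) * h5
      rw [h4]
      exact mul_le_mul_of_nonneg_right h3 (norm_nonneg _)
    refine ⟨h2.toLp, ?_⟩
    ext g
    simp only [TemperedDistribution.smulLeftCLM_apply_apply, Lp.toTemperedDistribution_apply,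
        SchwartzMap.smulLeftCLM_apply_apply hg, smul_eq_mul]
    refine integral_congr_ae ?_
    filter_upwards [h2.coeFn_toLp] with x hx
    rw [hx]; ring

/-! #### Multiplication operators -/

theorem memLp_mul_bounded {m : R3 → ℝ} (hm : Measurable m) {C : ℝ} (hC : ∀ p, |m p| ≤ C)
    (f : L2) : MemLp (fun p => (m p : ℂ) * f p) 2 volume := by
  refine (Lp.memLp f).of_le_mul (c := C)
    ((Complex.measurable_ofReal.comp hm).aestronglyMeasurable.mul (Lp.aestronglyMeasurable f)) ?_
  filter_upwards with p
  rw [norm_mul, Complex.norm_real]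
  exact mul_le_mul_of_nonneg_right (hC p) (norm_nonneg _)

/-- Multiplication by a bounded measurable real function on `L²(ℝ³)`. -/
noncomputable def mulOp (m : R3 → ℝ) (hm : Measurable m) (C : ℝ) (hC : ∀ p, |m p| ≤ C) :
    L2 →L[ℂ] L2 :=
  LinearMap.mkContinuous
    { toFun := fun f => (memLp_mul_bounded hm hC f).toLp
      map_add' := fun f g => by
        refine Lp.ext ?_
        filter_upwards [(memLp_mul_bounded hm hC (f + g)).coeFn_toLp,
          (memLp_mul_bounded hm hC f).coeFn_toLp, (memLp_mul_bounded hm hC g).coeFn_toLp,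
          Lp.coeFn_add f g, Lp.coeFn_add (memLp_mul_bounded hm hC f).toLp
            (memLp_mul_bounded hm hC g).toLp] with x h1 h2 h3 h4 h5
        rw [h1, h5, Pi.add_apply, h2, h3, h4, Pi.add_apply, mul_add]
      map_smul' := fun c f => by
        refine Lp.ext ?_
        filter_upwards [(memLp_mul_bounded hm hC (c • f)).coeFn_toLp,
          (memLp_mul_bounded hm hC f).coeFn_toLp,
          Lp.coeFn_smul c f, Lp.coeFn_smul c (memLp_mul_bounded hm hC f).toLp] with x h1 h2 h4 h5
        rw [h1, RingHom.id_apply, h5, Pi.smul_apply, h2, h4, Pi.smul_apply, smul_eq_mul, smul_eq_mul]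
        ring } C fun f => by
    refine Lp.norm_le_mul_norm_of_ae_le_mul ?_
    filter_upwards [(memLp_mul_bounded hm hC f).coeFn_toLp] with x h1
    change ‖(memLp_mul_bounded hm hC f).toLp _ x‖ ≤ _
    rw [h1, norm_mul, Complex.norm_real]
    exact mul_le_mul_of_nonneg_right (hC x) (norm_nonneg _)

theorem mulOp_ae {m : R3 → ℝ} (hm : Measurable m) {C : ℝ} (hC : ∀ p, |m p| ≤ C) (f : L2) :
    mulOp m hm C hC f =ᵐ[volume] fun p => (m p : ℂ) * f p :=
  (memLp_mul_bounded hm hC f).coeFn_toLp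

theorem norm_mulOp_le {m : R3 → ℝ} (hm : Measurable m) {C : ℝ} (hC : ∀ p, |m p| ≤ C) (hC0 : 0 ≤ C)
    (f : L2) : ‖mulOp m hm C hC f‖ ≤ C * ‖f‖ :=
  (mulOp m hm C hC).le_of_opNorm_le (LinearMap.mkContinuous_norm_le _ hC0 _) f

theorem measurable_inv_wt : Measurable (fun p => (wt p)⁻¹) := continuous_wt.measurable.inv

theorem abs_inv_wt_le (p : R3) : |(wt p)⁻¹| ≤ 1 := by
  rw [abs_of_pos (inv_pos.2 (wt_pos p))]
  exact inv_le_one_of_one_le₀ (one_le_wt p)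

/-- The Bessel potential `(1 - Δ)^{-1/2}` composed with the inverse Fourier transform: the function
whose transform is `(1 + p²)^{-1/2} f(p)`. Its range is `H¹(ℝ³)`. -/
noncomputable def bessel : L2 →L[ℂ] L2 :=
  (hatEquiv.symm.toContinuousLinearEquiv : L2 →L[ℂ] L2).comp
    (mulOp (fun p => (wt p)⁻¹) measurable_inv_wt 1 abs_inv_wt_le)

theorem hatEquiv_bessel (f : L2) :
    hatEquiv (bessel f) = mulOp (fun p => (wt p)⁻¹) measurable_inv_wt 1 abs_inv_wt_le f :=
  hatEquiv.apply_symm_apply _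

theorem hatL2_bessel (f : L2) : hatL2 (bessel f) =ᵐ[volume] fun p => (wt p : ℂ)⁻¹ * f p := by
  refine (hatEquiv_ae _).symm.trans ?_
  rw [hatEquiv_bessel]
  filter_upwards [mulOp_ae measurable_inv_wt abs_inv_wt_le f] with p hp
  rw [hp, Complex.ofReal_inv]

theorem norm_bessel_le (f : L2) : ‖bessel f‖ ≤ ‖f‖ := by
  rw [← hatEquiv.norm_map, hatEquiv_bessel]
  simpa using norm_mulOp_le measurable_inv_wt abs_inv_wt_le zero_le_one f

theorem memH1_bessel (f : L2) : MemH1 (bessel f) := by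
  rw [memH1_iff]
  refine (memLp_congr_ae ?_).1 (Lp.memLp f)
  filter_upwards [hatL2_bessel f] with p hp
  rw [hp, mul_inv_cancel_left₀ (wt_ne p)]

theorem exists_bessel_of_hat {g : R3 → ℂ} (hg : MemLp (fun p => (wt p : ℂ) * g p) 2 volume) :
    ∃ f : L2, hatL2 (bessel f) =ᵐ[volume] g ∧ f =ᵐ[volume] fun p => (wt p : ℂ) * g p := by
  refine ⟨hg.toLp, ?_, hg.coeFn_toLp⟩
  filter_upwards [hatL2_bessel hg.toLp, hg.coeFn_toLp] with p h1 h2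
  rw [h1, h2, inv_mul_cancel_left₀ (wt_ne p)]

theorem L2_ext_hat {α β : L2} (h : hatL2 α =ᵐ[volume] hatL2 β) : α = β :=
  hatEquiv.injective (Lp.ext (((hatEquiv_ae α).trans h).trans (hatEquiv_ae β).symm))

theorem exists_bessel_eq {α : L2} (h : MemH1 α) : ∃ f : L2, bessel f = α := by
  obtain ⟨f, hf, _⟩ := exists_bessel_of_hat ((memH1_iff α).1 h)
  exact ⟨f, L2_ext_hat hf⟩

theorem bessel_injective : Function.Injective bessel := by
  intro f g h
  refine Lp.ext ?_
  have h1 := hatL2_bessel f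
  rw [h] at h1
  filter_upwards [h1, hatL2_bessel g] with p h1 h2
  rw [h1] at h2
  exact mul_left_cancel₀ (inv_ne_zero (wt_ne p)) h2

theorem bessel_reflect (f : L2) : bessel (reflect f) = reflect (bessel f) := by
  apply hatEquiv.injective
  rw [hatEquiv_reflect, hatEquiv_bessel, hatEquiv_bessel]
  refine Lp.ext ?_
  have h := mulOp_ae measurable_inv_wt abs_inv_wt_le f
  filter_upwards [mulOp_ae measurable_inv_wt abs_inv_wt_le (reflect f), reflect_ae f,
    reflect_ae (mulOp (fun p => (wt p)⁻¹) measurable_inv_wt 1 abs_inv_wt_le f),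
    ae_neg h] with p h1 h2 h3 h4
  rw [h1, h2, h3, h4, wt_neg]

theorem isEven_bessel_iff (f : L2) : IsEven (bessel f) ↔ IsEven f := by
  rw [isEven_iff, isEven_iff, ← bessel_reflect]
  exact bessel_injective.eq_iff

theorem norm_sq_bessel (f : L2) : ‖bessel f‖ ^ 2 = ∫ p, ((wt p)⁻¹) ^ 2 * ‖f p‖ ^ 2 := by
  rw [← hatEquiv.norm_map, norm_sq_eq_integral]
  refine integral_congr_ae ?_
  filter_upwards [hatEquiv_ae (bessel f), hatL2_bessel f] with p h1 h2
  rw [h1, h2, norm_mul, norm_inv, Complex.norm_real, Real.norm_of_nonneg (wt_pos p).le, mul_pow]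

end Sobolev

/-! ### The Sobolev embedding `H¹(ℝ³) ⊆ L⁶(ℝ³)` -/

section Embedding

open Filter Topology
open scoped LineDeriv ENNReal NNReal

/-- The inverse weight has temperate growth, so the Bessel potential preserves the Schwartz space.
The displayed formula is its multiplier after the passage from p to ξ = p/2π. -/
theorem exists_schwartz_bessel (S : SchwartzMap R3 ℂ) :
    ∃ u : SchwartzMap R3 ℂ, bessel (S.toLp 2) = u.toLp 2 ∧
      ∀ ξ, 𝓕 u ξ = ((|2 * Real.pi| ^ (3 / 2 : ℝ) : ℝ) : ℂ) *
        ((wt ((2 * Real.pi) • ξ) : ℂ)⁻¹ * S ((2 * Real.pi) • ξ)) := by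
  have hw : (fun x : R3 => (wt x : ℂ)⁻¹) =
      fun x : R3 => (((1 + ‖x‖ ^ 2) ^ (-(1 : ℝ) / 2) : ℝ) : ℂ) := by
    funext x
    rw [← Complex.ofReal_inv, wt_eq_rpow, ← Real.rpow_neg (by positivity), neg_div]
  have hg : (fun x : R3 => (wt x : ℂ)⁻¹).HasTemperateGrowth := by rw [hw]; fun_prop
  let e : R3 ≃L[ℝ] R3 := ContinuousLinearEquiv.smulLeft (Units.mk0 (2 * Real.pi) two_pi_ne_zero)
  let S1 : SchwartzMap R3 ℂ := SchwartzMap.smulLeftCLM ℂ (fun x : R3 => (wt x : ℂ)⁻¹) S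
  let S2 : SchwartzMap R3 ℂ := ((|2 * Real.pi| ^ (3 / 2 : ℝ) : ℝ) : ℂ) •
    SchwartzMap.compCLMOfContinuousLinearEquiv ℂ e S1
  have hS2 (ξ : R3) : S2 ξ = ((|2 * Real.pi| ^ (3 / 2 : ℝ) : ℝ) : ℂ) *
        ((wt ((2 * Real.pi) • ξ) : ℂ)⁻¹ * S ((2 * Real.pi) • ξ)) := by
    change ((|2 * Real.pi| ^ (3 / 2 : ℝ) : ℝ) : ℂ) * S1 ((2 * Real.pi) • ξ) = _
    simp only [S1]
    rw [SchwartzMap.smulLeftCLM_apply_apply hg, smul_eq_mul]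
  have hF : 𝓕 (𝓕⁻ S2) = S2 := FourierTransform.fourier_fourierInv_eq S2
  refine ⟨𝓕⁻ S2, ?_, fun ξ => by rw [← hS2, hF]⟩
  refine L2_ext_hat ?_
  have hq := quasiMeasurePreserving_smul_R3 (inv_ne_zero two_pi_ne_zero)
  filter_upwards [hatL2_bessel (S.toLp 2), S.coeFn_toLp 2 volume,
    hq.ae (S2.coeFn_toLp 2 volume)] with p h1 h2 h3
  rw [h1, h2, hatL2, unitaryConvention_eq, dilFun, SchwartzMap.toLp_fourier_eq, hF, h3, hS2,
    smul_inv_smul₀ two_pi_ne_zero, ← mul_assoc, ← Complex.ofReal_mul,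
    ← Real.mul_rpow (abs_nonneg _) (abs_nonneg _), ← abs_mul, inv_mul_cancel₀ two_pi_ne_zero]
  simp

/-- By Plancherel: a unit directional derivative multiplies the transform by at most 2π|ξ|, and this
is absorbed by the inverse weight at 2πξ; the rest is a unitary dilation of S. -/
theorem norm_lineDeriv_le {S u : SchwartzMap R3 ℂ}
    (hu : ∀ ξ, 𝓕 u ξ = ((|2 * Real.pi| ^ (3 / 2 : ℝ) : ℝ) : ℂ) *
        ((wt ((2 * Real.pi) • ξ) : ℂ)⁻¹ * S ((2 * Real.pi) • ξ))) {m : R3} (hm : ‖m‖ ≤ 1) :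
    ‖(∂_{m} u).toLp 2 volume‖ ≤ ‖S.toLp 2 volume‖ := by
  have hn : ‖dilation (2 * Real.pi) two_pi_ne_zero (S.toLp 2)‖ = ‖S.toLp 2 volume‖ :=
    LinearIsometryEquiv.norm_map _ _
  rw [← SchwartzMap.norm_fourier_toL2_eq, SchwartzMap.fourier_lineDerivOp_eq, ← hn]
  refine Lp.norm_le_norm_of_ae_le ?_
  have hg : (fun x : R3 => inner ℝ x m).HasTemperateGrowth := by fun_prop
  filter_upwards [SchwartzMap.coeFn_toLp ((2 * Real.pi * Complex.I) •
    SchwartzMap.smulLeftCLM ℂ (fun x : R3 => inner ℝ x m) (𝓕 u)) 2 volume,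
    dilation_ae (2 * Real.pi) two_pi_ne_zero (S.toLp 2),
    (quasiMeasurePreserving_smul_R3 two_pi_ne_zero).ae (S.coeFn_toLp 2 volume)] with ξ h1 h2 h3
  rw [h1, h2, dilFun, h3, smul_apply, SchwartzMap.smulLeftCLM_apply_apply hg, hu]
  simp only [smul_eq_mul, norm_mul, Complex.norm_I, norm_smul, Complex.norm_real, norm_inv,
    Real.norm_of_nonneg (wt_pos _).le, mul_one]
  set A := ‖|2 * Real.pi| ^ (3 / 2 : ℝ)‖
  have hA : 0 ≤ A := norm_nonneg _
  have h4 : 2 * Real.pi * ‖inner ℝ ξ m‖ ≤ wt ((2 * Real.pi) • ξ) := by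
    refine le_trans ?_ (norm_le_wt _)
    rw [norm_smul, Real.norm_of_nonneg (by positivity : (0 : ℝ) ≤ 2 * Real.pi)]
    refine mul_le_mul_of_nonneg_left ?_ (by positivity)
    refine (norm_inner_le_norm ξ m).trans ?_
    exact mul_le_of_le_one_right (norm_nonneg _) hm
  have h5 := wt_pos ((2 * Real.pi) • ξ)
  have h6 : 2 * Real.pi * ‖inner ℝ ξ m‖ * (wt ((2 * Real.pi) • ξ))⁻¹ ≤ 1 := by
    rw [← div_eq_mul_inv, div_le_one h5]; exact h4
  have h7 : (0:ℝ) ≤ A * ‖S ((2 * Real.pi) • ξ)‖ := by positivity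
  have hpi : ‖Real.pi‖ = Real.pi := Real.norm_of_nonneg Real.pi_pos.le
  have h2' : ‖(2 : ℂ)‖ = 2 := by simp
  rw [hpi, h2']
  nlinarith [mul_le_mul_of_nonneg_right h6 h7]

theorem norm_fderiv_le_sum (u : SchwartzMap R3 ℂ) (x : R3) :
    ‖fderiv ℝ u x‖ ≤ ∑ i : Fin 3, ‖(∂_{EuclideanSpace.single i (1 : ℝ)} u : SchwartzMap R3 ℂ) x‖ := by
  refine ContinuousLinearMap.opNorm_le_bound _ (by positivity) fun v => ?_
  have hv : v = ∑ i : Fin 3, v i • EuclideanSpace.single i (1 : ℝ) := by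
    have := (EuclideanSpace.basisFun (Fin 3) ℝ).sum_repr v
    simpa using this.symm
  conv_lhs => rw [hv, map_sum]
  rw [Finset.sum_mul]
  refine (norm_sum_le _ _).trans (Finset.sum_le_sum fun i _ => ?_)
  rw [map_smul, norm_smul, mul_comm]
  have h1 : (∂_{EuclideanSpace.single i (1 : ℝ)} u : SchwartzMap R3 ℂ) x =
      fderiv ℝ u x (EuclideanSpace.single i (1 : ℝ)) := by
    rw [SchwartzMap.lineDerivOp_apply_eq_fderiv]
  rw [h1]
  exact mul_le_mul_of_nonneg_left (PiLp.norm_apply_le v i) (norm_nonneg _)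

/-- Dilates of one bump function; the gradients carry the factor 1/(n+1) and drop out in the limit.
-/
theorem exists_cutoff_sequence : ∃ (M : ℝ≥0) (χ : ℕ → R3 → ℝ), (∀ n, ContDiff ℝ 1 (χ n)) ∧
    (∀ n, HasCompactSupport (χ n)) ∧ (∀ n x, |χ n x| ≤ 1) ∧
    (∀ n x, ‖fderiv ℝ (χ n) x‖ ≤ ((n : ℝ) + 1)⁻¹ * M) ∧
    ∀ x, Tendsto (fun n => χ n x) atTop (𝓝 1) := by
  obtain ⟨φ, hφ, hφs, hφ1, hφ0⟩ : ∃ φ : R3 → ℝ, ContDiff ℝ 1 φ ∧ HasCompactSupport φ ∧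
      (∀ x, |φ x| ≤ 1) ∧ φ 0 = 1 := by
    let b : ContDiffBump (0 : R3) := ⟨1, 2, one_pos, one_lt_two⟩
    refine ⟨b, b.contDiff, b.hasCompactSupport, fun x => ?_, b.one_of_mem_closedBall (by simp [b])⟩
    rw [abs_of_nonneg b.nonneg]; exact b.le_one
  obtain ⟨M, hM⟩ := (hφs.fderiv (𝕜 := ℝ)).exists_bound_of_continuous
    (hφ.continuous_fderiv one_ne_zero)
  have ha (n : ℕ) : (0 : ℝ) < ((n : ℝ) + 1)⁻¹ := by positivity
  refine ⟨⟨max M 0, le_max_right _ _⟩, fun n x => φ (((n : ℝ) + 1)⁻¹ • x),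
    fun n => hφ.comp (by fun_prop), fun n => hφs.comp_smul (ha n).ne', fun n x => hφ1 _,
    fun n x => ?_, fun x => ?_⟩
  · have h1 : HasFDerivAt (fun x : R3 => ((n : ℝ) + 1)⁻¹ • x)
        (((n : ℝ) + 1)⁻¹ • ContinuousLinearMap.id ℝ R3) x :=
      (((n : ℝ) + 1)⁻¹ • ContinuousLinearMap.id ℝ R3).hasFDerivAt
    have h2 : HasFDerivAt φ (fderiv ℝ φ (((n : ℝ) + 1)⁻¹ • x)) (((n : ℝ) + 1)⁻¹ • x) :=
      (hφ.differentiable one_ne_zero _).hasFDerivAt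
    have h3 := (h2.comp x h1).fderiv
    change ‖fderiv ℝ (φ ∘ fun x : R3 => ((n : ℝ) + 1)⁻¹ • x) x‖ ≤ _
    rw [h3]
    refine (ContinuousLinearMap.opNorm_comp_le _ _).trans ?_
    rw [norm_smul, Real.norm_of_nonneg (ha n).le, mul_comm]
    refine mul_le_mul ?_ ((hM _).trans (le_max_left _ _)) (norm_nonneg _) (ha n).le
    exact mul_le_of_le_one_right (ha n).le ContinuousLinearMap.norm_id_le
  · have h0 : Tendsto (fun n : ℕ => ((n : ℝ) + 1)⁻¹ • x) atTop (𝓝 ((0 : ℝ) • x)) := by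
      refine Tendsto.smul_const ?_ x
      simpa using tendsto_one_div_add_atTop_nhds_zero_nat (𝕜 := ℝ)
    rw [zero_smul] at h0
    have h1 := (hφ.continuous.tendsto 0).comp h0
    rwa [hφ0] at h1

/-- The Gagliardo-Nirenberg-Sobolev inequality for compact support is applied to χₙ u. The error
from the gradient of χₙ tends to zero, and Fatou's lemma passes to the limit on the left. -/
theorem eLpNorm_schwartz_six_le (u : SchwartzMap R3 ℂ) :
    eLpNorm u 6 volume ≤ eLpNormLESNormFDerivOfEqInnerConst (volume : Measure R3) 2 *
      eLpNorm (fderiv ℝ u) 2 volume := by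
  set K := eLpNormLESNormFDerivOfEqInnerConst (volume : Measure R3) 2
  obtain ⟨M, χ, hχ, hχs, hχ1, hdχ, hχlim⟩ := exists_cutoff_sequence
  have ha (n : ℕ) : (0 : ℝ) < ((n : ℝ) + 1)⁻¹ := by positivity
  have hv (n) : ContDiff ℝ 1 (fun x => χ n x • u x) := (hχ n).smul (u.smooth 1)
  have hvs (n) : HasCompactSupport (fun x => χ n x • u x) := (hχs n).smul_right
  have hd (n) (x) : ‖fderiv ℝ (fun x => χ n x • u x) x‖ ≤
      ‖fderiv ℝ u x‖ + (((n : ℝ) + 1)⁻¹ * M) * ‖u x‖ := by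
    have h1 : fderiv ℝ (fun x => χ n x • u x) x = χ n x • fderiv ℝ u x +
        (fderiv ℝ (χ n) x).smulRight (u x) :=
      fderiv_fun_smul ((hχ n).differentiable one_ne_zero x) u.differentiableAt
    rw [h1]
    refine (norm_add_le _ _).trans (add_le_add ?_ ?_)
    · rw [norm_smul]
      exact mul_le_of_le_one_left (norm_nonneg _) (hχ1 n x)
    · rw [ContinuousLinearMap.norm_smulRight_apply]
      exact mul_le_mul_of_nonneg_right (hdχ n x) (norm_nonneg _)
  have hu1 : Continuous (fderiv ℝ u) := (u.smooth 1).continuous_fderiv one_ne_zero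
  have hd2 (n) : eLpNorm (fderiv ℝ (fun x => χ n x • u x)) 2 volume ≤
      eLpNorm (fderiv ℝ u) 2 volume + ENNReal.ofReal (((n : ℝ) + 1)⁻¹ * M) * eLpNorm u 2 volume := by
    calc eLpNorm (fderiv ℝ (fun x => χ n x • u x)) 2 volume
        ≤ eLpNorm (fun x => ‖fderiv ℝ u x‖ + (((n : ℝ) + 1)⁻¹ * M) * ‖u x‖) 2 volume :=
          eLpNorm_mono_real fun x => hd n x
      _ ≤ eLpNorm (fun x => ‖fderiv ℝ u x‖) 2 volume +
          eLpNorm (fun x => (((n : ℝ) + 1)⁻¹ * M) * ‖u x‖) 2 volume :=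
          eLpNorm_add_le hu1.norm.aestronglyMeasurable
            (continuous_const.mul u.continuous.norm).aestronglyMeasurable (by norm_num)
      _ = _ := by
          rw [eLpNorm_norm]
          congr 1
          rw [← eLpNorm_norm (f := u)]
          have := eLpNorm_const_smul (((n : ℝ) + 1)⁻¹ * (M : ℝ)) (fun x => ‖u x‖) 2
            (volume : Measure R3)
          simp only [Pi.smul_def, smul_eq_mul] at this
          rw [this, Real.enorm_eq_ofReal (by positivity)]
  have hn (n) : eLpNorm (fun x => χ n x • u x) 6 volume ≤
      K * (eLpNorm (fderiv ℝ u) 2 volume +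
        ENNReal.ofReal (((n : ℝ) + 1)⁻¹ * M) * eLpNorm u 2 volume) := by
    have h1 := eLpNorm_le_eLpNorm_fderiv_of_eq_inner (volume : Measure R3) (hv n) (hvs n)
      (p := 2) (p' := 6) (by norm_num) (by simp) (by simp; norm_num)
    have h1' : eLpNorm (fun x => χ n x • u x) 6 volume ≤
        K * eLpNorm (fderiv ℝ (fun x => χ n x • u x)) 2 volume := h1
    exact h1'.trans (mul_le_mul_right (hd2 n) _)
  have hlim : ∀ x, Tendsto (fun n => χ n x • u x) atTop (𝓝 (u x)) := fun x => by
    simpa using (hχlim x).smul_const (u x)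
  have hle := Lp.eLpNorm_lim_le_liminf_eLpNorm (p := 6) (μ := (volume : Measure R3))
    (fun n => (hv n).continuous.aestronglyMeasurable) u (Eventually.of_forall hlim)
  refine hle.trans ((liminf_le_liminf (Eventually.of_forall hn)).trans ?_)
  have hu2 : eLpNorm u 2 volume ≠ ∞ := (u.memLp 2 volume).eLpNorm_ne_top
  have ht : Tendsto (fun n : ℕ => (K : ℝ≥0∞) * (eLpNorm (fderiv ℝ u) 2 volume +
      ENNReal.ofReal (((n : ℝ) + 1)⁻¹ * M) * eLpNorm u 2 volume)) atTop
      (𝓝 (K * (eLpNorm (fderiv ℝ u) 2 volume + ENNReal.ofReal (0 * M) * eLpNorm u 2 volume))) := by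
    refine ENNReal.Tendsto.const_mul (Tendsto.const_add _ ?_) (Or.inr ENNReal.coe_ne_top)
    refine ENNReal.Tendsto.mul_const (ENNReal.tendsto_ofReal (Tendsto.mul_const _ ?_)) (Or.inr hu2)
    simpa using tendsto_one_div_add_atTop_nhds_zero_nat (𝕜 := ℝ)
  rw [ht.liminf_eq]
  simp

/-- **Sobolev inequality** in `ℝ³`: `H¹ ⊆ L⁶`. -/
theorem exists_eLpNorm_bessel_le :
    ∃ C : ℝ≥0, ∀ f : L2, eLpNorm (bessel f) 6 volume ≤ C * ‖f‖ₑ := by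
  set K := eLpNormLESNormFDerivOfEqInnerConst (volume : Measure R3) 2
  refine ⟨K * 3, fun f => ?_⟩
  have hS (S : SchwartzMap R3 ℂ) : eLpNorm (bessel (S.toLp 2)) 6 volume ≤
      (K * 3 : ℝ≥0) * ‖S.toLp 2 volume‖ₑ := by
    obtain ⟨u, hu, hF⟩ := exists_schwartz_bessel S
    rw [hu, eLpNorm_congr_ae (u.coeFn_toLp 2 volume)]
    refine (eLpNorm_schwartz_six_le u).trans ?_
    rw [ENNReal.coe_mul, mul_assoc]
    gcongr
    have hi (i : Fin 3) : eLpNorm (∂_{EuclideanSpace.single i (1 : ℝ)} u : SchwartzMap R3 ℂ) 2 volume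
        ≤ ‖S.toLp 2 volume‖ₑ := by
      have h1 := norm_lineDeriv_le hF (m := EuclideanSpace.single i (1 : ℝ)) (by simp)
      rw [← eLpNorm_congr_ae (SchwartzMap.coeFn_toLp _ 2 volume), ← Lp.enorm_def]
      rwa [← enorm_le_iff_norm_le] at h1
    calc eLpNorm (fderiv ℝ u) 2 volume
        ≤ eLpNorm (fun x => ∑ i : Fin 3, ‖(∂_{EuclideanSpace.single i (1 : ℝ)} u : SchwartzMap R3 ℂ) x‖) 2
          volume := eLpNorm_mono_real (norm_fderiv_le_sum u)
      _ ≤ ∑ i : Fin 3, eLpNorm (fun x => ‖(∂_{EuclideanSpace.single i (1 : ℝ)} u : SchwartzMap R3 ℂ) x‖) 2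
          volume := by
          have := eLpNorm_sum_le (μ := (volume : Measure R3)) (p := 2) (s := Finset.univ)
            (f := fun (i : Fin 3) x => ‖(∂_{EuclideanSpace.single i (1 : ℝ)} u : SchwartzMap R3 ℂ) x‖)
            (fun i _ => (SchwartzMap.continuous _).norm.aestronglyMeasurable) (by norm_num)
          convert this using 2
          ext x; simp
      _ ≤ ∑ i : Fin 3, ‖S.toLp 2 volume‖ₑ := Finset.sum_le_sum fun i _ => by
          rw [eLpNorm_norm]; exact hi i
      _ = (3 : ℝ≥0) * ‖S.toLp 2 volume‖ₑ := by simp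
  have hd := SchwartzMap.denseRange_toLpCLM (E := R3) (F := ℂ) (p := 2) (μ := volume)
    ENNReal.ofNat_ne_top
  obtain ⟨g, hg, hgf⟩ := mem_closure_iff_seq_limit.1 (hd f)
  choose S hSg using hg
  -- L² continuity yields an almost everywhere convergent subsequence, along which Fatou's lemma
  -- transfers the L⁶ bound from Schwartz functions to f.
  have hA : Tendsto (fun n => bessel (g n)) atTop (𝓝 (bessel f)) := (bessel.continuous.tendsto f).comp hgf
  obtain ⟨ns, hns, hae⟩ := (tendstoInMeasure_of_tendsto_Lp hA).exists_seq_tendsto_ae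
  have hle := Lp.eLpNorm_lim_le_liminf_eLpNorm (p := 6) (μ := (volume : Measure R3))
    (fun n => Lp.aestronglyMeasurable (bessel (g (ns n)))) (bessel f) hae
  refine hle.trans ?_
  have h1 (n) : eLpNorm (bessel (g (ns n))) 6 volume ≤ (K * 3 : ℝ≥0) * ‖g (ns n)‖ₑ := by
    rw [← hSg]; exact hS _
  refine (liminf_le_liminf (Eventually.of_forall h1)).trans ?_
  have ht : Tendsto (fun n => ((K * 3 : ℝ≥0) : ℝ≥0∞) * ‖g (ns n)‖ₑ) atTop
      (𝓝 (((K * 3 : ℝ≥0) : ℝ≥0∞) * ‖f‖ₑ)) :=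
    ENNReal.Tendsto.const_mul ((hgf.comp hns.tendsto_atTop).enorm) (Or.inr ENNReal.coe_ne_top)
  rw [ht.liminf_eq]

end Embedding

/-! ### Products and convolutions -/

section Pairing

open Filter Topology
open scoped ENNReal NNReal

/-- The exponents used throughout: α ∈ L⁶ and V ∈ L^{3/2} give Vα ∈ L^{6/5}, which pairs with L⁶. -/
instance holderTriple_sixFifths : ENNReal.HolderTriple (6 / 5) 6 1 where
  inv_add_inv_eq_inv := by
    rw [ENNReal.inv_div (by simp) (by simp), ENNReal.div_eq_inv_mul, inv_one]
    nth_rewrite 2 [← mul_one (6 : ℝ≥0∞)⁻¹]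
    rw [← mul_add]
    norm_num
    exact ENNReal.inv_mul_cancel (by simp) (by simp)

instance holderTriple_threeHalves : ENNReal.HolderTriple (3 / 2) 6 (6 / 5) where
  inv_add_inv_eq_inv := by
    have h4 : (2 : ℝ≥0∞) / 3 = 4 / 6 := by
      rw [show (4 : ℝ≥0∞) = 2 * 2 by norm_num, show (6 : ℝ≥0∞) = 2 * 3 by norm_num]
      exact (ENNReal.mul_div_mul_left 2 3 (by simp) (by simp)).symm
    rw [ENNReal.inv_div (by simp) (by simp), ENNReal.inv_div (by simp) (by simp), h4,
      ENNReal.div_eq_inv_mul, ENNReal.div_eq_inv_mul]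
    nth_rewrite 2 [← mul_one (6 : ℝ≥0∞)⁻¹]
    rw [← mul_add]
    norm_num

theorem memLp_bessel_six (f : L2) : MemLp (bessel f) 6 volume := by
  obtain ⟨C, hC⟩ := exists_eLpNorm_bessel_le
  refine ⟨Lp.aestronglyMeasurable _, (hC f).trans_lt ?_⟩
  exact ENNReal.mul_lt_top ENNReal.coe_lt_top (by simp)

theorem inner_toLp_left {h : R3 → ℂ} (hh : MemLp h 2 volume) (W : L2) :
    inner ℂ hh.toLp W = ∫ x, conj (h x) * W x := by
  rw [L2.inner_def]
  refine integral_congr_ae ?_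
  filter_upwards [hh.coeFn_toLp] with x hx
  rw [hx, RCLike.inner_apply, mul_comm]

theorem inner_eq_integral (f g : L2) : inner ℂ f g = ∫ x, conj (f x) * g x := by
  rw [L2.inner_def]
  refine integral_congr_ae (Eventually.of_forall fun x => ?_)
  simp only [RCLike.inner_apply, mul_comm]

theorem integrable_mul_L2 {f g : R3 → ℂ} (hf : MemLp f 2 volume) (hg : MemLp g 2 volume) :
    Integrable (fun x => f x * g x) volume := hf.integrable_mul hg

theorem memLp_conj {f : R3 → ℂ} {p : ℝ≥0∞} (hf : MemLp f p volume) :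
    MemLp (fun x => conj (f x)) p volume :=
  hf.of_le (Complex.continuous_conj.comp_aestronglyMeasurable hf.aestronglyMeasurable)
    (Eventually.of_forall fun x => by simp)

theorem continuous_hatL1 {U : R3 → ℂ} (hU : Integrable U volume) : Continuous (hatL1 U) := by
  have : Continuous (𝓕 U) := VectorFourier.fourierIntegral_continuous Real.continuous_fourierChar
    continuous_inner hU
  unfold hatL1 unitaryConvention
  fun_prop

theorem integrable_mul_bessel {U : R3 → ℂ} (hU : MemLp U (6 / 5) volume) (f : L2) :
    Integrable (fun x => U x * bessel f x) volume :=
  memLp_one_iff_integrable.1 ((memLp_bessel_six f).mul hU)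

theorem exists_norm_integral_mul_bessel_le {U : R3 → ℂ} (hU : MemLp U (6 / 5) volume) :
    ∃ C : ℝ, ∀ f : L2, ‖∫ x, U x * bessel f x‖ ≤ C * ‖f‖ := by
  obtain ⟨C, hC⟩ := exists_eLpNorm_bessel_le
  refine ⟨(eLpNorm U (6 / 5) volume).toReal * C, fun f => ?_⟩
  have h1 : ‖∫ x, U x * bessel f x‖ₑ ≤ eLpNorm U (6 / 5) volume * (C * ‖f‖ₑ) := by
    refine (enorm_integral_le_lintegral_enorm _).trans ?_
    rw [← eLpNorm_one_eq_lintegral_enorm]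
    refine le_trans ?_ (mul_le_mul_right (hC f) _)
    have := eLpNorm_smul_le_mul_eLpNorm (p := 6 / 5) (q := 6) (r := 1) (f := bessel f) (φ := U)
      (μ := volume) (Lp.aestronglyMeasurable _) hU.aestronglyMeasurable
    exact this
  have h2 := ENNReal.toReal_mono (ENNReal.mul_ne_top hU.eLpNorm_ne_top
    (ENNReal.mul_ne_top ENNReal.coe_ne_top (by simp))) h1
  simpa [ENNReal.toReal_mul, mul_assoc] using h2

/-- The multiplication formula ∫ f̂ g = ∫ f ĝ for integrable functions, rescaled to the unitary
convention. -/
theorem integral_mul_schwartz_eq {U : R3 → ℂ} (hU : Integrable U volume) {S u : SchwartzMap R3 ℂ}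
    (hu : ∀ ξ, 𝓕 u ξ = ((|2 * Real.pi| ^ (3 / 2 : ℝ) : ℝ) : ℂ) *
        ((wt ((2 * Real.pi) • ξ) : ℂ)⁻¹ * S ((2 * Real.pi) • ξ))) :
    ∫ x, U x * u x = ∫ p, S p * ((wt p : ℂ)⁻¹ * hatL1 U (-p)) := by
  have h1 : ∫ x, (𝓕⁻ (𝓕 u : SchwartzMap R3 ℂ) : SchwartzMap R3 ℂ) x * U x =
      ∫ ξ, 𝓕 u ξ * 𝓕 U (-ξ) := by
    have h := VectorFourier.integral_fourierIntegral_smul_eq_flip (μ := (volume : Measure R3))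
      (ν := (volume : Measure R3)) (L := -innerₗ R3) (f := ⇑(𝓕 u : SchwartzMap R3 ℂ)) (g := U)
      Real.continuous_fourierChar continuous_inner.neg (𝓕 u : SchwartzMap R3 ℂ).integrable hU
    have e1 : VectorFourier.fourierIntegral Real.fourierChar (volume : Measure R3)
        (-innerₗ R3).flip U = fun ξ => 𝓕 U (-ξ) := by
      funext ξ
      rw [← Real.fourierInv_eq_fourier_neg]
      have : (-innerₗ R3).flip = -innerₗ R3 := by
        ext x y; simp [real_inner_comm]
      rw [this]; rfl
    rw [e1] at h
    simp only [smul_eq_mul] at h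
    rw [← h, SchwartzMap.fourierInv_coe]
    rfl
  rw [FourierTransform.fourierInv_fourier_eq] at h1
  have h2 : ∫ x, U x * u x = ∫ ξ, 𝓕 u ξ * 𝓕 U (-ξ) := by
    rw [← h1]; congr 1 with x; ring
  rw [h2]
  let G : R3 → ℂ := fun p => ((|2 * Real.pi| ^ (3 / 2 : ℝ) : ℝ) : ℂ) *
        ((wt p : ℂ)⁻¹ * S p) * 𝓕 U (-((2 * Real.pi)⁻¹ • p))
  have h3 : ∫ ξ, 𝓕 u ξ * 𝓕 U (-ξ) = ∫ ξ, G ((2 * Real.pi) • ξ) := by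
    congr 1 with ξ
    simp only [G]
    rw [hu, inv_smul_smul₀ two_pi_ne_zero]
  rw [h3, Measure.integral_comp_smul, finrank_R3, ← integral_smul]
  congr 1 with p
  simp only [G]
  rw [hatL1, unitaryConvention, smul_neg, Complex.real_smul]
  have h4 : |((2 * Real.pi) ^ 3)⁻¹| * |2 * Real.pi| ^ (3 / 2 : ℝ) = (2 * Real.pi) ^ (-(3 / 2) : ℝ) := by
    have h0 : (0 : ℝ) < 2 * Real.pi := by positivity
    rw [abs_of_pos (by positivity), abs_of_pos h0, ← Real.rpow_natCast, ← Real.rpow_neg h0.le,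
      ← Real.rpow_add h0]
    norm_num
  rw [← h4]
  push_cast
  ring

/-- Parseval's identity for the pairing of `U ∈ L¹ ∩ L^{6/5}` with `H¹`. -/
theorem pairing {U : R3 → ℂ} (hU : Integrable U volume) (hU6 : MemLp U (6 / 5) volume) :
    MemLp (fun q => (wt q : ℂ)⁻¹ * hatL1 U (-q)) 2 volume ∧
      ∀ f : L2, ∫ x, U x * bessel f x = ∫ q, (wt q : ℂ)⁻¹ * hatL1 U (-q) * f q := by
  obtain ⟨C, hC⟩ := exists_norm_integral_mul_bessel_le hU6
  let l : L2 →L[ℂ] ℂ := LinearMap.mkContinuous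
    { toFun := fun f => ∫ x, U x * bessel f x
      map_add' := fun f g => by
        rw [← integral_add (integrable_mul_bessel hU6 f) (integrable_mul_bessel hU6 g)]
        refine integral_congr_ae ?_
        rw [map_add]
        filter_upwards [Lp.coeFn_add (bessel f) (bessel g)] with x hx
        rw [hx, Pi.add_apply, mul_add]
      map_smul' := fun c f => by
        rw [RingHom.id_apply, smul_eq_mul, ← integral_const_mul]
        refine integral_congr_ae ?_
        rw [map_smul]
        filter_upwards [Lp.coeFn_smul c (bessel f)] with x hx
        rw [hx, Pi.smul_apply, smul_eq_mul]; ring } C hC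
  -- Hölder and Sobolev bound the functional, so Riesz gives a representative in L². Comparison on
  -- compactly supported Schwartz functions identifies it with the weighted transform of U, which is
  -- thereby shown to be square integrable.
  let d : L2 := (InnerProductSpace.toDual ℂ L2).symm l
  have hd (f : L2) : ∫ x, U x * bessel f x = ∫ x, conj (d x) * f x := by
    rw [← inner_eq_integral, InnerProductSpace.toDual_symm_apply]; rfl
  have hdc : MemLp (fun x => conj (d x)) 2 volume := memLp_conj (Lp.memLp d)
  have hcont : Continuous (fun q => (wt q : ℂ)⁻¹ * hatL1 U (-q)) :=
    ((Complex.continuous_ofReal.comp continuous_wt).inv₀ wt_ne).mul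
      ((continuous_hatL1 hU).comp continuous_neg)
  have key : (fun x => conj (d x)) =ᵐ[volume] (fun q => (wt q : ℂ)⁻¹ * hatL1 U (-q)) := by
    refine ae_eq_of_integral_schwartz_mul (hdc.locallyIntegrable (by norm_num))
      hcont.locallyIntegrable fun S _ => ?_
    obtain ⟨u, hu, hF⟩ := exists_schwartz_bessel S
    have h1 := hd (S.toLp 2)
    have h2 : ∫ x, U x * bessel (S.toLp 2) x = ∫ x, U x * u x := by
      rw [hu]
      refine integral_congr_ae ?_
      filter_upwards [u.coeFn_toLp 2 volume] with x hx
      rw [hx]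
    have h3 : ∫ x, conj (d x) * S.toLp 2 volume x = ∫ x, S x * conj (d x) := by
      refine integral_congr_ae ?_
      filter_upwards [S.coeFn_toLp 2 volume] with x hx
      rw [hx, mul_comm]
    rw [h2, integral_mul_schwartz_eq hU hF, h3] at h1
    exact h1.symm
  refine ⟨(memLp_congr_ae key).1 hdc, fun f => ?_⟩
  rw [hd f]
  refine integral_congr_ae ?_
  filter_upwards [key] with x hx
  rw [hx]

/-- The normalization constant `(2π)^{-3/2}`. -/
noncomputable abbrev cFour : ℂ := (((2 * Real.pi) ^ (-(3 / 2) : ℝ) : ℝ) : ℂ)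

theorem hatL1_congr {U W : R3 → ℂ} (h : U =ᵐ[volume] W) (p : R3) : hatL1 U p = hatL1 W p := by
  unfold hatL1 unitaryConvention
  rw [Real.fourier_congr_ae h]

/-- A modulation in position space translates the transform; this turns Parseval's identity into the
convolution theorem at an arbitrary point p. -/
theorem hatL1_modulate (U : R3 → ℂ) (p q : R3) :
    hatL1 (fun x => Real.fourierChar (-(inner ℝ x ((2 * Real.pi)⁻¹ • p))) • U x) q =
      hatL1 U (p + q) := by
  unfold hatL1 unitaryConvention
  rw [Real.fourier_eq, Real.fourier_eq]
  congr 2 with x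
  rw [smul_smul, ← AddChar.map_add_eq_mul, smul_add, inner_add_right]
  congr 2; ring

theorem cFour_mul_integral (U : R3 → ℂ) (p : R3) :
    cFour * ∫ x, Real.fourierChar (-(inner ℝ x ((2 * Real.pi)⁻¹ • p))) • U x = hatL1 U p := by
  rw [hatL1, unitaryConvention, Real.fourier_eq]

theorem continuous_modulation (p : R3) :
    Continuous fun x : R3 => Real.fourierChar (-(inner ℝ x p)) := by
  exact Real.continuous_fourierChar.comp (by fun_prop)

theorem memLp_modulate {U : R3 → ℂ} {r : ℝ≥0∞} (hU : MemLp U r volume) (p : R3) :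
    MemLp (fun x => Real.fourierChar (-(inner ℝ x p)) • U x) r volume := by
  refine hU.of_le ?_ (Eventually.of_forall fun x => by rw [Circle.norm_smul])
  exact (continuous_modulation p).aestronglyMeasurable.smul hU.aestronglyMeasurable

/-- Parseval's identity `pairing` for U multiplied by the character at p. -/
theorem conv_hatL1 {U : R3 → ℂ} (hU : Integrable U volume) (hU6 : MemLp U (6 / 5) volume)
    (f : L2) (p : R3) :
    Integrable (fun q => hatL1 U (p - q) * hatL2 (bessel f) q) volume ∧
      cFour * ∫ q, hatL1 U (p - q) * hatL2 (bessel f) q =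
        hatL1 (fun x => U x * bessel f x) p := by
  set M : R3 → ℂ := fun x => Real.fourierChar (-(inner ℝ x ((2 * Real.pi)⁻¹ • p))) • U x with hM
  have hM1 : Integrable M volume :=
    memLp_one_iff_integrable.1 (memLp_modulate (memLp_one_iff_integrable.2 hU) _)
  obtain ⟨h1, h2⟩ := pairing hM1 (memLp_modulate hU6 _)
  have h3 (q : R3) : hatL1 M (-q) = hatL1 U (p - q) := by
    rw [hM, hatL1_modulate, sub_eq_add_neg]
  have hae : (fun q => hatL1 U (p - q) * hatL2 (bessel f) q) =ᵐ[volume]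
      fun q => (wt q : ℂ)⁻¹ * hatL1 M (-q) * f q := by
    filter_upwards [hatL2_bessel f] with q hq
    rw [hq, h3]; ring
  refine ⟨(integrable_congr hae).2 (integrable_mul_L2 h1 (Lp.memLp f)), ?_⟩
  rw [integral_congr_ae hae, ← h2, ← cFour_mul_integral]
  congr 2 with x
  rw [hM, smul_mul_assoc]

theorem memLp_sub_left {g : R3 → ℂ} {r : ℝ≥0∞} (hg : MemLp g r volume) (p : R3) :
    MemLp (fun q => g (p - q)) r volume :=
  hg.comp_measurePreserving (Measure.measurePreserving_sub_left volume p)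

theorem hatL2_toLp_schwartz (S : SchwartzMap R3 ℂ) :
    hatL2 (S.toLp 2) =ᵐ[volume] hatL1 S := by
  have hq := quasiMeasurePreserving_smul_R3 (inv_ne_zero two_pi_ne_zero)
  filter_upwards [hq.ae ((𝓕 S).coeFn_toLp 2 volume)] with p hp
  rw [hatL2, hatL1, unitaryConvention, unitaryConvention, SchwartzMap.toLp_fourier_eq, hp,
    SchwartzMap.fourier_coe]

/-- For fixed p both sides are inner products, continuous in W ∈ L², and they agree for Schwartz W
by the L¹ case. -/
theorem conv_hatL2 (W f : L2) (p : R3) :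
    Integrable (fun q => hatL2 W (p - q) * hatL2 (bessel f) q) volume ∧
      cFour * ∫ q, hatL2 W (p - q) * hatL2 (bessel f) q =
        hatL1 (fun x => W x * bessel f x) p := by
  refine ⟨integrable_mul_L2 (memLp_sub_left (memLp_hatL2 W) p) (memLp_hatL2 _), ?_⟩
  set g := hatL2 (bessel f) with hg
  have hg2 : MemLp g 2 volume := memLp_hatL2 _
  have hG := memLp_conj (memLp_sub_left hg2 p)
  set ξ := (2 * Real.pi)⁻¹ • p
  have hH := memLp_conj (memLp_modulate (Lp.memLp (bessel f)) ξ)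
  have hL (W : L2) : cFour * ∫ q, hatL2 W (p - q) * g q =
      cFour * inner ℂ hG.toLp (hatEquiv W) := by
    rw [inner_toLp_left, ← integral_sub_left_eq_self (fun q => hatL2 W (p - q) * g q) volume p]
    congr 1
    refine integral_congr_ae ?_
    filter_upwards [hatEquiv_ae W] with q hq
    rw [hq, Complex.conj_conj, sub_sub_cancel, mul_comm]
  have hR (W : L2) : hatL1 (fun x => W x * bessel f x) p = cFour * inner ℂ hH.toLp W := by
    rw [inner_toLp_left, ← cFour_mul_integral]
    congr 2 with x
    rw [Complex.conj_conj, smul_mul_assoc, mul_comm (W x), ← smul_mul_assoc]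
  have hcL : Continuous fun W : L2 => cFour * inner ℂ hG.toLp (hatEquiv W) := by
    exact continuous_const.mul (continuous_const.inner hatEquiv.continuous)
  have hcR : Continuous fun W : L2 => cFour * inner ℂ hH.toLp W :=
    continuous_const.mul (continuous_const.inner continuous_id)
  rw [hL, hR]
  have hd := SchwartzMap.denseRange_toLpCLM (E := R3) (F := ℂ) (p := 2) (μ := volume)
    ENNReal.ofNat_ne_top
  refine congrFun (hd.equalizer hcL hcR (funext fun S => ?_)) W
  simp only [Function.comp_apply, SchwartzMap.toLpCLM_apply]
  rw [← hL, ← hR]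
  have h1 := (conv_hatL1 S.integrable (S.memLp (6 / 5) volume) f p).2
  rw [hatL1_congr (W := fun x => S x * bessel f x), ← h1]
  · congr 1
    refine integral_congr_ae ?_
    filter_upwards [(Measure.measurePreserving_sub_left (volume : Measure R3) p).quasiMeasurePreserving.ae
      (hatL2_toLp_schwartz S)] with q hq
    rw [hq]
  · filter_upwards [S.coeFn_toLp 2 volume] with x hx
    rw [hx]

/-! #### The potential -/

theorem largePart_add_smallPart (V : R3 → ℝ) (x : R3) :
    largePart V x + smallPart V x = (V x : ℂ) := by
  unfold largePart smallPart
  split_ifs <;> simp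

/-- Where |V| > 1, lowering the exponent lowers the power; hence the large part lies in every
smaller L^r, in particular in L¹ and L^{6/5}. -/
theorem memLp_largePart {V : R3 → ℝ} (hV : MemLp V (3 / 2) volume) {r : ℝ} (hr0 : 0 < r)
    (hr : r ≤ 3 / 2) : MemLp (largePart V) (ENNReal.ofReal r) volume := by
  have hmeas : AEStronglyMeasurable (largePart V) volume := by
    have ht : Measurable (fun y : ℝ => if |y| ≤ 1 then 0 else (y : ℂ)) :=
      Measurable.ite (measurableSet_le (by fun_prop) (by fun_prop)) (by fun_prop) (by fun_prop)
    exact (ht.comp_aemeasurable hV.aestronglyMeasurable.aemeasurable).aestronglyMeasurable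
  have h32 : ((3 / 2 : ENNReal)).toReal = 3 / 2 := by simp
  have hI : Integrable (fun x => ‖V x‖ ^ (3 / 2 : ℝ)) volume := by
    have h := hV.integrable_norm_rpow (by simp) (ENNReal.div_ne_top (by simp) (by simp))
    rwa [h32] at h
  rw [← integrable_norm_rpow_iff hmeas (by simpa using hr0) (by simp),
    ENNReal.toReal_ofReal hr0.le]
  refine hI.mono' (hmeas.norm.aemeasurable.pow_const r).aestronglyMeasurable
    (Eventually.of_forall fun x => ?_)
  rw [Real.norm_of_nonneg (by positivity)]
  unfold largePart
  split_ifs with h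
  · rw [norm_zero, Real.zero_rpow hr0.ne']; positivity
  · rw [Complex.norm_real]
    exact Real.rpow_le_rpow_of_exponent_le (by rw [Real.norm_eq_abs]; linarith) hr

theorem ofReal_sixFifths : ENNReal.ofReal (6 / 5) = 6 / 5 := by
  rw [ENNReal.ofReal_div_of_pos (by norm_num)]; simp

theorem memLp_largePart_one {V : R3 → ℝ} (hV : MemLp V (3 / 2) volume) :
    Integrable (largePart V) volume := by
  have := memLp_largePart hV one_pos (by norm_num)
  rw [ENNReal.ofReal_one] at this
  exact memLp_one_iff_integrable.1 this

theorem memLp_largePart_sixFifths {V : R3 → ℝ} (hV : MemLp V (3 / 2) volume) :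
    MemLp (largePart V) (6 / 5) volume := by
  rw [← ofReal_sixFifths]
  exact memLp_largePart hV (by norm_num) (by norm_num)

theorem memLp_ofReal {V : R3 → ℝ} {r : ℝ≥0∞} (hV : MemLp V r volume) :
    MemLp (fun x => (V x : ℂ)) r volume := hV.ofReal

/-- L^{6/5}·L⁶ for the large part and L²·L² for the small part. Since Vα is in L¹, its transform is
defined at every p, so the gap equation can hold pointwise. -/
theorem integrable_potential_mul {V : R3 → ℝ} (hV : MemLp V (3 / 2) volume) (f : L2) :
    Integrable (fun x => (V x : ℂ) * bessel f x) volume := by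
  have h1 := integrable_mul_bessel (memLp_largePart_sixFifths hV) f
  have h2 := integrable_mul_L2 (memLp_smallPart hV) (Lp.memLp (bessel f))
  refine (h1.add h2).congr (Eventually.of_forall fun x => ?_)
  simp only [Pi.add_apply]
  rw [← add_mul, largePart_add_smallPart]

theorem memLp_potential_mul {V : R3 → ℝ} (hV : MemLp V (3 / 2) volume) (f : L2) :
    MemLp (fun x => (V x : ℂ) * bessel f x) (6 / 5) volume :=
  (memLp_bessel_six f).mul (memLp_ofReal hV)

/-- The Fourier transform of `V α` is `(2π)^{-3/2} V̂ ∗ α̂`. -/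
theorem cFour_mul_convHatV {V : R3 → ℝ} (hV : MemLp V (3 / 2) volume) (f : L2) (p : R3) :
    cFour * convHatV hV (hatL2 (bessel f)) p = hatL1 (fun x => (V x : ℂ) * bessel f x) p := by
  obtain ⟨hi1, h1⟩ := conv_hatL1 (memLp_largePart_one hV) (memLp_largePart_sixFifths hV) f p
  obtain ⟨hi2, h2⟩ := conv_hatL2 ((memLp_smallPart hV).toLp (smallPart V)) f p
  have h3 : hatL1 (fun x => (memLp_smallPart hV).toLp (smallPart V) x * bessel f x) p =
      hatL1 (fun x => smallPart V x * bessel f x) p := by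
    refine hatL1_congr ?_ p
    filter_upwards [(memLp_smallPart hV).coeFn_toLp] with x hx
    rw [hx]
  unfold convHatV hatV
  simp_rw [add_mul]
  rw [integral_add hi1 hi2, mul_add, h1, h2, h3, ← cFour_mul_integral, ← cFour_mul_integral,
    ← cFour_mul_integral, ← mul_add, ← integral_add]
  · congr 2 with x
    rw [← smul_add, ← add_mul, largePart_add_smallPart]
  · exact memLp_one_iff_integrable.1 (memLp_modulate
      (memLp_one_iff_integrable.2 (integrable_mul_bessel (memLp_largePart_sixFifths hV) f)) _)
  · exact memLp_one_iff_integrable.1 (memLp_modulate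
      (memLp_one_iff_integrable.2 (integrable_mul_L2 (memLp_smallPart hV) (Lp.memLp (bessel f)))) _)

theorem convHatV_congr {V : R3 → ℝ} (hV : MemLp V (3 / 2) volume) {g h : R3 → ℂ}
    (hgh : g =ᵐ[volume] h) (p : R3) : convHatV hV g p = convHatV hV h p := by
  unfold convHatV
  refine integral_congr_ae ?_
  filter_upwards [hgh] with q hq
  rw [hq]

theorem gapFunction_bessel {V : R3 → ℝ} (hV : MemLp V (3 / 2) volume) (f : L2) (p : R3) :
    gapFunction hV (bessel f) p = 2 * hatL1 (fun x => (V x : ℂ) * bessel f x) p := by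
  rw [gapFunction, mul_assoc, cFour_mul_convHatV]

end Pairing

/-! ### The quadratic form of the potential -/

section Potential

open Filter Topology
open scoped ENNReal NNReal

/-- The sesquilinear form of the potential on `H¹`, in the coordinates given by `bessel`. -/
noncomputable def potForm (V : R3 → ℝ) (f g : L2) : ℂ :=
  ∫ x, (V x : ℂ) * (conj (bessel f x) * bessel g x)

/-- The quadratic form `∫ V |α|²` of the potential. -/
noncomputable def potQuad (V : R3 → ℝ) (f : L2) : ℝ := ∫ x, ‖bessel f x‖ ^ 2 * V x

theorem memLp_potential_mul_conj {V : R3 → ℝ} (hV : MemLp V (3 / 2) volume) (f : L2) :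
    MemLp (fun x => (V x : ℂ) * conj (bessel f x)) (6 / 5) volume :=
  (memLp_conj (memLp_bessel_six f)).mul (memLp_ofReal hV)

theorem integrable_potForm {V : R3 → ℝ} (hV : MemLp V (3 / 2) volume) (f g : L2) :
    Integrable (fun x => (V x : ℂ) * (conj (bessel f x) * bessel g x)) volume := by
  refine (integrable_mul_bessel (memLp_potential_mul_conj hV f) g).congr
    (Eventually.of_forall fun x => ?_)
  simp only [mul_assoc]

theorem potForm_self (V : R3 → ℝ) (f : L2) : potForm V f f = (potQuad V f : ℂ) := by
  unfold potForm potQuad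
  rw [← integral_complex_ofReal]
  congr 1 with x
  rw [Complex.conj_mul', Complex.ofReal_mul, Complex.ofReal_pow, mul_comm]

/-- Hölder with exponents 3/2, 6, 6 and Sobolev. The constant does not depend on V, so V may be
approximated in L^{3/2}. -/
theorem exists_norm_potForm_le : ∃ C : ℝ, 0 ≤ C ∧ ∀ (V : R3 → ℝ), MemLp V (3 / 2) volume →
    ∀ f g : L2, ‖potForm V f g‖ ≤ C * (eLpNorm V (3 / 2) volume).toReal * ‖f‖ * ‖g‖ := by
  obtain ⟨C, hC⟩ := exists_eLpNorm_bessel_le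
  refine ⟨C * C, by positivity, fun V hV f g => ?_⟩
  have hconj : eLpNorm (fun x => conj (bessel f x)) 6 volume = eLpNorm (bessel f) 6 volume :=
    eLpNorm_congr_norm_ae (Eventually.of_forall fun x => by simp)
  have hVc : eLpNorm (fun x => (V x : ℂ)) (3 / 2) volume = eLpNorm V (3 / 2) volume :=
    eLpNorm_congr_norm_ae (Eventually.of_forall fun x => by simp)
  have h1 : ‖potForm V f g‖ₑ ≤ eLpNorm V (3 / 2) volume * (C * ‖f‖ₑ) * (C * ‖g‖ₑ) := by
    refine (enorm_integral_le_lintegral_enorm _).trans ?_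
    rw [← eLpNorm_one_eq_lintegral_enorm]
    have h2 := eLpNorm_smul_le_mul_eLpNorm (p := 6 / 5) (q := 6) (r := 1) (f := bessel g)
      (φ := fun x => (V x : ℂ) * conj (bessel f x))
      (μ := volume) (Lp.aestronglyMeasurable _) (memLp_potential_mul_conj hV f).aestronglyMeasurable
    have h3 := eLpNorm_smul_le_mul_eLpNorm (p := 3 / 2) (q := 6) (r := 6 / 5)
      (f := fun x => conj (bessel f x)) (φ := fun x => (V x : ℂ))
      (μ := volume) (memLp_conj (memLp_bessel_six f)).aestronglyMeasurable
      (memLp_ofReal hV).aestronglyMeasurable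
    have e : (fun x => (V x : ℂ) * (conj (bessel f x) * bessel g x)) =
        (fun x => (V x : ℂ) * conj (bessel f x)) • (bessel g : R3 → ℂ) := by
      funext x; simp [mul_assoc]
    rw [e]
    refine h2.trans (mul_le_mul' ?_ (hC g))
    refine le_trans h3 ?_
    rw [hconj, hVc]
    exact mul_le_mul_right (hC f) _
  have h2 := ENNReal.toReal_mono (ENNReal.mul_ne_top (ENNReal.mul_ne_top hV.eLpNorm_ne_top
    (ENNReal.mul_ne_top ENNReal.coe_ne_top (by simp)))
    (ENNReal.mul_ne_top ENNReal.coe_ne_top (by simp))) h1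
  simp only [ENNReal.toReal_mul, toReal_enorm, ENNReal.coe_toReal] at h2
  refine h2.trans (le_of_eq (by ring))

theorem conj_hatL1 (U : R3 → ℂ) (p : R3) : conj (hatL1 U p) = hatL1 (fun x => conj (U x)) (-p) := by
  rw [← cFour_mul_integral, ← cFour_mul_integral, map_mul, Complex.conj_ofReal, ← integral_conj]
  congr 2 with x
  rw [Circle.smul_def, Circle.smul_def, smul_eq_mul, smul_eq_mul, map_mul]
  congr 1
  rw [smul_neg, inner_neg_right, ← Circle.coe_inv_eq_conj, ← AddChar.map_neg_eq_inv]

theorem memLp_comp_neg {g : R3 → ℂ} {r : ℝ≥0∞} (hg : MemLp g r volume) :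
    MemLp (fun q => g (-q)) r volume :=
  hg.comp_measurePreserving (Measure.measurePreserving_neg volume)

theorem memLp_hatL1_potential {V : R3 → ℝ} (hV : MemLp V (3 / 2) volume) (f : L2) :
    MemLp (fun q => (wt q : ℂ)⁻¹ * hatL1 (fun x => (V x : ℂ) * bessel f x) q) 2 volume := by
  have h := memLp_comp_neg (pairing (integrable_potential_mul hV f) (memLp_potential_mul hV f)).1
  simpa only [wt_neg, neg_neg] using h

/-- Identifies the form of V with the operator f ↦ (1+p²)^{-1/2} (Vα)^: this ties the abstract
variational problem to the concrete function Δ. -/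
theorem potForm_eq_inner {V : R3 → ℝ} (hV : MemLp V (3 / 2) volume) (f g : L2) :
    potForm V f g = inner ℂ (memLp_hatL1_potential hV f).toLp g := by
  have hc : (fun x => (V x : ℂ) * conj (bessel f x)) = fun x => conj ((V x : ℂ) * bessel f x) := by
    funext x; simp
  have h1 : Integrable (fun x => conj ((V x : ℂ) * bessel f x)) volume :=
    memLp_one_iff_integrable.1 (memLp_conj (memLp_one_iff_integrable.2 (integrable_potential_mul hV f)))
  have h := (pairing h1 (memLp_conj (memLp_potential_mul hV f))).2 g
  rw [inner_toLp_left, potForm]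
  have e1 : ∫ x, (V x : ℂ) * (conj (bessel f x) * bessel g x) =
      ∫ x, conj ((V x : ℂ) * bessel f x) * bessel g x := by
    congr 1 with x
    rw [map_mul, Complex.conj_ofReal, mul_assoc]
  rw [e1, h]
  congr 1 with q
  rw [map_mul, map_inv₀, Complex.conj_ofReal, conj_hatL1]

/-- The form bound is tested on the representing vector itself, and one factor of its norm is
cancelled. -/
theorem exists_norm_vOp_le {V : R3 → ℝ} (hV : MemLp V (3 / 2) volume) :
    ∃ C : ℝ, ∀ f, ‖(memLp_hatL1_potential hV f).toLp‖ ≤ C * ‖f‖ := by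
  obtain ⟨C, hC0, hC⟩ := exists_norm_potForm_le
  refine ⟨C * (eLpNorm V (3 / 2) volume).toReal, fun f => ?_⟩
  set d := (memLp_hatL1_potential hV f).toLp with hd
  have h1 := hC V hV f d
  rw [potForm_eq_inner hV, ← hd, inner_self_eq_norm_sq_to_K] at h1
  have h2 : ‖d‖ * ‖d‖ ≤ C * (eLpNorm V (3 / 2) volume).toReal * ‖f‖ * ‖d‖ := by
    simpa [sq] using h1
  rcases (norm_nonneg d).eq_or_lt with h0 | h0
  · rw [← h0]; positivity
  · exact le_of_mul_le_mul_right h2 h0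

/-- The bounded operator representing the potential in the coordinates given by `bessel`:
`f ↦ (1 + p²)^{-1/2} (V α)^`. -/
noncomputable def vOp {V : R3 → ℝ} (hV : MemLp V (3 / 2) volume) : L2 →L[ℂ] L2 :=
  LinearMap.mkContinuous
    { toFun := fun f => (memLp_hatL1_potential hV f).toLp
      map_add' := fun f g => by
        refine ext_inner_right ℂ fun h => ?_
        rw [inner_add_left, ← potForm_eq_inner hV, ← potForm_eq_inner hV, ← potForm_eq_inner hV, potForm,
          potForm, potForm, ← integral_add (integrable_potForm hV f h) (integrable_potForm hV g h)]
        refine integral_congr_ae ?_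
        rw [map_add]
        filter_upwards [Lp.coeFn_add (bessel f) (bessel g)] with x hx
        rw [hx, Pi.add_apply, map_add]; ring
      map_smul' := fun c f => by
        refine ext_inner_right ℂ fun h => ?_
        rw [RingHom.id_apply, inner_smul_left, ← potForm_eq_inner hV, ← potForm_eq_inner hV, potForm,
          potForm, ← integral_const_mul]
        refine integral_congr_ae ?_
        rw [map_smul]
        filter_upwards [Lp.coeFn_smul c (bessel f)] with x hx
        rw [hx, Pi.smul_apply, smul_eq_mul, map_mul]; ring }
    (exists_norm_vOp_le hV).choose (exists_norm_vOp_le hV).choose_spec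

theorem vOp_ae {V : R3 → ℝ} (hV : MemLp V (3 / 2) volume) (f : L2) :
    vOp hV f =ᵐ[volume] fun q => (wt q : ℂ)⁻¹ * hatL1 (fun x => (V x : ℂ) * bessel f x) q :=
  (memLp_hatL1_potential hV f).coeFn_toLp

theorem inner_vOp {V : R3 → ℝ} (hV : MemLp V (3 / 2) volume) (f g : L2) :
    inner ℂ (vOp hV f) g = potForm V f g := (potForm_eq_inner hV f g).symm

theorem potForm_conj_symm (V : R3 → ℝ) (f g : L2) : conj (potForm V f g) = potForm V g f := by
  unfold potForm
  rw [← integral_conj]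
  congr 1 with x
  rw [map_mul, map_mul, Complex.conj_conj, Complex.conj_ofReal, mul_comm (bessel f x)]

theorem inner_vOp_right {V : R3 → ℝ} (hV : MemLp V (3 / 2) volume) (f g : L2) :
    inner ℂ f (vOp hV g) = potForm V f g := by
  rw [← inner_conj_symm, inner_vOp, potForm_conj_symm]

theorem potQuad_eq_re {V : R3 → ℝ} (hV : MemLp V (3 / 2) volume) (f : L2) :
    potQuad V f = (inner ℂ (vOp hV f) f).re := by
  rw [inner_vOp, potForm_self, Complex.ofReal_re]

theorem continuous_potQuad {V : R3 → ℝ} (hV : MemLp V (3 / 2) volume) :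
    Continuous (potQuad V) := by
  have : potQuad V = fun f => (inner ℂ (vOp hV f) f).re := funext (potQuad_eq_re hV)
  rw [this]
  exact Complex.continuous_re.comp ((vOp hV).continuous.inner continuous_id)

theorem integrable_potQuad {V : R3 → ℝ} (hV : MemLp V (3 / 2) volume) (f : L2) :
    Integrable (fun x => ‖bessel f x‖ ^ 2 * V x) volume := by
  have h := (integrable_potForm hV f f).re
  refine h.congr (Eventually.of_forall fun x => ?_)
  simp only [RCLike.re_eq_complex_re]
  rw [Complex.conj_mul']
  rw [← Complex.ofReal_pow, ← Complex.ofReal_mul, Complex.ofReal_re, mul_comm]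

/-- Cut V where |V| ≥ M; uniform integrability makes the removed part small. The remainder is in L²
since |W|² ≤ M^{1/2} |W|^{3/2}. -/
theorem exists_bounded_approx {V : R3 → ℝ} (hV : MemLp V (3 / 2) volume) {ε : ℝ} (hε : 0 < ε) :
    ∃ (W : R3 → ℝ) (N : ℝ), 0 ≤ N ∧ MemLp W (3 / 2) volume ∧ MemLp W 2 volume ∧
      (∀ x, |W x| ≤ N) ∧ (eLpNorm (fun x => V x - W x) (3 / 2) volume).toReal ≤ ε := by
  set g := hV.1.mk V with hg
  have hgm : StronglyMeasurable g := hV.1.stronglyMeasurable_mk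
  have hVg : V =ᵐ[volume] g := hV.1.ae_eq_mk
  have hgL : MemLp g (3 / 2) volume := (memLp_congr_ae hVg).1 hV
  obtain ⟨M, hM0, hM⟩ := hgL.eLpNorm_indicator_norm_ge_pos_le hgm hε
  set A : Set R3 := {x | M ≤ ‖g x‖₊} with hA
  have hAm : MeasurableSet A := measurableSet_le measurable_const hgm.measurable.nnnorm.subtype_coe
  have hWb (x) : |Aᶜ.indicator g x| ≤ M := by
    by_cases hx : x ∈ A
    · simp [hx, hM0.le]
    · rw [Set.indicator_of_mem (by simpa using hx)]
      have : (‖g x‖₊ : ℝ) < M := not_le.1 hx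
      exact this.le
  have hW : MemLp (Aᶜ.indicator g) (3 / 2) volume := hgL.indicator hAm.compl
  refine ⟨Aᶜ.indicator g, M, hM0.le, hW, ?_, hWb, ?_⟩
  · have hI : Integrable (fun x => ‖Aᶜ.indicator g x‖ ^ (3 / 2 : ℝ)) volume := by
      have h := hW.integrable_norm_rpow (by simp) (ENNReal.div_ne_top (by simp) (by simp))
      rwa [show ((3 / 2 : ENNReal)).toReal = 3 / 2 by simp] at h
    rw [memLp_two_iff_integrable_sq_norm hW.aestronglyMeasurable]
    refine (hI.const_mul (M ^ (1 / 2 : ℝ))).mono' (hW.aestronglyMeasurable.norm.pow 2)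
      (Eventually.of_forall fun x => ?_)
    rw [Real.norm_of_nonneg (by positivity)]
    set y := ‖Aᶜ.indicator g x‖ with hy
    have hy0 : 0 ≤ y := norm_nonneg _
    have hyM : y ≤ M := hWb x
    have e : y ^ 2 = y ^ (1 / 2 : ℝ) * y ^ (3 / 2 : ℝ) := by
      rw [← Real.rpow_add_of_nonneg hy0 (by norm_num) (by norm_num), ← Real.rpow_natCast]
      norm_num
    rw [e]
    exact mul_le_mul_of_nonneg_right (Real.rpow_le_rpow hy0 hyM (by norm_num)) (by positivity)
  · have h1 : eLpNorm (fun x => V x - Aᶜ.indicator g x) (3 / 2) volume =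
        eLpNorm (A.indicator g) (3 / 2) volume := by
      refine eLpNorm_congr_ae ?_
      filter_upwards [hVg] with x hx
      rw [hx]
      by_cases h : x ∈ A <;> simp [h]
    rw [h1]
    exact ENNReal.toReal_le_of_le_ofReal hε.le hM

theorem potQuad_sub {V W : R3 → ℝ} (hV : MemLp V (3 / 2) volume) (hW : MemLp W (3 / 2) volume)
    (f : L2) : potQuad V f - potQuad W f = potQuad (fun x => V x - W x) f := by
  unfold potQuad
  rw [← integral_sub (integrable_potQuad hV f) (integrable_potQuad hW f)]
  congr 1 with x; ring

/-- The L^{3/2} error is measured by the Sobolev bound, uniformly on bounded sets of H¹. Questions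
of weak continuity thus reduce to bounded potentials. -/
theorem abs_potQuad_sub_le {V : R3 → ℝ} (hV : MemLp V (3 / 2) volume) {ε : ℝ} (hε : 0 < ε) :
    ∃ (W : R3 → ℝ) (N : ℝ), 0 ≤ N ∧ MemLp W (3 / 2) volume ∧ MemLp W 2 volume ∧
      (∀ x, |W x| ≤ N) ∧ ∀ f, |potQuad V f - potQuad W f| ≤ ε * ‖f‖ ^ 2 := by
  obtain ⟨C, hC0, hC⟩ := exists_norm_potForm_le
  obtain ⟨W, N, hN, hW, hW2, hWN, hVW⟩ := exists_bounded_approx hV (ε := ε / (C + 1)) (by positivity)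
  refine ⟨W, N, hN, hW, hW2, hWN, fun f => ?_⟩
  have h := hC _ (hV.sub hW) f f
  rw [potQuad_sub hV hW]
  have h1 : ‖potForm (V - W) f f‖ = |potQuad (fun x => V x - W x) f| := by
    change ‖potForm (fun x => V x - W x) f f‖ = _
    rw [potForm_self, Complex.norm_real, Real.norm_eq_abs]
  rw [h1] at h
  refine h.trans ?_
  rw [mul_assoc, ← sq]
  refine mul_le_mul_of_nonneg_right ?_ (sq_nonneg _)
  have h2 : (eLpNorm (V - W) (3 / 2) volume).toReal ≤ ε / (C + 1) := hVW
  calc C * (eLpNorm (V - W) (3 / 2) volume).toReal ≤ (C + 1) * (ε / (C + 1)) := by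
        gcongr; linarith
    _ = ε := by field_simp

theorem norm_potForm_le_of_bounded {W : R3 → ℝ} {N : ℝ} (hN : 0 ≤ N) (hWN : ∀ x, |W x| ≤ N)
    (f g : L2) : ‖potForm W f g‖ ≤ N * ‖bessel f‖ * ‖bessel g‖ := by
  have hf := integrable_norm_sq (bessel f)
  have hg := integrable_norm_sq (bessel g)
  have hi : Integrable (fun x => ‖bessel f x‖ * ‖bessel g x‖) volume :=
    (Lp.memLp (bessel f)).norm.integrable_mul (Lp.memLp (bessel g)).norm
  have h1 : ‖potForm W f g‖ ≤ ∫ x, N * (‖bessel f x‖ * ‖bessel g x‖) := by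
    refine norm_integral_le_of_norm_le (hi.const_mul N) (Eventually.of_forall fun x => ?_)
    rw [norm_mul, norm_mul, RCLike.norm_conj, Complex.norm_real]
    exact mul_le_mul_of_nonneg_right (hWN x) (by positivity)
  refine h1.trans ?_
  rw [integral_const_mul, mul_assoc]
  refine mul_le_mul_of_nonneg_left ?_ hN
  have h2 := integral_mul_le_Lp_mul_Lq_of_nonneg (μ := (volume : Measure R3)) (p := 2) (q := 2)
    (f := fun x => ‖bessel f x‖) (g := fun x => ‖bessel g x‖) Real.HolderConjugate.two_two
    (Eventually.of_forall fun x => norm_nonneg _) (Eventually.of_forall fun x => norm_nonneg _)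
    (by simpa using (Lp.memLp (bessel f)).norm) (by simpa using (Lp.memLp (bessel g)).norm)
  refine h2.trans (le_of_eq ?_)
  simp only [Real.rpow_two]
  rw [← norm_sq_eq_integral, ← norm_sq_eq_integral, ← Real.sqrt_eq_rpow, ← Real.sqrt_eq_rpow,
    Real.sqrt_sq (norm_nonneg _), Real.sqrt_sq (norm_nonneg _)]

/-- The potential is infinitesimally form bounded with respect to the Laplacian. -/
theorem exists_abs_potQuad_le {V : R3 → ℝ} (hV : MemLp V (3 / 2) volume) {ε : ℝ} (hε : 0 < ε) :
    ∃ C : ℝ, 0 ≤ C ∧ ∀ f, |potQuad V f| ≤ ε * ‖f‖ ^ 2 + C * ‖bessel f‖ ^ 2 := by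
  obtain ⟨W, N, hN, hW, hW2, hWN, h⟩ := abs_potQuad_sub_le hV hε
  refine ⟨N, hN, fun f => ?_⟩
  have h1 := norm_potForm_le_of_bounded hN hWN f f
  rw [potForm_self, Complex.norm_real, Real.norm_eq_abs, mul_assoc, ← sq] at h1
  have h2 := h f
  have h3 := abs_sub_abs_le_abs_sub (potQuad V f) (potQuad W f)
  linarith

end Potential

/-! ### Weak sequential continuity of the potential energy -/

section WeakContinuity

open Filter Topology
open scoped ENNReal NNReal

/-- Weak convergence of sequences in `L²`. -/
def WeakTendsto (F : ℕ → L2) (f : L2) : Prop :=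
  ∀ g : L2, Tendsto (fun n => inner ℂ g (F n)) atTop (𝓝 (inner ℂ g f))

theorem WeakTendsto.map {F : ℕ → L2} {f : L2} (h : WeakTendsto F f) (A : L2 →L[ℂ] L2) :
    WeakTendsto (fun n => A (F n)) (A f) := fun g => by
  simpa only [ContinuousLinearMap.adjoint_inner_left] using h (A.adjoint g)

theorem WeakTendsto.inner_of_tendsto {F A : ℕ → L2} {f a : L2} {M : ℝ} (h : WeakTendsto F f)
    (hM : ∀ n, ‖F n‖ ≤ M) (hA : Tendsto A atTop (𝓝 a)) :
    Tendsto (fun n => inner ℂ (A n) (F n)) atTop (𝓝 (inner ℂ a f)) := by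
  have h1 : Tendsto (fun n => inner ℂ (A n - a) (F n)) atTop (𝓝 0) := by
    refine squeeze_zero_norm (a := fun n => ‖A n - a‖ * M) (fun n => ?_) ?_
    · exact (norm_inner_le_norm _ _).trans (mul_le_mul_of_nonneg_left (hM n) (norm_nonneg _))
    · simpa using (tendsto_iff_norm_sub_tendsto_zero.1 hA).mul_const M
  have h2 := h1.add (h a)
  simp only [inner_sub_left, sub_add_cancel, zero_add] at h2
  exact h2

theorem tendsto_of_uniform_approx {v : ℕ → ℝ} {v₀ : ℝ}
    (h : ∀ ε > 0, ∃ (a : ℕ → ℝ) (b : ℝ), Tendsto a atTop (𝓝 b) ∧ (∀ n, |v n - a n| ≤ ε) ∧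
      |v₀ - b| ≤ ε) : Tendsto v atTop (𝓝 v₀) := by
  rw [Metric.tendsto_atTop]
  intro ε hε
  obtain ⟨a, b, hab, hv, hb⟩ := h (ε / 4) (by linarith)
  obtain ⟨n₀, hn₀⟩ := Metric.tendsto_atTop.1 hab (ε / 4) (by linarith)
  refine ⟨n₀, fun n hn => ?_⟩
  have h1 := hn₀ n hn
  rw [Real.dist_eq] at h1 ⊢
  have h2 := abs_lt.1 h1
  have h3 := abs_le.1 (hv n)
  have h4 := abs_le.1 hb
  rw [abs_lt]
  constructor <;> linarith [h2.1, h2.2, h3.1, h3.2, h4.1, h4.2]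

theorem inner_mulOp_left {m : R3 → ℝ} (hm : Measurable m) {C : ℝ} (hC : ∀ p, |m p| ≤ C)
    (f g : L2) : inner ℂ (mulOp m hm C hC f) g = inner ℂ f (mulOp m hm C hC g) := by
  rw [inner_eq_integral, inner_eq_integral]
  refine integral_congr_ae ?_
  filter_upwards [mulOp_ae hm hC f, mulOp_ae hm hC g] with p h1 h2
  rw [h1, h2, map_mul, Complex.conj_ofReal]; ring

/-- The indicator function of the ball of radius `R` in momentum space. -/
noncomputable def ballInd (R : ℝ) (p : R3) : ℝ := if ‖p‖ ≤ R then 1 else 0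

theorem measurable_ballInd (R : ℝ) : Measurable (ballInd R) :=
  Measurable.ite (measurableSet_le measurable_norm measurable_const) measurable_const
    measurable_const

theorem abs_ballInd_le (R : ℝ) (p : R3) : |ballInd R p| ≤ 1 := by
  unfold ballInd; split_ifs <;> simp

theorem integrable_ballInd (R : ℝ) : Integrable (ballInd R) volume := by
  have h : ballInd R = (Metric.closedBall (0 : R3) R).indicator fun _ => (1 : ℝ) := by
    funext p; by_cases h : ‖p‖ ≤ R <;> simp [ballInd, h]
  rw [h, integrable_indicator_iff Metric.isClosed_closedBall.measurableSet]
  exact integrableOn_const (isCompact_closedBall _ _).measure_lt_top.ne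

/-- The projection onto momenta in the ball of radius `R`. -/
noncomputable def ballProj (R : ℝ) : L2 →L[ℂ] L2 :=
  mulOp (ballInd R) (measurable_ballInd R) 1 (abs_ballInd_le R)

/-- Outside the ball of radius R the multiplier (1+p²)^{-1/2} is at most 1/R: high momenta have
small L² norm, uniformly on bounded sets of H¹. -/
theorem norm_bessel_sub_ballProj_le {R : ℝ} (hR : 0 < R) (f : L2) :
    ‖bessel (f - ballProj R f)‖ ≤ R⁻¹ * ‖f‖ := by
  refine abs_le_of_sq_le_sq' ?_ (by positivity) |>.2
  rw [norm_sq_bessel, mul_pow, norm_sq_eq_integral f, ← integral_const_mul]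
  refine integral_mono_of_nonneg (Eventually.of_forall fun p => by positivity)
    ((integrable_norm_sq f).const_mul _) ?_
  filter_upwards [mulOp_ae (measurable_ballInd R) (abs_ballInd_le R) f,
    Lp.coeFn_sub f (ballProj R f)] with p h1 h2
  have h3 : (f - ballProj R f) p = (1 - (ballInd R p : ℂ)) * f p := by
    rw [h2, Pi.sub_apply, ballProj, h1]; ring
  simp only [h3, ballInd]
  split_ifs with h
  · simp; positivity
  · simp only [Complex.ofReal_zero, sub_zero, one_mul]
    refine mul_le_mul_of_nonneg_right ?_ (sq_nonneg _)
    have := norm_le_wt p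
    have h5 : R ≤ wt p := (not_le.1 h).le.trans this
    have := (inv_pos.2 (wt_pos p)).le
    gcongr

/-- For W ∈ L² the value of (Wα)^ at a fixed p is a bounded linear functional of α, with a bound
independent of p. Weak convergence of α therefore gives pointwise convergence of (Wα)^ together with
a dominating constant. -/
theorem hatL1_potential_eq_inner {W : R3 → ℝ} (hW2 : MemLp W 2 volume) (p : R3) :
    ∃ g : L2, ‖g‖ ≤ (eLpNorm W 2 volume).toReal ∧ ∀ α : L2,
      hatL1 (fun x => (W x : ℂ) * α x) p = cFour * inner ℂ g α := by
  have hWc : MemLp (fun x => (W x : ℂ)) 2 volume := memLp_ofReal hW2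
  have hM := memLp_conj (memLp_modulate hWc ((2 * Real.pi)⁻¹ • p))
  refine ⟨hM.toLp, ?_, fun α => ?_⟩
  · rw [Lp.norm_toLp]
    refine le_of_eq ?_
    congr 1
    exact eLpNorm_congr_norm_ae (Eventually.of_forall fun x => by simp [Circle.norm_smul])
  · rw [inner_toLp_left, ← cFour_mul_integral]
    congr 2 with x
    rw [Complex.conj_conj, smul_mul_assoc]

/-- The compactness behind the weak continuity: on a ball of momenta the weighted transforms of Wα
converge pointwise and boundedly, hence in L². -/
theorem tendsto_ballProj_vOp {W : R3 → ℝ} (hW : MemLp W (3 / 2) volume) (hW2 : MemLp W 2 volume)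
    {F : ℕ → L2} {f : L2} {M : ℝ} (h : WeakTendsto F f) (hM : ∀ n, ‖F n‖ ≤ M) (R : ℝ) :
    Tendsto (fun n => ballProj R (vOp hW (F n))) atTop (𝓝 (ballProj R (vOp hW f))) := by
  rw [tendsto_iff_norm_sub_tendsto_zero]
  have hsq : Tendsto (fun n => ‖ballProj R (vOp hW (F n)) - ballProj R (vOp hW f)‖ ^ 2) atTop
      (𝓝 0) := by
    set G : ℕ → R3 → ℂ := fun n p => hatL1 (fun x => (W x : ℂ) * bessel (F n - f) x) p with hG
    have hG0 (p : R3) : Tendsto (fun n => G n p) atTop (𝓝 0) := by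
      obtain ⟨g, -, hg⟩ := hatL1_potential_eq_inner hW2 p
      simp only [hG, hg, map_sub, inner_sub_right]
      have h1 := ((h.map bessel g).sub_const (inner ℂ g (bessel f))).const_mul (cFour : ℂ)
      simpa using h1
    have hGb (n : ℕ) (p : R3) : ‖G n p‖ ≤
        ‖(cFour : ℂ)‖ * ((eLpNorm W 2 volume).toReal * (M + ‖f‖)) := by
      obtain ⟨g, hgn, hg⟩ := hatL1_potential_eq_inner hW2 p
      simp only [hG, hg, norm_mul]
      refine mul_le_mul_of_nonneg_left ((norm_inner_le_norm _ _).trans ?_) (norm_nonneg _)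
      refine mul_le_mul hgn ?_ (norm_nonneg _) ENNReal.toReal_nonneg
      exact (norm_bessel_le _).trans ((norm_sub_le _ _).trans (add_le_add_left (hM n) _))
    have hGc (n : ℕ) : Continuous (G n) := continuous_hatL1 (integrable_potential_mul hW _)
    have e (n : ℕ) : ‖ballProj R (vOp hW (F n)) - ballProj R (vOp hW f)‖ ^ 2 =
        ∫ p, ballInd R p * ((wt p)⁻¹ ^ 2 * ‖G n p‖ ^ 2) := by
      rw [← map_sub, ← map_sub, norm_sq_eq_integral]
      refine integral_congr_ae ?_
      filter_upwards [mulOp_ae (measurable_ballInd R) (abs_ballInd_le R) (vOp hW (F n - f)),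
        vOp_ae hW (F n - f)] with p h1 h2
      rw [ballProj, h1, h2, norm_mul, norm_mul, mul_pow, mul_pow, norm_inv, Complex.norm_real,
        Complex.norm_real, Real.norm_of_nonneg (wt_pos p).le]
      congr 1
      unfold ballInd; split_ifs <;> simp
    simp only [e]
    set B := ‖(cFour : ℂ)‖ * ((eLpNorm W 2 volume).toReal * (M + ‖f‖)) with hB
    have h0 : (∫ p, ballInd R p * ((wt p)⁻¹ ^ 2 * ‖(0 : ℂ)‖ ^ 2)) = 0 := by simp
    rw [← h0]
    refine tendsto_integral_of_dominated_convergence (fun p => ballInd R p * B ^ 2)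
      (fun n => ?_) ((integrable_ballInd R).mul_const _) (fun n => ?_) ?_
    · exact (measurable_ballInd R).aestronglyMeasurable.mul
        ((measurable_inv_wt.aestronglyMeasurable.pow 2).mul
          ((hGc n).aestronglyMeasurable.norm.pow 2))
    · refine Eventually.of_forall fun p => ?_
      have h1 : 0 ≤ ballInd R p := by unfold ballInd; split_ifs <;> simp
      rw [Real.norm_of_nonneg (mul_nonneg h1 (by positivity))]
      refine mul_le_mul_of_nonneg_left ?_ h1
      have h2 := abs_inv_wt_le p
      rw [abs_of_pos (inv_pos.2 (wt_pos p))] at h2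
      calc (wt p)⁻¹ ^ 2 * ‖G n p‖ ^ 2 ≤ 1 ^ 2 * B ^ 2 := by
            gcongr
            · exact (inv_pos.2 (wt_pos p)).le
            · exact hGb n p
        _ = B ^ 2 := by ring
    · refine Eventually.of_forall fun p => ?_
      exact (((hG0 p).norm.pow 2).const_mul _).const_mul _
  have h1 := (Real.continuous_sqrt.tendsto _).comp hsq
  simpa [Function.comp_def, Real.sqrt_sq] using h1

/-- Insert a momentum projection on one side of the form. The projected form pairs a strongly with a
weakly convergent sequence; for bounded W the discarded part is at most N M²/R, whence the choice of
R. -/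
theorem tendsto_potQuad_of_bounded {W : R3 → ℝ} {N : ℝ} (hN : 0 ≤ N) (hWN : ∀ x, |W x| ≤ N)
    (hW : MemLp W (3 / 2) volume) (hW2 : MemLp W 2 volume)
    {F : ℕ → L2} {f : L2} {M : ℝ} (h : WeakTendsto F f) (hM : ∀ n, ‖F n‖ ≤ M)
    (hf : ‖f‖ ≤ M) : Tendsto (fun n => potQuad W (F n)) atTop (𝓝 (potQuad W f)) := by
  have hM0 : 0 ≤ M := (norm_nonneg _).trans hf
  refine tendsto_of_uniform_approx fun ε hε => ?_
  set R : ℝ := (N * M * M + 1) / ε with hR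
  have hR0 : 0 < R := by positivity
  have key (g : L2) (hg : ‖g‖ ≤ M) :
      |potQuad W g - (inner ℂ (ballProj R (vOp hW g)) g).re| ≤ ε := by
    rw [potQuad_eq_re hW, ← Complex.sub_re, ballProj, inner_mulOp_left, ← ballProj,
      ← inner_sub_right, inner_vOp]
    refine (Complex.abs_re_le_norm _).trans ((norm_potForm_le_of_bounded hN hWN _ _).trans ?_)
    calc N * ‖bessel g‖ * ‖bessel (g - ballProj R g)‖ ≤ N * M * (R⁻¹ * M) := by
          gcongr
          · exact (norm_bessel_le g).trans hg
          · exact (norm_bessel_sub_ballProj_le hR0 g).trans (by gcongr)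
      _ = N * M * M / R := by ring
      _ ≤ ε := by
          rw [div_le_iff₀ hR0, hR, mul_div_cancel₀ _ hε.ne']; linarith
  exact ⟨fun n => (inner ℂ (ballProj R (vOp hW (F n))) (F n)).re,
    (inner ℂ (ballProj R (vOp hW f)) f).re,
    (Complex.continuous_re.tendsto _).comp
      (h.inner_of_tendsto hM (tendsto_ballProj_vOp hW hW2 h hM R)), fun n => key _ (hM n),
    key _ hf⟩

/-- The potential energy is weakly sequentially continuous on bounded sequences. -/
theorem tendsto_potQuad {V : R3 → ℝ} (hV : MemLp V (3 / 2) volume) {F : ℕ → L2} {f : L2} {M : ℝ}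
    (h : WeakTendsto F f) (hM : ∀ n, ‖F n‖ ≤ M) (hf : ‖f‖ ≤ M) :
    Tendsto (fun n => potQuad V (F n)) atTop (𝓝 (potQuad V f)) := by
  have hM0 : 0 ≤ M := (norm_nonneg _).trans hf
  refine tendsto_of_uniform_approx fun ε hε => ?_
  obtain ⟨W, N, hN, hW, hW2, hWN, hVW⟩ := abs_potQuad_sub_le hV (ε := ε / (M ^ 2 + 1)) (by positivity)
  have key (g : L2) (hg : ‖g‖ ≤ M) : |potQuad V g - potQuad W g| ≤ ε := by
    refine (hVW g).trans ?_
    rw [div_mul_eq_mul_div, div_le_iff₀ (by positivity)]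
    have : ‖g‖ ^ 2 ≤ M ^ 2 := pow_le_pow_left₀ (norm_nonneg _) hg 2
    exact mul_le_mul_of_nonneg_left (by linarith) hε.le
  exact ⟨fun n => potQuad W (F n), potQuad W f, tendsto_potQuad_of_bounded hN hWN hW hW2 h hM hf,
    fun n => key _ (hM n), key _ hf⟩

/-- Bounded sequences in `L²` have weakly convergent subsequences. -/
theorem exists_weakTendsto_subseq {F : ℕ → L2} {M : ℝ} (hM : ∀ n, ‖F n‖ ≤ M) :
    ∃ f : L2, ‖f‖ ≤ M ∧ ∃ φ : ℕ → ℕ, StrictMono φ ∧ WeakTendsto (fun n => F (φ n)) f := by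
  have : Fact ((2 : ℝ≥0∞) ≠ ∞) := ⟨by simp⟩
  have : SecondCountableTopology L2 := Lp.SecondCountableTopology
  have hc := WeakDual.isSeqCompact_closedBall (𝕜 := ℂ) (E := L2) 0 M
  set G : ℕ → WeakDual ℂ L2 := fun n => StrongDual.toWeakDual (InnerProductSpace.toDual ℂ L2 (F n))
    with hG
  obtain ⟨a, ha, φ, hφ, hlim⟩ := hc (x := G) (fun n => by simpa [hG] using hM n)
  obtain ⟨f, hf⟩ := (InnerProductSpace.toDual ℂ L2).surjective (WeakDual.toStrongDual a)
  refine ⟨f, ?_, φ, hφ, fun g => ?_⟩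
  · rw [← (InnerProductSpace.toDual ℂ L2).norm_map f, hf]
    simpa using ha
  · have h1 := ((WeakDual.eval_continuous g).tendsto a).comp hlim
    have h2 : a g = inner ℂ f g := by
      rw [← InnerProductSpace.toDual_apply_apply, hf]; rfl
    rw [h2] at h1
    have h3 : Tendsto (fun n => inner ℂ (F (φ n)) g) atTop (𝓝 (inner ℂ f g)) := h1
    simpa only [Function.comp_def, inner_conj_symm] using
      (Complex.continuous_conj.tendsto _).comp h3

end WeakContinuity

/-! ### The direct method -/

section DirectMethod

open Filter Topology
open scoped ENNReal NNReal

theorem WeakTendsto.norm_le {F : ℕ → L2} {f : L2} {M : ℝ} (h : WeakTendsto F f)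
    (hM : ∀ n, ‖F n‖ ≤ M) : ‖f‖ ≤ M := by
  have h1 : Tendsto (fun n => ‖inner ℂ f (F n)‖) atTop (𝓝 ‖inner ℂ f f‖) := (h f).norm
  have h2 : ‖inner ℂ f f‖ ≤ ‖f‖ * M := le_of_tendsto' h1 fun n =>
    (norm_inner_le_norm _ _).trans (mul_le_mul_of_nonneg_left (hM n) (norm_nonneg _))
  rw [inner_self_eq_norm_sq_to_K] at h2
  have h3 : ‖f‖ * ‖f‖ ≤ ‖f‖ * M := by simpa [sq] using h2
  rcases (norm_nonneg f).eq_or_lt with h0 | h0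
  · rw [← h0]; exact (norm_nonneg _).trans (hM 0)
  · exact le_of_mul_le_mul_left h3 h0

theorem WeakTendsto.isEven {F : ℕ → L2} {f : L2} (h : WeakTendsto F f)
    (hF : ∀ n, IsEven (F n)) : IsEven f := by
  rw [isEven_iff]
  refine ext_inner_left ℂ fun g => ?_
  have h1 := h.map reflect.toContinuousLinearMap g
  have h2 : (fun n => inner ℂ g (reflect.toContinuousLinearMap (F n))) =
      fun n => inner ℂ g (F n) := by
    funext n
    rw [LinearIsometry.coe_toContinuousLinearMap, (isEven_iff _).1 (hF n)]
  rw [h2] at h1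
  exact tendsto_nhds_unique h1 (h g)

/-- The direct method in the calculus of variations for a functional `m + ∫ V |α|²` on a weakly
closed subset of `L² × ℝ`. -/
theorem exists_minimizer {V : R3 → ℝ} (hV : MemLp V (3 / 2) volume) {E : Set (L2 × ℝ)}
    {x₀ : L2 × ℝ} (hx₀ : x₀ ∈ E) (h0 : ∀ x ∈ E, 0 ≤ x.2)
    (hclosed : ∀ (F : ℕ → L2) (m : ℕ → ℝ) (f : L2) (m₀ : ℝ), (∀ n, (F n, m n) ∈ E) →
      WeakTendsto F f → Tendsto m atTop (𝓝 m₀) → (f, m₀) ∈ E)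
    {M : ℝ} (hM : ∀ x ∈ E, x.2 + potQuad V x.1 ≤ x₀.2 + potQuad V x₀.1 → ‖x.1‖ ≤ M) :
    ∃ x ∈ E, ∀ y ∈ E, x.2 + potQuad V x.1 ≤ y.2 + potQuad V y.1 := by
  obtain ⟨C, hC0, hC⟩ := exists_abs_potQuad_le hV zero_lt_one
  set c := x₀.2 + potQuad V x₀.1 with hc
  have hv (x) (hx : x ∈ E) (h : x.2 + potQuad V x.1 ≤ c) :
      |potQuad V x.1| ≤ (1 + C) * M ^ 2 := by
    have h1 := hM x hx h
    have h2 : ‖x.1‖ ^ 2 ≤ M ^ 2 := pow_le_pow_left₀ (norm_nonneg _) h1 2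
    have h3 : ‖bessel x.1‖ ^ 2 ≤ M ^ 2 :=
      pow_le_pow_left₀ (norm_nonneg _) ((norm_bessel_le _).trans h1) 2
    nlinarith [hC x.1]
  set S : Set ℝ := {r | ∃ x ∈ E, r = x.2 + potQuad V x.1 ∧ r ≤ c} with hS
  have hSb : BddBelow S := by
    refine ⟨-((1 + C) * M ^ 2), ?_⟩
    rintro r ⟨x, hx, rfl, hr⟩
    linarith [(abs_le.1 (hv x hx hr)).1, h0 x hx]
  have hSn : S.Nonempty := ⟨c, x₀, hx₀, rfl, le_rfl⟩
  obtain ⟨u, -, hu, huS⟩ := exists_seq_tendsto_sInf hSn hSb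
  choose X hXE hXu hXc using huS
  have hXb (n) : ‖(X n).1‖ ≤ M := hM _ (hXE n) ((hXu n) ▸ hXc n)
  obtain ⟨f, hf, φ, hφ, hw⟩ := exists_weakTendsto_subseq hXb
  have hvlim := tendsto_potQuad hV hw (fun n => hXb _) hf
  -- The total converges to the infimum and the potential energy converges, so the second component
  -- converges as well. Closedness of the epigraph then takes the place of lower semicontinuity.
  have hm : Tendsto (fun n => (X (φ n)).2) atTop (𝓝 (sInf S - potQuad V f)) := by
    have h1 := (hu.comp hφ.tendsto_atTop).sub hvlim
    refine h1.congr fun n => ?_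
    simp only [Function.comp_apply, hXu]; ring
  refine ⟨(f, sInf S - potQuad V f), hclosed _ _ _ _ (fun n => hXE (φ n)) hw hm, fun y hy => ?_⟩
  simp only [sub_add_cancel]
  by_cases h : y.2 + potQuad V y.1 ≤ c
  · exact csInf_le hSb ⟨y, hy, rfl, h⟩
  · exact (csInf_le hSb ⟨x₀, hx₀, rfl, le_rfl⟩).trans (not_le.1 h).le

end DirectMethod

/-! ### The kinetic weight -/

section Kinetic

open Filter Topology

theorem half_wt_sq_le {μ : ℝ} {p : R3} (hp : 2 * |μ| + 1 ≤ ‖p‖) : wt p ^ 2 / 2 ≤ ‖p‖ ^ 2 - μ := by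
  rw [wt_sq]
  have h1 := le_abs_self μ
  have h2 := abs_nonneg μ
  nlinarith

theorem abs_xi_le (μ : ℝ) (p : R3) : |‖p‖ ^ 2 - μ| ≤ (1 + |μ|) * wt p ^ 2 := by
  rw [wt_sq]
  have h1 := le_abs_self μ
  have h2 := neg_abs_le μ
  have h3 := abs_nonneg μ
  have h4 := sq_nonneg ‖p‖
  rw [abs_le]
  constructor <;> nlinarith

theorem KZero_le {T : ℝ} (hT : 0 ≤ T) (μ : ℝ) (p : R3) :
    KZero μ T p ≤ (1 + |μ| + 2 * T) * wt p ^ 2 := by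
  have h1 := thermal_le hT (‖p‖ ^ 2 - μ)
  have h2 := abs_xi_le μ p
  have h3 : 1 ≤ wt p ^ 2 := one_le_pow₀ (one_le_wt p)
  unfold KZero
  nlinarith

theorem KZero_nonneg {T : ℝ} (hT : 0 ≤ T) (μ : ℝ) (p : R3) : 0 ≤ KZero μ T p := thermal_nonneg hT _

theorem xi_le_KZero {T : ℝ} (hT : 0 ≤ T) (μ : ℝ) (p : R3) : ‖p‖ ^ 2 - μ ≤ KZero μ T p :=
  (le_abs_self _).trans (abs_le_thermal hT _)

theorem measurable_KZero (μ T : ℝ) : Measurable (KZero μ T) :=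
  (measurable_thermal T).comp (by fun_prop)

theorem KZero_neg (μ T : ℝ) (p : R3) : KZero μ T (-p) = KZero μ T p := by simp [KZero]

/-- The Fermi surface is a sphere, hence a null set. This gives almost everywhere K > 0, also for T
= 0, and justifies the divisions by K. -/
theorem ae_xi_ne_zero (μ : ℝ) : ∀ᵐ p : R3, ‖p‖ ^ 2 - μ ≠ 0 := by
  refine measure_mono_null (fun p hp => ?_)
    (Measure.addHaar_sphere (volume : Measure R3) 0 (Real.sqrt μ))
  have : ‖p‖ ^ 2 - μ = 0 := by simpa using hp
  rw [mem_sphere_zero_iff_norm, show μ = ‖p‖ ^ 2 by linarith, Real.sqrt_sq (norm_nonneg _)]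

theorem ae_KZero_pos {T : ℝ} (hT : 0 ≤ T) (μ : ℝ) : ∀ᵐ p : R3, 0 < KZero μ T p := by
  filter_upwards [ae_xi_ne_zero μ] with p hp
  exact thermal_pos hT hp

/-- The ratio `K_T^0(p) / (1 + p²)`. -/
noncomputable def kinRatio (μ T : ℝ) (p : R3) : ℝ := KZero μ T p * ((wt p)⁻¹) ^ 2

theorem kinRatio_mul (μ T : ℝ) (p : R3) : kinRatio μ T p * wt p ^ 2 = KZero μ T p := by
  have := (wt_pos p).ne'
  unfold kinRatio; field_simp

theorem kinRatio_nonneg {T : ℝ} (hT : 0 ≤ T) (μ : ℝ) (p : R3) : 0 ≤ kinRatio μ T p :=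
  mul_nonneg (KZero_nonneg hT _ _) (sq_nonneg _)

theorem abs_kinRatio_le {T : ℝ} (hT : 0 ≤ T) (μ : ℝ) (p : R3) :
    |kinRatio μ T p| ≤ 1 + |μ| + 2 * T := by
  rw [abs_of_nonneg (kinRatio_nonneg hT μ p), kinRatio, inv_pow, ← div_eq_mul_inv,
    div_le_iff₀ (pow_pos (wt_pos p) 2)]
  exact KZero_le hT μ p

theorem measurable_kinRatio (μ T : ℝ) : Measurable (kinRatio μ T) :=
  (measurable_KZero μ T).mul (measurable_inv_wt.pow_const 2)

theorem half_le_kinRatio {T : ℝ} (hT : 0 ≤ T) {μ : ℝ} {p : R3} (hp : 2 * |μ| + 1 ≤ ‖p‖) :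
    1 / 2 ≤ kinRatio μ T p := by
  rw [kinRatio, inv_pow, ← div_eq_mul_inv, le_div_iff₀ (pow_pos (wt_pos p) 2)]
  linarith [half_wt_sq_le hp, xi_le_KZero hT μ p]

theorem kinRatio_neg (μ T : ℝ) (p : R3) : kinRatio μ T (-p) = kinRatio μ T p := by
  simp [kinRatio, KZero_neg, wt_neg]

/-- Multiplication by `K_T^0(p) / (1 + p²)`. -/
noncomputable def kinOp (μ : ℝ) {T : ℝ} (hT : 0 ≤ T) : L2 →L[ℂ] L2 :=
  mulOp (kinRatio μ T) (measurable_kinRatio μ T) _ (abs_kinRatio_le hT μ)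

theorem kinOp_ae (μ : ℝ) {T : ℝ} (hT : 0 ≤ T) (f : L2) :
    kinOp μ hT f =ᵐ[volume] fun p => (kinRatio μ T p : ℂ) * f p := mulOp_ae _ _ f

theorem isEven_mulOp {m : R3 → ℝ} (hm : Measurable m) {C : ℝ} (hC : ∀ p, |m p| ≤ C)
    (hmn : ∀ p, m (-p) = m p) {f : L2} (hf : IsEven f) : IsEven (mulOp m hm C hC f) := by
  have h := mulOp_ae hm hC f
  filter_upwards [h, ae_neg h, hf] with p h1 h2 h3
  rw [h1, h2, h3, hmn]

theorem isEven_ballProj (R : ℝ) {f : L2} (hf : IsEven f) : IsEven (ballProj R f) :=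
  isEven_mulOp _ _ (fun p => by simp [ballInd]) hf

theorem isEven_kinOp (μ : ℝ) {T : ℝ} (hT : 0 ≤ T) {f : L2} (hf : IsEven f) :
    IsEven (kinOp μ hT f) := isEven_mulOp _ _ (kinRatio_neg μ T) hf

theorem isEven_add {f g : L2} (hf : IsEven f) (hg : IsEven g) : IsEven (f + g) := by
  rw [isEven_iff] at *; rw [map_add, hf, hg]

theorem isEven_smul (c : ℂ) {f : L2} (hf : IsEven f) : IsEven (c • f) := by
  rw [isEven_iff] at *; rw [map_smul, hf]

theorem isEven_sub {f g : L2} (hf : IsEven f) (hg : IsEven g) : IsEven (f - g) := by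
  rw [isEven_iff] at *; rw [map_sub, hf, hg]

theorem isEven_zero : IsEven 0 := by rw [isEven_iff, map_zero]

theorem re_inner_mulOp {m : R3 → ℝ} (hm : Measurable m) {C : ℝ} (hC : ∀ p, |m p| ≤ C) (f : L2) :
    (inner ℂ (mulOp m hm C hC f) f).re = ∫ p, m p * ‖f p‖ ^ 2 := by
  rw [inner_eq_integral, ← Complex.ofReal_re (∫ p, m p * ‖f p‖ ^ 2), ← integral_complex_ofReal]
  congr 1
  refine integral_congr_ae ?_
  filter_upwards [mulOp_ae hm hC f] with p hp
  rw [hp, map_mul, Complex.conj_ofReal, mul_assoc, Complex.conj_mul']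
  push_cast; ring

theorem integrable_mul_norm_sq {m : R3 → ℝ} (hm : Measurable m) {C : ℝ} (hC : ∀ p, |m p| ≤ C)
    (f : L2) : Integrable (fun p => m p * ‖f p‖ ^ 2) volume :=
  (integrable_norm_sq f).bdd_mul hm.aestronglyMeasurable (Eventually.of_forall hC)

/-- The norm is controlled by the kinetic energy and the low momentum part. -/
theorem norm_sq_le_kin {T : ℝ} (hT : 0 ≤ T) {μ R : ℝ} (hR : 2 * |μ| + 1 ≤ R) (f : L2) :
    ‖f‖ ^ 2 ≤ 2 * (∫ p, kinRatio μ T p * ‖f p‖ ^ 2) + ∫ p, ballInd R p * ‖f p‖ ^ 2 := by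
  have h1 := integrable_mul_norm_sq (measurable_kinRatio μ T) (abs_kinRatio_le hT μ) f
  have h2 := integrable_mul_norm_sq (measurable_ballInd R) (abs_ballInd_le R) f
  rw [norm_sq_eq_integral, ← integral_const_mul, ← integral_add (h1.const_mul 2) h2]
  refine integral_mono (integrable_norm_sq f) ((h1.const_mul 2).add h2) fun p => ?_
  simp only [ballInd]
  have h3 := kinRatio_nonneg hT μ p
  split_ifs with h
  · have := mul_nonneg h3 (sq_nonneg ‖f p‖); linarith
  · have := half_le_kinRatio hT (hR.trans (not_le.1 h).le)
    nlinarith [sq_nonneg ‖f p‖]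

theorem norm_sq_ballProj (R : ℝ) (f : L2) : ‖ballProj R f‖ ^ 2 = ∫ p, ballInd R p * ‖f p‖ ^ 2 := by
  rw [norm_sq_eq_integral]
  refine integral_congr_ae ?_
  filter_upwards [mulOp_ae (measurable_ballInd R) (abs_ballInd_le R) f] with p h1
  rw [ballProj, h1, norm_mul, mul_pow, Complex.norm_real]
  congr 1
  unfold ballInd; split_ifs <;> simp

theorem norm_sq_bessel_le_ball {R : ℝ} (hR : 0 < R) (f : L2) :
    ‖bessel f‖ ^ 2 ≤ 2 * (∫ p, ballInd R p * ‖f p‖ ^ 2) + 2 * (R⁻¹ ^ 2 * ‖f‖ ^ 2) := by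
  have h1 : ‖bessel f‖ ≤ ‖ballProj R f‖ + R⁻¹ * ‖f‖ := by
    have : bessel f = bessel (ballProj R f) + bessel (f - ballProj R f) := by
      rw [← map_add]; congr 1; abel
    rw [this]
    exact (norm_add_le _ _).trans (add_le_add (norm_bessel_le _) (norm_bessel_sub_ballProj_le hR f))
  rw [← norm_sq_ballProj]
  have h2 := pow_le_pow_left₀ (norm_nonneg _) h1 2
  nlinarith [sq_nonneg (‖ballProj R f‖ - R⁻¹ * ‖f‖)]

/-- Coercivity: a bound on the kinetic energy relative to the potential energy, together with a
bound on the low momentum part, bounds the norm. -/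
theorem exists_norm_le_of_kin {V : R3 → ℝ} (hV : MemLp V (3 / 2) volume) {T : ℝ} (hT : 0 ≤ T)
    (μ c : ℝ) (B : ℝ → ℝ) : ∃ M : ℝ, ∀ f : L2,
      (∫ p, kinRatio μ T p * ‖f p‖ ^ 2) + potQuad V f ≤ c →
      (∀ R, ∫ p, ballInd R p * ‖f p‖ ^ 2 ≤ B R) → ‖f‖ ≤ M := by
  obtain ⟨C, hC0, hC⟩ := exists_abs_potQuad_le hV (ε := 1 / 8) (by norm_num)
  -- R is large enough for the kinetic bound beyond 2|μ| + 1 and for C/R² ≤ 1/16. The potential then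
  -- costs at most half of ‖f‖², which is absorbed.
  set R : ℝ := 2 * |μ| + 4 * C + 4 with hR
  have hμ := abs_nonneg μ
  have hRpos : 0 < R := by positivity
  refine ⟨1 + 4 * |c| + 8 * C * |B R| + 4 * |B R|, fun f h1 h2 => ?_⟩
  have h3 := norm_sq_le_kin hT (μ := μ) (R := R) (by linarith) f
  have h4 := norm_sq_bessel_le_ball hRpos f
  have h5 := (abs_le.1 (hC f)).1
  have h6 := h2 R
  have h7 := le_abs_self (B R)
  have h8 : C * R⁻¹ ^ 2 ≤ 1 / 16 := by
    rw [inv_pow, ← div_eq_mul_inv, div_le_iff₀ (by positivity)]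
    nlinarith
  have h9 : C * (2 * (R⁻¹ ^ 2 * ‖f‖ ^ 2)) ≤ 1 / 8 * ‖f‖ ^ 2 := by
    have := mul_le_mul_of_nonneg_right h8 (sq_nonneg ‖f‖); linarith
  have h10 : C * (∫ p, ballInd R p * ‖f p‖ ^ 2) ≤ C * |B R| :=
    mul_le_mul_of_nonneg_left (h6.trans h7) hC0
  have h11 : C * ‖bessel f‖ ^ 2 ≤ C * (2 * (∫ p, ballInd R p * ‖f p‖ ^ 2)) +
      C * (2 * (R⁻¹ ^ 2 * ‖f‖ ^ 2)) := by
    have := mul_le_mul_of_nonneg_left h4 hC0; linarith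
  have h12 := le_abs_self c
  have h13 : 0 ≤ C * |B R| := by positivity
  have h14 := norm_nonneg f
  have h15 := abs_nonneg c
  have h16 := abs_nonneg (B R)
  have h17 : ‖f‖ ^ 2 ≤ 4 * |c| + 8 * C * |B R| + 4 * |B R| := by linarith
  nlinarith [sq_nonneg (‖f‖ - 1)]

end Kinetic

/-! ### The energy gained by a pairing field -/

section PairEnergy

open Filter Topology

/-- The quasi-particle energy `√((p² - μ)² + |d|²)`. -/
noncomputable def quasiE (μ : ℝ) (p : R3) (d : ℂ) : ℝ := Real.sqrt ((‖p‖ ^ 2 - μ) ^ 2 + ‖d‖ ^ 2)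

theorem quasiE_nonneg (μ : ℝ) (p : R3) (d : ℂ) : 0 ≤ quasiE μ p d := Real.sqrt_nonneg _

theorem quasiE_sq (μ : ℝ) (p : R3) (d : ℂ) :
    quasiE μ p d ^ 2 = (‖p‖ ^ 2 - μ) ^ 2 + ‖d‖ ^ 2 := Real.sq_sqrt (by positivity)

theorem norm_le_quasiE (μ : ℝ) (p : R3) (d : ℂ) : ‖d‖ ≤ quasiE μ p d :=
  Real.le_sqrt_of_sq_le (by nlinarith [sq_nonneg (‖p‖ ^ 2 - μ)])

theorem abs_xi_le_quasiE (μ : ℝ) (p : R3) (d : ℂ) : |‖p‖ ^ 2 - μ| ≤ quasiE μ p d :=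
  Real.abs_le_sqrt (by nlinarith [sq_nonneg ‖d‖])

theorem quasiE_le (μ : ℝ) (p : R3) (d : ℂ) : quasiE μ p d ≤ |‖p‖ ^ 2 - μ| + ‖d‖ := by
  refine Real.sqrt_le_iff.2 ⟨by positivity, ?_⟩
  have := mul_nonneg (abs_nonneg (‖p‖ ^ 2 - μ)) (norm_nonneg d)
  nlinarith [sq_abs (‖p‖ ^ 2 - μ)]

theorem quasiE_neg (μ : ℝ) (p : R3) (d : ℂ) : quasiE μ (-p) d = quasiE μ p d := by simp [quasiE]

theorem measurable_quasiE (μ : ℝ) {g : R3 → ℂ} (hg : Measurable g) :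
    Measurable fun p => quasiE μ p (g p) := by
  unfold quasiE; fun_prop

/-- The kinetic function of the gap equation, `K_T^Δ(p)` with `d = Δ(p)`. -/
noncomputable def quasiK (μ T : ℝ) (p : R3) (d : ℂ) : ℝ := thermal T (quasiE μ p d)

theorem KDelta_eq (μ T : ℝ) (Δ : R3 → ℂ) (p : R3) : KDelta μ T Δ p = quasiK μ T p (Δ p) := rfl

theorem KZero_le_quasiK {T : ℝ} (hT : 0 ≤ T) (μ : ℝ) (p : R3) (d : ℂ) :
    KZero μ T p ≤ quasiK μ T p d := by
  rw [KZero, ← thermal_abs, quasiK]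
  exact (strictMonoOn_thermal hT).monotoneOn (Set.mem_Ici.2 (abs_nonneg _)) (quasiE_nonneg _ _ _)
    (abs_xi_le_quasiE _ _ _)

theorem KZero_lt_quasiK {T : ℝ} (hT : 0 ≤ T) (μ : ℝ) (p : R3) {d : ℂ} (hd : d ≠ 0) :
    KZero μ T p < quasiK μ T p d := by
  rw [KZero, ← thermal_abs, quasiK]
  refine (strictMonoOn_thermal hT) (Set.mem_Ici.2 (abs_nonneg _)) (quasiE_nonneg _ _ _) ?_
  refine abs_lt_of_sq_lt_sq ?_ (quasiE_nonneg _ _ _)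
  rw [quasiE_sq]
  have := norm_pos_iff.2 hd
  nlinarith

theorem norm_le_quasiK {T : ℝ} (hT : 0 ≤ T) (μ : ℝ) (p : R3) (d : ℂ) : ‖d‖ ≤ quasiK μ T p d :=
  (norm_le_quasiE μ p d).trans ((le_abs_self _).trans (abs_le_thermal hT _))

theorem quasiE_le_quasiK {T : ℝ} (hT : 0 ≤ T) (μ : ℝ) (p : R3) (d : ℂ) :
    quasiE μ p d ≤ quasiK μ T p d := (le_abs_self _).trans (abs_le_thermal hT _)

theorem quasiK_neg (μ T : ℝ) (p : R3) (d : ℂ) : quasiK μ T (-p) d = quasiK μ T p d := by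
  rw [quasiK, quasiE_neg, quasiK]

theorem measurable_quasiK (μ T : ℝ) {g : R3 → ℂ} (hg : Measurable g) :
    Measurable fun p => quasiK μ T p (g p) := (measurable_thermal T).comp (measurable_quasiE μ hg)

/-- The gain in pressure due to the pairing field `d` at momentum `p`. -/
noncomputable def pairEnergy (μ T : ℝ) (p : R3) (d : ℂ) : ℝ :=
  pressure T (quasiE μ p d) - pressure T (‖p‖ ^ 2 - μ)

variable {T : ℝ} (hT : 0 ≤ T) (μ : ℝ) (p : R3)

include hT in
theorem pairEnergy_nonneg (d : ℂ) : 0 ≤ pairEnergy μ T p d := by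
  rw [pairEnergy, ← pressure_abs T (‖p‖ ^ 2 - μ)]
  linarith [pressure_mono hT (abs_nonneg _) (abs_xi_le_quasiE μ p d)]

include hT in
theorem pairEnergy_le_half (d : ℂ) : pairEnergy μ T p d ≤ ‖d‖ / 2 := by
  rw [pairEnergy, ← pressure_abs T (‖p‖ ^ 2 - μ)]
  linarith [pressure_sub_le_half hT (abs_nonneg _) (abs_xi_le_quasiE μ p d), quasiE_le μ p d]

include hT in
theorem pairEnergy_le_div (hK : 0 < KZero μ T p) (d : ℂ) :
    pairEnergy μ T p d ≤ ‖d‖ ^ 2 / (4 * KZero μ T p) := by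
  rw [KZero, ← thermal_abs] at hK
  have := pressure_sub_le hT (abs_nonneg (‖p‖ ^ 2 - μ)) (quasiE_nonneg μ p d) hK
  rwa [quasiE_sq, sq_abs, add_sub_cancel_left, pressure_abs, thermal_abs] at this

include hT in
-- Concavity in |d|²: for fixed p, E² and |d|² differ by a constant.
theorem pairEnergy_sub_le {d : ℂ} (hK : 0 < quasiK μ T p d) (d' : ℂ) :
    pairEnergy μ T p d' - pairEnergy μ T p d ≤ (‖d'‖ ^ 2 - ‖d‖ ^ 2) / (4 * quasiK μ T p d) := by
  have := pressure_sub_le hT (quasiE_nonneg μ p d) (quasiE_nonneg μ p d') hK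
  rw [quasiE_sq, quasiE_sq, add_sub_add_left_eq_sub] at this
  unfold pairEnergy quasiK; unfold quasiK at hK
  linarith

theorem norm_mul_le_quasiE_mul (d d' : ℂ) :
    (‖p‖ ^ 2 - μ) ^ 2 + ‖d‖ * ‖d'‖ ≤ quasiE μ p d * quasiE μ p d' := by
  rw [quasiE, quasiE, ← Real.sqrt_mul (by positivity)]
  refine Real.le_sqrt_of_sq_le ?_
  nlinarith [mul_nonneg (sq_nonneg (‖p‖ ^ 2 - μ)) (sq_nonneg (‖d‖ - ‖d'‖))]

include hT in
-- Convexity in d, with gradient d/(2K): the tangent bound in E is combined with Cauchy-Schwarz for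
-- the vectors (ξ, |d|) and (ξ, |d'|).
theorem tangent_le_pairEnergy {d : ℂ} (hK : 0 < quasiK μ T p d) (d' : ℂ) :
    (conj (d' - d) * d).re / (2 * quasiK μ T p d) ≤ pairEnergy μ T p d' - pairEnergy μ T p d := by
  have := pressure_tangent_le hT (quasiE_nonneg μ p d) (quasiE_nonneg μ p d') hK
  have h1 : (conj (d' - d) * d).re ≤ quasiE μ p d * (quasiE μ p d' - quasiE μ p d) := by
    have h2 := norm_mul_le_quasiE_mul μ p d d'
    have h3 : (conj d' * d).re ≤ ‖d‖ * ‖d'‖ := by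
      refine (Complex.re_le_norm _).trans (le_of_eq ?_)
      rw [norm_mul, RCLike.norm_conj, mul_comm]
    have h4 : (conj d * d).re = ‖d‖ ^ 2 := by
      rw [Complex.conj_mul', ← Complex.ofReal_pow, Complex.ofReal_re]
    rw [map_sub, sub_mul, Complex.sub_re, h4, mul_sub, ← sq, quasiE_sq]
    linarith
  have h5 : (conj (d' - d) * d).re / (2 * quasiK μ T p d) ≤
      quasiE μ p d * (quasiE μ p d' - quasiE μ p d) / (2 * quasiK μ T p d) :=
    div_le_div_of_nonneg_right h1 (by positivity)
  unfold pairEnergy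
  unfold quasiK at *
  linarith

theorem pairEnergy_zero : pairEnergy μ T p 0 = 0 := by
  rw [pairEnergy, quasiE, norm_zero]
  simp [Real.sqrt_sq_eq_abs, pressure_abs]

theorem measurable_pairEnergy (μ T : ℝ) {g : R3 → ℂ} (hg : Measurable g) :
    Measurable fun p => pairEnergy μ T p (g p) :=
  ((measurable_pressure T).comp (measurable_quasiE μ hg)).sub
    ((measurable_pressure T).comp (by fun_prop))

theorem measurable_wt_mul (f : L2) : Measurable fun p => (wt p : ℂ) * f p :=
  (Complex.measurable_ofReal.comp continuous_wt.measurable).mul (Lp.stronglyMeasurable f).measurable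

include hT in
-- For |p| ≤ 2|μ| + 1 the linear bound is used, since 1/K may be singular; beyond that radius K ≥
-- (1+p²)/2 and the quadratic bound suffices. Hence W is finite on all of L².
theorem pairEnergy_le (z : ℂ) : pairEnergy μ T p ((wt p : ℂ) * z) ≤
    (1 + (2 * |μ| + 1) ^ 2) * ballInd (2 * |μ| + 1) p + ‖z‖ ^ 2 := by
  have hn : ‖(wt p : ℂ) * z‖ = wt p * ‖z‖ := by
    rw [norm_mul, Complex.norm_real, Real.norm_of_nonneg (wt_pos p).le]
  by_cases h : ‖p‖ ≤ 2 * |μ| + 1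
  · have h1 := pairEnergy_le_half hT μ p ((wt p : ℂ) * z)
    have h2 : wt p ^ 2 ≤ 1 + (2 * |μ| + 1) ^ 2 := by
      rw [wt_sq]; gcongr
    rw [hn] at h1
    simp only [ballInd, h, if_true]
    nlinarith [sq_nonneg (wt p - ‖z‖)]
  · have h' := (not_le.1 h).le
    have h1 := half_wt_sq_le h'
    have hw := pow_pos (wt_pos p) 2
    have h2 := xi_le_KZero hT μ p
    have hK : 0 < KZero μ T p := by linarith
    have h3 := pairEnergy_le_div hT μ p hK ((wt p : ℂ) * z)
    simp only [ballInd, h, if_false]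
    rw [hn] at h3
    refine h3.trans ?_
    rw [mul_zero, zero_add, div_le_iff₀ (by positivity), mul_pow]
    nlinarith [sq_nonneg ‖z‖]

include hT in
theorem integrable_pairEnergy (f : L2) :
    Integrable (fun p => pairEnergy μ T p ((wt p : ℂ) * f p)) volume := by
  refine (((integrable_ballInd (2 * |μ| + 1)).const_mul (1 + (2 * |μ| + 1) ^ 2)).add
    (integrable_norm_sq f)).mono' (measurable_pairEnergy μ T (measurable_wt_mul f)).aestronglyMeasurable
    (Eventually.of_forall fun p => ?_)
  rw [Real.norm_of_nonneg (pairEnergy_nonneg hT μ p _)]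
  exact pairEnergy_le hT μ p _

/-- The total gain in pressure due to the pairing field `(1 + p²)^{1/2} f(p)`. -/
noncomputable def condensation (μ T : ℝ) (f : L2) : ℝ :=
  ∫ p, pairEnergy μ T p ((wt p : ℂ) * f p)

theorem condensation_zero : condensation μ T 0 = 0 := by
  rw [condensation, ← integral_zero R3 ℝ]
  refine integral_congr_ae ?_
  filter_upwards [Lp.coeFn_zero ℂ 2 (volume : Measure R3)] with p hp
  rw [hp]; simp [pairEnergy_zero]

include hT in
-- The field 2K_T^0 f/(1+p²) is the one that maximizes Re⟨g,f⟩ minus the quadratic upper bound for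
-- W(g).
theorem condensation_kinOp_le (f : L2) :
    condensation μ T ((2 : ℂ) • kinOp μ hT f) ≤ ∫ p, kinRatio μ T p * ‖f p‖ ^ 2 := by
  refine integral_mono_ae (integrable_pairEnergy hT μ _)
    (integrable_mul_norm_sq (measurable_kinRatio μ T) (abs_kinRatio_le hT μ) f) ?_
  filter_upwards [ae_KZero_pos hT μ, kinOp_ae μ hT f, Lp.coeFn_smul (2 : ℂ) (kinOp μ hT f)]
    with p hK h1 h2
  refine (pairEnergy_le_div hT μ p hK _).trans (le_of_eq ?_)
  have hw := (wt_pos p).ne'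
  rw [h2, Pi.smul_apply, h1, smul_eq_mul, norm_mul, norm_mul, norm_mul, Complex.norm_real,
    Complex.norm_real, Real.norm_of_nonneg (wt_pos p).le,
    Real.norm_of_nonneg (kinRatio_nonneg hT μ p), RCLike.norm_ofNat, kinRatio]
  field_simp
  ring

include hT in
-- Uses the linear growth of the pair energy, followed by ab ≤ (a² + b²)/2; the result is linear in
-- s.
theorem condensation_ballProj_le {s : ℝ} (hs : 0 ≤ s) (R : ℝ) (f : L2) :
    condensation μ T ((s : ℂ) • ballProj R f) ≤
      s / 4 * (∫ p, ballInd R p * wt p ^ 2) + s / 4 * ∫ p, ballInd R p * ‖f p‖ ^ 2 := by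
  have hi1 : Integrable (fun p => ballInd R p * wt p ^ 2) volume := by
    refine ((integrable_ballInd R).const_mul (1 + R ^ 2)).mono'
      ((measurable_ballInd R).mul (continuous_wt.measurable.pow_const 2)).aestronglyMeasurable
      (Eventually.of_forall fun p => ?_)
    rw [wt_sq]
    unfold ballInd
    split_ifs with h
    · rw [one_mul, mul_one, Real.norm_of_nonneg (by positivity)]; gcongr
    · simp
  have hi2 := integrable_mul_norm_sq (measurable_ballInd R) (abs_ballInd_le R) f
  rw [← integral_const_mul, ← integral_const_mul,
    ← integral_add (hi1.const_mul _) (hi2.const_mul _)]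
  refine integral_mono_ae (integrable_pairEnergy hT μ _) ((hi1.const_mul _).add (hi2.const_mul _)) ?_
  filter_upwards [mulOp_ae (measurable_ballInd R) (abs_ballInd_le R) f,
    Lp.coeFn_smul (s : ℂ) (ballProj R f)] with p h1 h2
  refine (pairEnergy_le_half hT μ p _).trans ?_
  rw [h2, Pi.smul_apply, ballProj, h1, smul_eq_mul, norm_mul, norm_mul, norm_mul, Complex.norm_real,
    Complex.norm_real, Complex.norm_real, Real.norm_of_nonneg (wt_pos p).le,
    Real.norm_of_nonneg hs]
  simp only [ballInd]
  split_ifs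
  · rw [norm_one]; nlinarith [mul_nonneg hs (sq_nonneg (wt p - ‖f p‖))]
  · simp

/-- The epigraph of the Legendre transform of `condensation` on even functions. -/
def dualEpi (μ T : ℝ) : Set (L2 × ℝ) :=
  {x | IsEven x.1 ∧ ∀ g : L2, IsEven g → (inner ℂ g x.1).re - condensation μ T g ≤ x.2}

theorem dualEpi_nonneg {x : L2 × ℝ} (hx : x ∈ dualEpi μ T) : 0 ≤ x.2 := by
  simpa [condensation_zero] using hx.2 0 isEven_zero

/-- An epigraph of a supremum of continuous affine functions is an intersection of weakly closed
half-spaces. -/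
theorem dualEpi_closed {F : ℕ → L2} {m : ℕ → ℝ} {f : L2} {m₀ : ℝ}
    (h : ∀ n, (F n, m n) ∈ dualEpi μ T) (hF : WeakTendsto F f) (hm : Tendsto m atTop (𝓝 m₀)) :
    (f, m₀) ∈ dualEpi μ T := by
  refine ⟨hF.isEven fun n => (h n).1, fun g hg => ?_⟩
  exact le_of_tendsto_of_tendsto' (((Complex.continuous_re.tendsto _).comp (hF g)).sub_const _) hm
    fun n => (h n).2 g hg

theorem dualEpi_convex {x y : L2 × ℝ} (hx : x ∈ dualEpi μ T) (hy : y ∈ dualEpi μ T) {t : ℝ}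
    (h0 : 0 ≤ t) (h1 : t ≤ 1) :
    (x.1 + (t : ℂ) • (y.1 - x.1), x.2 + t * (y.2 - x.2)) ∈ dualEpi μ T := by
  refine ⟨isEven_add hx.1 (isEven_smul _ (isEven_sub hy.1 hx.1)), fun g hg => ?_⟩
  have h2 := hx.2 g hg
  have h3 := hy.2 g hg
  simp only [inner_add_right, inner_smul_right, inner_sub_right, Complex.add_re,
    Complex.re_ofReal_mul, Complex.sub_re]
  nlinarith

include hT in
-- Testing with the field 2K_T^0 f/(1+p²) gives 2 kin - kin ≤ x.2, where kin is the kinetic energy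
-- on the left: W* dominates it.
theorem kin_le_of_mem_dualEpi {x : L2 × ℝ} (hx : x ∈ dualEpi μ T) :
    ∫ p, kinRatio μ T p * ‖x.1 p‖ ^ 2 ≤ x.2 := by
  have h1 := hx.2 _ (isEven_smul 2 (isEven_kinOp μ hT hx.1))
  have h2 := condensation_kinOp_le hT μ x.1
  rw [inner_smul_left, kinOp] at h1
  have h3 := re_inner_mulOp (measurable_kinRatio μ T) (abs_kinRatio_le hT μ) x.1
  simp only [map_ofNat, Complex.mul_re, Complex.re_ofNat, Complex.im_ofNat, zero_mul, sub_zero] at h1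
  rw [h3] at h1
  rw [kinOp] at h2
  linarith

include hT in
-- Testing with s f on the ball gives a bound linear in s with a fixed right side; letting s grow
-- forces the coefficient to be nonpositive. It is an integrated form of the constraint |α̂| ≤ 1/2.
theorem ball_le_of_mem_dualEpi {x : L2 × ℝ} (hx : x ∈ dualEpi μ T) (R : ℝ) :
    ∫ p, ballInd R p * ‖x.1 p‖ ^ 2 ≤ ∫ p, ballInd R p * wt p ^ 2 := by
  set A := ∫ p, ballInd R p * ‖x.1 p‖ ^ 2
  set B := ∫ p, ballInd R p * wt p ^ 2
  have hB : 0 ≤ B := integral_nonneg fun p => by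
    unfold ballInd; split_ifs <;> simp; positivity
  have key (s : ℝ) (hs : 0 ≤ s) : s * (3 / 4 * A - B / 4) ≤ x.2 := by
    have h1 := hx.2 _ (isEven_smul (s : ℂ) (isEven_ballProj R hx.1))
    have h2 := condensation_ballProj_le hT μ hs R x.1
    rw [inner_smul_left, Complex.conj_ofReal, Complex.re_ofReal_mul, ballProj, re_inner_mulOp,
      ← ballProj] at h1
    linarith
  have h3 : 3 / 4 * A - B / 4 ≤ 0 := by
    by_contra! h
    have h4 := key ((x.2 + 1) / (3 / 4 * A - B / 4))
      (div_nonneg (by linarith [dualEpi_nonneg μ hx]) h.le)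
    rw [div_mul_cancel₀ _ h.ne'] at h4
    linarith
  linarith

end PairEnergy

/-! ### The normal state -/

section Normal

open Filter Topology

theorem integrable_exp_neg_mul_sq {b : ℝ} (hb : 0 < b) :
    Integrable (fun p : R3 => Real.exp (-b * ‖p‖ ^ 2)) volume := by
  have h := (GaussianFourier.integrable_cexp_neg_mul_sq_norm_add (V := R3) (b := b)
    (by simpa using hb) 0 0).norm
  refine h.congr (Eventually.of_forall fun p => ?_)
  simp only [zero_mul, add_zero, Complex.norm_exp]
  congr 1
  rw [← Complex.ofReal_neg, ← Complex.ofReal_pow, ← Complex.ofReal_mul, Complex.ofReal_re]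

theorem integrable_wt_sq_mul_exp {b : ℝ} (hb : 0 < b) :
    Integrable (fun p : R3 => (1 + ‖p‖ ^ 2) * Real.exp (-b * ‖p‖ ^ 2)) volume := by
  refine ((integrable_exp_neg_mul_sq (half_pos hb)).const_mul (1 + 2 / b)).mono' (by fun_prop)
    (Eventually.of_forall fun p => ?_)
  rw [Real.norm_of_nonneg (by positivity)]
  have h1 : Real.exp (-b * ‖p‖ ^ 2) =
      Real.exp (-(b / 2 * ‖p‖ ^ 2)) * Real.exp (-(b / 2) * ‖p‖ ^ 2) := by
    rw [← Real.exp_add]; ring_nf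
  have h2 : b / 2 * ‖p‖ ^ 2 * Real.exp (-(b / 2 * ‖p‖ ^ 2)) ≤ 1 := by
    rw [Real.exp_neg, ← div_eq_mul_inv, div_le_one (Real.exp_pos _)]
    linarith [Real.add_one_le_exp (b / 2 * ‖p‖ ^ 2)]
  have h3 : Real.exp (-(b / 2 * ‖p‖ ^ 2)) ≤ 1 := Real.exp_le_one_iff.2 (by
    have : 0 ≤ b / 2 * ‖p‖ ^ 2 := by positivity
    linarith)
  have h4 : ‖p‖ ^ 2 * Real.exp (-(b / 2 * ‖p‖ ^ 2)) ≤ 2 / b := by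
    rw [le_div_iff₀ hb]; nlinarith
  rw [h1, ← mul_assoc]
  refine mul_le_mul_of_nonneg_right ?_ (Real.exp_pos _).le
  linarith

theorem normalGamma_nonneg (μ T : ℝ) (p : R3) : 0 ≤ normalGamma μ T p := by
  unfold normalGamma
  split_ifs <;> positivity

theorem normalGamma_neg (μ T : ℝ) (p : R3) : normalGamma μ T (-p) = normalGamma μ T p := by
  simp [normalGamma]

theorem normalGamma_le_exp {T : ℝ} (hT : 0 < T) (μ : ℝ) (p : R3) :
    normalGamma μ T p ≤ Real.exp (μ / T) * Real.exp (-T⁻¹ * ‖p‖ ^ 2) := by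
  rw [normalGamma, if_neg hT.ne', ← Real.exp_add]
  have : μ / T + -T⁻¹ * ‖p‖ ^ 2 = -((‖p‖ ^ 2 - μ) / T) := by ring
  rw [this, Real.exp_neg]
  exact inv_anti₀ (Real.exp_pos _) (by linarith)

theorem norm_le_of_xi_neg {μ : ℝ} {p : R3} (h : ‖p‖ ^ 2 < μ) : ‖p‖ ≤ 1 + |μ| := by
  have := le_abs_self μ
  nlinarith [norm_nonneg p, abs_nonneg μ]

theorem measurable_normalGamma (μ T : ℝ) : Measurable (normalGamma μ T) := by
  unfold normalGamma
  by_cases hT : T = 0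
  · simp only [hT, if_true]
    exact Measurable.ite (measurableSet_lt (by fun_prop) measurable_const) measurable_const
      measurable_const
  · simp only [hT, if_false]; fun_prop

theorem integrable_normalGamma {T : ℝ} (hT : 0 ≤ T) (μ : ℝ) :
    Integrable (fun p => (1 + ‖p‖ ^ 2) * normalGamma μ T p) volume := by
  have hm : AEStronglyMeasurable (fun p : R3 => (1 + ‖p‖ ^ 2) * normalGamma μ T p) volume :=
    ((by fun_prop : Measurable fun p : R3 => 1 + ‖p‖ ^ 2).mul
      (measurable_normalGamma μ T)).aestronglyMeasurable
  rcases hT.eq_or_lt with rfl | hT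
  · refine ((integrable_ballInd (1 + |μ|)).const_mul (1 + (1 + |μ|) ^ 2)).mono' hm
      (Eventually.of_forall fun p => ?_)
    rw [Real.norm_of_nonneg (mul_nonneg (by positivity) (normalGamma_nonneg _ _ _)), normalGamma,
      if_pos rfl]
    unfold ballInd
    by_cases h : ‖p‖ ^ 2 < μ
    · have h1 := norm_le_of_xi_neg h
      rw [if_pos h, if_pos h1]; gcongr
    · rw [if_neg h]; split_ifs <;> simp; positivity
  · refine ((integrable_wt_sq_mul_exp (inv_pos.2 hT)).const_mul (Real.exp (μ / T))).mono' hm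
      (Eventually.of_forall fun p => ?_)
    rw [Real.norm_of_nonneg (mul_nonneg (by positivity) (normalGamma_nonneg _ _ _))]
    have h1 := normalGamma_le_exp hT μ p
    have h2 := mul_le_mul_of_nonneg_left h1 (by positivity : 0 ≤ 1 + ‖p‖ ^ 2)
    linarith

/-- The free energy density of the normal state, `-T log (1 + e^{-(p² - μ)/T})`. -/
noncomputable def normalDensity (μ T : ℝ) (p : R3) : ℝ :=
  (‖p‖ ^ 2 - μ) / 2 - pressure T (‖p‖ ^ 2 - μ)

theorem pressure_sub_half {T : ℝ} (hT : 0 < T) (e : ℝ) :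
    pressure T e - e / 2 = T * Real.log (1 + Real.exp (-(e / T))) := by
  have h1 : Real.cosh (e / (2 * T)) = Real.exp (e / (2 * T)) * (1 + Real.exp (-(e / T))) / 2 := by
    rw [Real.cosh_eq, mul_add, ← Real.exp_add]
    congr 3
    · ring
    · field_simp; ring
  rw [pressure_of_pos hT, h1, Real.log_div (by positivity) two_ne_zero,
    Real.log_mul (Real.exp_pos _).ne' (by positivity), Real.log_exp]
  field_simp
  ring

/-- At T = 0 the density lives in the Fermi ball; for T > 0 it decays like a Gaussian by log(1 + x)
≤ x. -/
theorem integrable_normalDensity {T : ℝ} (hT : 0 ≤ T) (μ : ℝ) :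
    Integrable (normalDensity μ T) volume := by
  have hm : AEStronglyMeasurable (normalDensity μ T) volume := by
    unfold normalDensity
    exact ((by fun_prop : Measurable fun p : R3 => (‖p‖ ^ 2 - μ) / 2).sub
      ((measurable_pressure T).comp (by fun_prop))).aestronglyMeasurable
  rcases hT.eq_or_lt with rfl | hT
  · refine ((integrable_ballInd (1 + |μ|)).const_mul |μ|).mono' hm
      (Eventually.of_forall fun p => ?_)
    rw [normalDensity, pressure_zero_left]
    unfold ballInd
    by_cases h : ‖p‖ ^ 2 < μ
    · have h1 := norm_le_of_xi_neg h
      rw [if_pos h1, abs_of_neg (sub_neg.2 h), Real.norm_eq_abs, abs_le]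
      have := le_abs_self μ
      constructor <;> nlinarith [sq_nonneg ‖p‖]
    · rw [abs_of_nonneg (by linarith), sub_self, norm_zero]
      split_ifs <;> simp
  · refine (((integrable_exp_neg_mul_sq (inv_pos.2 hT)).const_mul (Real.exp (μ / T))).const_mul
      T).mono' hm (Eventually.of_forall fun p => ?_)
    have h1 := pressure_sub_half hT (‖p‖ ^ 2 - μ)
    have h2 : normalDensity μ T p = -(T * Real.log (1 + Real.exp (-((‖p‖ ^ 2 - μ) / T)))) := by
      rw [← h1, normalDensity]; ring
    have h3 : 0 ≤ Real.log (1 + Real.exp (-((‖p‖ ^ 2 - μ) / T))) :=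
      Real.log_nonneg (by linarith [Real.exp_pos (-((‖p‖ ^ 2 - μ) / T))])
    rw [h2, norm_neg, Real.norm_of_nonneg (mul_nonneg hT.le h3)]
    refine mul_le_mul_of_nonneg_left ?_ hT.le
    have h4 := Real.log_le_sub_one_of_pos
      (by positivity : 0 < 1 + Real.exp (-((‖p‖ ^ 2 - μ) / T)))
    rw [← Real.exp_add, show μ / T + -T⁻¹ * ‖p‖ ^ 2 = -((‖p‖ ^ 2 - μ) / T) by ring]
    linarith

theorem hatL2_zero : hatL2 0 =ᵐ[volume] fun _ => 0 := by
  have h := hatEquiv_ae 0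
  rw [map_zero] at h
  exact h.symm.trans (Lp.coeFn_zero ℂ 2 (volume : Measure R3))

theorem isHermitian_fin_two (a d : ℝ) (z : ℂ) :
    (!![(a : ℂ), z; conj z, (d : ℂ)] : Matrix (Fin 2) (Fin 2) ℂ).IsHermitian := by
  ext i j
  fin_cases i <;> fin_cases j <;> simp

/-- The entropy density of a thermal state of a quadratic Hamiltonian. -/
theorem mul_trace_negMulLog_thermal {T : ℝ} (hT : 0 ≤ T) (μ : ℝ) (p : R3) (d : ℂ)
    (hK : 0 < quasiK μ T p d) {a : ℝ} {z : ℂ}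
    (ha : a = (1 - (‖p‖ ^ 2 - μ) / quasiK μ T p d) / 2)
    (hz : z = d / (2 * quasiK μ T p d : ℝ)) :
    T * (cfc Real.negMulLog (!![(a : ℂ), z; conj z, ((1 - a : ℝ) : ℂ)] :
      Matrix (Fin 2) (Fin 2) ℂ)).trace.re =
      pressure T (quasiE μ p d) - quasiE μ p d ^ 2 / (2 * quasiK μ T p d) := by
  set K := quasiK μ T p d with hKdef
  rw [trace_cfc_of_trace_eq_one (isHermitian_fin_two a (1 - a) z) (l := (1 - quasiE μ p d / K) / 2)]
  · exact entropy_thermal hT (quasiE_nonneg μ p d) hK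
  · rw [Matrix.trace_fin_two_of]; push_cast; ring
  -- The determinant a(1-a) - |z|² equals (1 - (ξ² + |d|²)/K²)/4 = (1 - E²/K²)/4.
  · rw [Matrix.det_fin_two_of, Complex.mul_conj', ← Complex.ofReal_mul, ← Complex.ofReal_pow,
      ← Complex.ofReal_sub]
    congr 1
    have h1 : ‖z‖ ^ 2 = ‖d‖ ^ 2 / (2 * K) ^ 2 := by
      rw [hz, norm_div, Complex.norm_real, Real.norm_of_nonneg (by positivity), div_pow]
    rw [h1, ha]
    have h2 := quasiE_sq μ p d
    have h3 : ‖d‖ ^ 2 = quasiE μ p d ^ 2 - (‖p‖ ^ 2 - μ) ^ 2 := by linarith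
    rw [h3]
    field_simp
    ring

theorem quasiK_zero (μ T : ℝ) (p : R3) : quasiK μ T p 0 = KZero μ T p := by
  rw [quasiK, quasiE, norm_zero, KZero]
  simp [Real.sqrt_sq_eq_abs, thermal_abs]

theorem integrable_xi_mul {γ : R3 → ℝ} (hγ : Integrable (fun p => (1 + ‖p‖ ^ 2) * γ p) volume)
    {g : R3 → ℝ} (hg : Measurable g) {C : ℝ} (hC : ∀ p, |g p| ≤ C * wt p ^ 2) :
    Integrable (fun p => g p * γ p) volume := by
  have h1 : Measurable fun p => g p / wt p ^ 2 := hg.div (continuous_wt.measurable.pow_const 2)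
  refine (hγ.bdd_mul (c := C) h1.aestronglyMeasurable (Eventually.of_forall fun p => ?_)).congr
    (Eventually.of_forall fun p => ?_)
  · rw [Real.norm_eq_abs, abs_div, abs_of_pos (pow_pos (wt_pos p) 2),
      div_le_iff₀ (pow_pos (wt_pos p) 2)]
    exact hC p
  · have := (wt_pos p).ne'
    simp only [← wt_sq]; field_simp

/-- The thermal entropy formula at zero pairing field: the energy ξγ₀ cancels and only ξ/2 - P(ξ) is
left. -/
theorem freeEnergy_normal (V : R3 → ℝ) {T : ℝ} (hT : 0 ≤ T) (μ : ℝ) :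
    freeEnergy V μ T (normalGamma μ T, 0) = ∫ p, normalDensity μ T p := by
  have hξ : Integrable (fun p => (‖p‖ ^ 2 - μ) * normalGamma μ T p) volume :=
    integrable_xi_mul (integrable_normalGamma hT μ) (by fun_prop) (abs_xi_le μ)
  have hV : ∫ x, ‖(0 : L2) x‖ ^ 2 * V x = 0 := by
    rw [← integral_zero R3 ℝ]
    refine integral_congr_ae ?_
    filter_upwards [Lp.coeFn_zero ℂ 2 (volume : Measure R3)] with x hx
    rw [hx]; simp
  have hS : T * entropy (normalGamma μ T) 0 =
      ∫ p, ((‖p‖ ^ 2 - μ) * normalGamma μ T p - normalDensity μ T p) := by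
    rw [entropy, ← integral_const_mul]
    refine integral_congr_ae ?_
    filter_upwards [hatL2_zero, ae_KZero_pos hT μ] with p h0 hK
    have h1 := normalGamma_eq hT μ p hK
    have h2 : stateMatrix (normalGamma μ T) 0 p =
        !![(normalGamma μ T p : ℂ), 0; conj 0, ((1 - normalGamma μ T p : ℝ) : ℂ)] := by
      rw [stateMatrix, h0, normalGamma_neg]; push_cast; rfl
    have hq := quasiK_zero μ T p
    rw [h2, mul_trace_negMulLog_thermal hT μ p 0 (hq ▸ hK) (by rw [hq, h1]; rfl) (by simp), hq,
      quasiE_sq, h1, normalDensity, quasiE, norm_zero]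
    have hK' : thermal T (‖p‖ ^ 2 - μ) = KZero μ T p := rfl
    rw [hK', show ((‖p‖ ^ 2 - μ) ^ 2 + 0 ^ 2 : ℝ) = (‖p‖ ^ 2 - μ) ^ 2 by ring,
      Real.sqrt_sq_eq_abs, pressure_abs]
    field_simp
    ring
  rw [freeEnergy, hV, hS, integral_sub hξ (integrable_normalDensity hT μ)]
  ring

end Normal

/-! ### The lower bound on the free energy -/

section LowerBound

open Filter Topology

theorem stateMatrix_bounds {γ : R3 → ℝ} {α : L2} {p : R3} (h : (stateMatrix γ α p).PosSemidef)
    (h1 : (1 - stateMatrix γ α p).PosSemidef) : 0 ≤ γ p ∧ γ p ≤ 1 := by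
  have h2 : 0 ≤ (stateMatrix γ α p) 0 0 := h.diag_nonneg
  have h3 : 0 ≤ (1 - stateMatrix γ α p) 0 0 := h1.diag_nonneg
  simp only [stateMatrix, Matrix.sub_apply, Matrix.one_apply_eq, Matrix.of_apply,
    Matrix.cons_val_zero] at h2 h3
  constructor
  · exact_mod_cast h2
  · have : (0 : ℂ) ≤ ((1 - γ p : ℝ) : ℂ) := by push_cast; exact h3
    have : (0 : ℝ) ≤ 1 - γ p := by exact_mod_cast this
    linarith

theorem trace_negMulLog_nonneg {A : Matrix (Fin 2) (Fin 2) ℂ} (hA : A.PosSemidef)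
    (hA1 : (1 - A).PosSemidef) : 0 ≤ (cfc Real.negMulLog A).trace.re := by
  rw [trace_cfc hA.1, ← Complex.ofReal_sum, Complex.ofReal_re]
  refine Finset.sum_nonneg fun i _ => ?_
  have h := eigenvalues_mem_Icc hA hA1 i
  exact Real.negMulLog_nonneg h.1 h.2

theorem integral_eq_zero_of_odd {g : R3 → ℝ} (h : ∀ᵐ p : R3, g (-p) = -g p) :
    ∫ p, g p = 0 := by
  have h1 : ∫ p, g (-p) = ∫ p, g p := integral_neg_eq_self g volume
  rw [integral_congr_ae h, integral_neg] at h1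
  linarith

/-- Duality bound for the BCS functional. -/
theorem le_freeEnergy (V : R3 → ℝ) {T : ℝ} (hT : 0 ≤ T) (μ : ℝ) {s : (R3 → ℝ) × L2}
    (hs : s ∈ admissible) {f : L2} (hf : bessel f = s.2) {g : L2} (hg : IsEven g) :
    (∫ p, normalDensity μ T p) + potQuad V f + ((inner ℂ g f).re - condensation μ T g) ≤
      freeEnergy V μ T s := by
  obtain ⟨hγ, -, -, hΓ⟩ := hs
  set γ := s.1 with hγdef
  have hγn : Integrable (fun p => (1 + ‖p‖ ^ 2) * γ (-p)) volume := by
    have := hγ.comp_neg; simpa using this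
  -- Measurability of γ is recovered from its weighted integrability by multiplying with 1/(1+p²).
  have hγm : AEStronglyMeasurable γ volume := by
    have h1 := (integrable_xi_mul hγ (g := fun _ => 1) measurable_const (C := 1) (fun p => by
      rw [abs_one, one_mul]; exact one_le_pow₀ (one_le_wt p))).aestronglyMeasurable
    simpa using h1
  have hγnm : AEStronglyMeasurable (fun p => γ (-p)) volume :=
    hγm.comp_quasiMeasurePreserving (Measure.measurePreserving_neg volume).quasiMeasurePreserving
  have hX : Integrable (fun p => (‖p‖ ^ 2 - μ) * γ p) volume :=
    integrable_xi_mul hγ (by fun_prop) (abs_xi_le μ)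
  have hXn : Integrable (fun p => (‖p‖ ^ 2 - μ) * γ (-p)) volume :=
    integrable_xi_mul hγn (by fun_prop) (abs_xi_le μ)
  have hXeq : ∫ p, (‖p‖ ^ 2 - μ) * γ (-p) = ∫ p, (‖p‖ ^ 2 - μ) * γ p := by
    have := integral_neg_eq_self (fun p : R3 => (‖p‖ ^ 2 - μ) * γ p) volume
    simpa using this
  have hH := integrable_normalDensity hT μ
  have hW := integrable_pairEnergy hT μ g
  have hI : Integrable (fun p => (conj (g p) * f p).re) volume :=
    (integrable_mul_L2 (memLp_conj (Lp.memLp g)) (Lp.memLp f)).re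
  have hIeq : ∫ p, (conj (g p) * f p).re = (inner ℂ g f).re := by
    rw [inner_eq_integral]
    exact integral_re (integrable_mul_L2 (memLp_conj (Lp.memLp g)) (Lp.memLp f))
  -- The trace of Γ(p) is 1 + γ(p) - γ(-p), since γ need not be even. The surplus multiplies an even
  -- factor, so it is odd and integrates to zero. The P(ξ) part of it is integrable by the weight on
  -- γ, the rest because |γ(p) - γ(-p)| ≤ 1.
  set O : R3 → ℝ := fun p =>
    (pressure T (quasiE μ p ((wt p : ℂ) * g p)) - T) * (γ p - γ (-p)) with hO
  have hOi : Integrable O volume := by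
    have hb : ∀ p, |pressure T (‖p‖ ^ 2 - μ) - T| ≤ ((1 + |μ|) / 2 + T) * wt p ^ 2 := fun p => by
      have h1 := pressure_nonneg hT (‖p‖ ^ 2 - μ)
      have h2 := pressure_le hT (‖p‖ ^ 2 - μ)
      have h3 := abs_xi_le μ p
      have h4 : 1 ≤ wt p ^ 2 := one_le_pow₀ (one_le_wt p)
      have h5 := abs_nonneg (‖p‖ ^ 2 - μ)
      rw [abs_le]; constructor <;> nlinarith
    have hpm : Measurable fun p : R3 => pressure T (‖p‖ ^ 2 - μ) - T :=
      ((measurable_pressure T).comp (by fun_prop)).sub_const T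
    have h1 := (integrable_xi_mul hγ hpm hb).sub (integrable_xi_mul hγn hpm hb)
    have h2 : Integrable (fun p => (γ p - γ (-p)) * pairEnergy μ T p ((wt p : ℂ) * g p)) volume := by
      refine hW.bdd_mul (c := 1) (hγm.sub hγnm) ?_
      filter_upwards [hΓ, ae_neg hΓ] with p h3 h4
      have h5 := stateMatrix_bounds h3.1 h3.2
      have h6 := stateMatrix_bounds h4.1 h4.2
      rw [Real.norm_eq_abs, abs_le]
      constructor <;> linarith [h5.1, h5.2, h6.1, h6.2]
    refine (h1.add h2).congr (Eventually.of_forall fun p => ?_)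
    simp only [hO, Pi.add_apply, Pi.sub_apply, pairEnergy]
    ring
  have hO0 : ∫ p, O p = 0 := by
    refine integral_eq_zero_of_odd ?_
    filter_upwards [hg] with p hp
    simp only [hO, hp, wt_neg, quasiE_neg, neg_neg]
    ring
  have hSle : T * entropy γ s.2 ≤ (∫ p, (‖p‖ ^ 2 - μ) * γ p) - (∫ p, normalDensity μ T p) +
      condensation μ T g - (inner ℂ g f).re := by
    have hB1 := hX.const_mul (1 / 2)
    have hB2 := hXn.const_mul (1 / 2)
    have hB := ((((hB1.add hB2).sub hH).add hW).sub hI).add hOi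
    have e := integral_add' ((((hB1.add hB2).sub hH).add hW).sub hI) hOi
    rw [integral_sub' (((hB1.add hB2).sub hH).add hW) hI, integral_add' ((hB1.add hB2).sub hH) hW,
      integral_sub' (hB1.add hB2) hH, integral_add' hB1 hB2, integral_const_mul,
      integral_const_mul, hXeq, hO0, hIeq, ← condensation] at e
    have e' : (∫ p, (‖p‖ ^ 2 - μ) * γ p) - (∫ p, normalDensity μ T p) +
        condensation μ T g - (inner ℂ g f).re =
        1 / 2 * (∫ p, (‖p‖ ^ 2 - μ) * γ p) + 1 / 2 * (∫ p, (‖p‖ ^ 2 - μ) * γ p) -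
          (∫ p, normalDensity μ T p) + condensation μ T g - (inner ℂ g f).re + 0 := by ring
    rw [e', ← e, entropy, ← integral_const_mul]
    -- The entropy density is nonnegative, so only the majorant has to be integrable: a
    -- non-integrable entropy would have integral zero by convention and satisfy the bound too.
    refine integral_mono_of_nonneg ?_ hB ?_
    · filter_upwards [hΓ] with p hp
      exact mul_nonneg hT (trace_negMulLog_nonneg hp.1 hp.2)
    · filter_upwards [hΓ, hatL2_bessel f] with p hp hfp
      -- The field is taken with a minus sign so that ⟨g,f⟩ enters the lower bound for F positively.
      have h1 := mul_trace_negMulLog_le hT hp.1 hp.2 (‖p‖ ^ 2 - μ) (-((wt p : ℂ) * g p))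
      have h2 : (conj (-((wt p : ℂ) * g p)) * hatL2 s.2 p) = -(conj (g p) * f p) := by
        rw [← hf, hfp, map_neg, map_mul, Complex.conj_ofReal]
        have := wt_ne p
        field_simp
      have h3 : stateMatrix γ s.2 p 0 0 = (γ p : ℂ) := rfl
      have h4 : stateMatrix γ s.2 p 1 1 = 1 - (γ (-p) : ℂ) := rfl
      have h5 : stateMatrix γ s.2 p 0 1 = hatL2 s.2 p := rfl
      rw [h3, h4, h5, h2, Complex.ofReal_re, Complex.sub_re, Complex.one_re, Complex.ofReal_re,
        norm_neg, Complex.neg_re] at h1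
      refine h1.trans (le_of_eq ?_)
      simp only [hO, normalDensity, pairEnergy, Pi.add_apply, Pi.sub_apply]
      change _ + pressure T (quasiE μ p ((wt p : ℂ) * g p)) * _ + _ = _
      ring
  have hv : ∫ x, ‖s.2 x‖ ^ 2 * V x = potQuad V f := by rw [← hf, potQuad]
  rw [freeEnergy, hv]
  linarith

end LowerBound

/-! ### From instability of the normal state to the gap equation -/

section Minimizer

open Filter Topology

theorem potForm_reflect {V : R3 → ℝ} (hVe : ∀ᵐ x : R3, V (-x) = V x) (f g : L2) :
    potForm V (reflect f) g = potForm V f (reflect g) := by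
  unfold potForm
  rw [← integral_neg_eq_self (fun x => (V x : ℂ) * (conj (bessel f x) * bessel (reflect g) x)),
    bessel_reflect, bessel_reflect]
  refine integral_congr_ae ?_
  filter_upwards [hVe, reflect_ae (bessel f), ae_neg (reflect_ae (bessel g))] with x h1 h2 h3
  rw [h1, h2, h3, neg_neg]

theorem isEven_vOp {V : R3 → ℝ} (hV : MemLp V (3 / 2) volume) (hVe : ∀ᵐ x : R3, V (-x) = V x)
    {f : L2} (hf : IsEven f) : IsEven (vOp hV f) := by
  rw [isEven_iff] at hf ⊢
  refine ext_inner_right ℂ fun g => ?_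
  rw [inner_reflect, inner_vOp, inner_vOp, ← potForm_reflect hVe, hf]

theorem potQuad_add_smul {V : R3 → ℝ} (hV : MemLp V (3 / 2) volume) (f h : L2) (t : ℝ) :
    potQuad V (f + (t : ℂ) • h) =
      potQuad V f + 2 * t * (inner ℂ (vOp hV f) h).re + t ^ 2 * potQuad V h := by
  have hs : (inner ℂ (vOp hV h) f).re = (inner ℂ (vOp hV f) h).re := by
    rw [inner_vOp, ← potForm_conj_symm, Complex.conj_re, ← inner_vOp hV]
  rw [potQuad_eq_re hV, potQuad_eq_re hV, potQuad_eq_re hV, map_add, map_smul, inner_add_left,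
    inner_add_right, inner_add_right, inner_smul_left, inner_smul_right, inner_smul_left,
    inner_smul_right, Complex.conj_ofReal]
  simp only [Complex.add_re, Complex.re_ofReal_mul, hs]
  ring

theorem nonneg_of_forall_quadratic {a b : ℝ}
    (h : ∀ t : ℝ, 0 ≤ t → t ≤ 1 → 0 ≤ t * a + t ^ 2 * b) : 0 ≤ a := by
  by_contra! ha
  -- Small enough that t|b| ≤ -a/2, so the linear term wins.
  set t := min 1 (-a / (2 * (|b| + 1))) with ht
  have hb : 0 < 2 * (|b| + 1) := by positivity
  have ht0 : 0 < t := lt_min one_pos (div_pos (by linarith) hb)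
  have h1 := h t ht0.le (min_le_left _ _)
  have h2 : t * (2 * (|b| + 1)) ≤ -a := (le_div_iff₀ hb).1 (min_le_right _ _)
  have h3 : 0 ≤ a + t * b := by
    have : 0 ≤ t * (a + t * b) := by nlinarith
    exact nonneg_of_mul_nonneg_right this ht0
  have h4 : t * b ≤ t * |b| := mul_le_mul_of_nonneg_left (le_abs_self b) ht0.le
  have h5 : 0 ≤ t * |b| := by positivity
  nlinarith

/-- The Euler–Lagrange inequality of a minimizer. -/
theorem variational_inequality {V : R3 → ℝ} (hV : MemLp V (3 / 2) volume) {μ T : ℝ} {x : L2 × ℝ}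
    (hx : x ∈ dualEpi μ T)
    (hmin : ∀ y ∈ dualEpi μ T, x.2 + potQuad V x.1 ≤ y.2 + potQuad V y.1) {y : L2 × ℝ}
    (hy : y ∈ dualEpi μ T) :
    0 ≤ y.2 - x.2 + 2 * (inner ℂ (vOp hV x.1) (y.1 - x.1)).re := by
  refine nonneg_of_forall_quadratic (b := potQuad V (y.1 - x.1)) fun t h0 h1 => ?_
  have h2 := hmin _ (dualEpi_convex μ hx hy h0 h1)
  simp only [potQuad_add_smul hV] at h2
  linarith

section Dual

variable {T : ℝ} (hT : 0 ≤ T) (μ : ℝ) (d : L2)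

/-- The kinetic function associated with the pairing field `(1 + p²)^{1/2} d(p)`. -/
noncomputable def fieldK (μ T : ℝ) (d : L2) (p : R3) : ℝ := quasiK μ T p ((wt p : ℂ) * d p)

theorem measurable_fieldK : Measurable (fieldK μ T d) := measurable_quasiK μ T (measurable_wt_mul d)

include hT in
theorem ae_fieldK_pos : ∀ᵐ p : R3, 0 < fieldK μ T d p := by
  filter_upwards [ae_KZero_pos hT μ] with p hp
  exact hp.trans_le (KZero_le_quasiK hT μ p _)

theorem norm_wt_mul (p : R3) (z : ℂ) : ‖(wt p : ℂ) * z‖ = wt p * ‖z‖ := by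
  rw [norm_mul, Complex.norm_real, Real.norm_of_nonneg (wt_pos p).le]

include hT in
-- Near the Fermi surface (1+p²)^{1/2}|d| ≤ K bounds the product by the weight, which is square
-- integrable on a ball; far out the multiplier is at most one.
theorem memLp_dualField :
    MemLp (fun p => ((wt p ^ 2 / (2 * fieldK μ T d p) : ℝ) : ℂ) * d p) 2 volume := by
  have hm : AEStronglyMeasurable (fun p => ((wt p ^ 2 / (2 * fieldK μ T d p) : ℝ) : ℂ) * d p)
      volume :=
    ((Complex.measurable_ofReal.comp ((continuous_wt.measurable.pow_const 2).div
      ((measurable_fieldK μ d).const_mul 2))).mul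
        (Lp.stronglyMeasurable d).measurable).aestronglyMeasurable
  rw [memLp_two_iff_integrable hm]
  refine (((integrable_ballInd (2 * |μ| + 1)).const_mul (1 + (2 * |μ| + 1) ^ 2)).add
    (integrable_norm_sq d)).mono' (hm.norm.pow 2) ?_
  filter_upwards [ae_fieldK_pos hT μ d] with p hK
  have hw := wt_pos p
  rw [Real.norm_of_nonneg (by positivity), norm_mul, Complex.norm_real,
    Real.norm_of_nonneg (by positivity), Pi.add_apply]
  have h1 := norm_le_quasiK hT μ p ((wt p : ℂ) * d p)
  rw [norm_wt_mul] at h1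
  change _ ≤ fieldK μ T d p at h1
  by_cases h : ‖p‖ ≤ 2 * |μ| + 1
  · have h2 : wt p ^ 2 ≤ 1 + (2 * |μ| + 1) ^ 2 := by rw [wt_sq]; gcongr
    have h3 : wt p ^ 2 / (2 * fieldK μ T d p) * ‖d p‖ ≤ wt p := by
      rw [div_mul_eq_mul_div, div_le_iff₀ (by positivity)]
      nlinarith
    have h4 := pow_le_pow_left₀ (by positivity) h3 2
    simp only [ballInd, h, if_true]
    nlinarith [sq_nonneg ‖d p‖]
  · have h' := (not_le.1 h).le
    have h2 := half_wt_sq_le h'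
    have h5 : wt p ^ 2 ≤ 2 * fieldK μ T d p := by
      have := (xi_le_KZero hT μ p).trans (KZero_le_quasiK hT μ p ((wt p : ℂ) * d p))
      change _ ≤ fieldK μ T d p at this
      linarith
    have h3 : wt p ^ 2 / (2 * fieldK μ T d p) * ‖d p‖ ≤ ‖d p‖ :=
      mul_le_of_le_one_left (norm_nonneg _) ((div_le_one (by positivity)).2 h5)
    have h4 := pow_le_pow_left₀ (by positivity) h3 2
    simp only [ballInd, h, if_false]
    linarith

/-- The derivative of `condensation` at `d`. -/
noncomputable def dualField : L2 := (memLp_dualField hT μ d).toLp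

theorem dualField_ae : dualField hT μ d =ᵐ[volume]
    fun p => ((wt p ^ 2 / (2 * fieldK μ T d p) : ℝ) : ℂ) * d p :=
  (memLp_dualField hT μ d).coeFn_toLp

theorem fieldK_neg {d : L2} (hd : IsEven d) : ∀ᵐ p : R3, fieldK μ T d (-p) = fieldK μ T d p := by
  filter_upwards [hd] with p hp
  rw [fieldK, hp, wt_neg, quasiK_neg, fieldK]

theorem isEven_dualField {d : L2} (hd : IsEven d) : IsEven (dualField hT μ d) := by
  have h := dualField_ae hT μ d
  filter_upwards [h, ae_neg h, hd, fieldK_neg μ hd] with p h1 h2 h3 h4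
  rw [h1, h2, h3, h4, wt_neg]

theorem re_inner_eq_integral (f g : L2) :
    (inner ℂ f g).re = ∫ p, (conj (f p) * g p).re := by
  rw [inner_eq_integral]
  exact (integral_re (integrable_mul_L2 (memLp_conj (Lp.memLp f)) (Lp.memLp g))).symm

theorem integrable_re_conj_mul (f g : L2) : Integrable (fun p => (conj (f p) * g p).re) volume :=
  (integrable_mul_L2 (memLp_conj (Lp.memLp f)) (Lp.memLp g)).re

/-- Equality in Fenchel's inequality at the derivative: the tangent to the convex function W at d
lies below W. -/
theorem dualField_mem_dualEpi {d : L2} (hd : IsEven d) :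
    (dualField hT μ d, (inner ℂ d (dualField hT μ d)).re - condensation μ T d) ∈ dualEpi μ T := by
  refine ⟨isEven_dualField hT μ hd, fun g _ => ?_⟩
  have key : (inner ℂ (g - d) (dualField hT μ d)).re ≤ condensation μ T g - condensation μ T d := by
    have hg := integrable_pairEnergy hT μ g
    have hdi := integrable_pairEnergy hT μ d
    rw [re_inner_eq_integral, condensation, condensation, ← integral_sub hg hdi]
    refine integral_mono_ae (integrable_re_conj_mul _ _) (hg.sub hdi) ?_
    filter_upwards [ae_fieldK_pos hT μ d, dualField_ae hT μ d, Lp.coeFn_sub g d] with p hK h1 h2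
    refine le_trans (le_of_eq ?_) (tangent_le_pairEnergy hT μ p hK _)
    have e : conj ((g - d : L2) p) * dualField hT μ d p =
        ((1 / (2 * fieldK μ T d p) : ℝ) : ℂ) *
          (conj ((wt p : ℂ) * g p - (wt p : ℂ) * d p) * ((wt p : ℂ) * d p)) := by
      rw [h1, h2, Pi.sub_apply, ← mul_sub, map_mul, Complex.conj_ofReal]
      push_cast; ring
    rw [e, Complex.re_ofReal_mul, one_div_mul_eq_div]
    rfl
  rw [inner_sub_left, Complex.sub_re] at key
  simp only
  linarith

/-- The subdifferential of `condensation` consists of the derivative. -/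
theorem eq_dualField {d f : L2} (hd : IsEven d) (hf : IsEven f)
    (h : ∀ g : L2, IsEven g → (inner ℂ (g - d) f).re ≤ condensation μ T g - condensation μ T d) :
    f = dualField hT μ d := by
  set K := fieldK μ T d with hKdef
  set u := f - dualField hT μ d with hu
  -- K is even only almost everywhere; symmetrizing makes the multiplier θ even at every point.
  set k : R3 → ℝ := fun p => (K p + K (-p)) / 2 with hk
  have hKm : Measurable K := measurable_fieldK (T := T) μ d
  have hkm : Measurable k := (hKm.add (hKm.comp measurable_neg)).div_const 2
  have hK0 (p) : 0 ≤ K p := thermal_nonneg hT _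
  have hk0 (p) : 0 ≤ k p := div_nonneg (add_nonneg (hK0 _) (hK0 _)) zero_le_two
  -- The truncation compensates the factor (1+p²)/(2K) in the quadratic term, which is unbounded
  -- near the Fermi surface at T = 0. The direction v = θu is then an admissible step of length one,
  -- and no limit of difference quotients is needed.
  set θ : R3 → ℝ := fun p => min 1 (2 * k p / wt p ^ 2) with hθ
  have hθm : Measurable θ :=
    measurable_const.min ((hkm.const_mul 2).div (continuous_wt.measurable.pow_const 2))
  have hθ0 (p) : 0 ≤ θ p :=
    le_min zero_le_one (div_nonneg (mul_nonneg zero_le_two (hk0 p)) (sq_nonneg _))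
  have hθC (p) : |θ p| ≤ 1 := by rw [abs_of_nonneg (hθ0 p)]; exact min_le_left _ _
  have hθn (p) : θ (-p) = θ p := by simp only [hθ, hk, neg_neg, wt_neg, add_comm]
  have hue : IsEven u := isEven_sub hf (isEven_dualField hT μ hd)
  set v := mulOp θ hθm 1 hθC u with hv
  have hve : IsEven v := isEven_mulOp hθm hθC hθn hue
  have h1 := h (d + v) (isEven_add hd hve)
  rw [add_sub_cancel_left] at h1
  have h2 : condensation μ T (d + v) - condensation μ T d ≤
      (inner ℂ v (dualField hT μ d)).re + 1 / 2 * (inner ℂ v u).re := by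
    have hg := integrable_pairEnergy hT μ (d + v)
    have hdi := integrable_pairEnergy hT μ d
    have hi1 := integrable_re_conj_mul v (dualField hT μ d)
    have hi2 := (integrable_re_conj_mul v u).const_mul (1 / 2)
    rw [re_inner_eq_integral, re_inner_eq_integral, condensation, condensation,
      ← integral_sub hg hdi, ← integral_const_mul, ← integral_add hi1 hi2]
    refine integral_mono_ae (hg.sub hdi) (hi1.add hi2) ?_
    filter_upwards [ae_fieldK_pos hT μ d, fieldK_neg (T := T) μ hd, dualField_ae hT μ d,
      Lp.coeFn_add d v, mulOp_ae hθm hθC u] with p hK hKn h3 h4 h5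
    refine (pairEnergy_sub_le hT μ p hK _).trans ?_
    change _ / (4 * K p) ≤ _
    change 0 < K p at hK
    have hkK : k p = K p := by
      change K (-p) = K p at hKn
      simp only [hk]; rw [hKn]; ring
    have hw := wt_pos p
    rw [norm_wt_mul, norm_wt_mul, h4, Pi.add_apply, h3, hv, h5]
    have e1 : ‖d p + (θ p : ℂ) * u p‖ ^ 2 =
        ‖d p‖ ^ 2 + 2 * θ p * (conj (u p) * d p).re + θ p ^ 2 * ‖u p‖ ^ 2 := by
      rw [← Complex.normSq_eq_norm_sq, ← Complex.normSq_eq_norm_sq, ← Complex.normSq_eq_norm_sq]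
      simp only [Complex.normSq_apply, Complex.add_re, Complex.add_im, Complex.mul_re,
        Complex.mul_im, Complex.ofReal_re, Complex.ofReal_im, Complex.conj_re, Complex.conj_im]
      ring
    have e2 : (conj ((θ p : ℂ) * u p) * (((wt p ^ 2 / (2 * fieldK μ T d p) : ℝ) : ℂ) * d p)).re =
        θ p * wt p ^ 2 / (2 * K p) * (conj (u p) * d p).re := by
      rw [map_mul, Complex.conj_ofReal, show (θ p : ℂ) * conj (u p) *
        (((wt p ^ 2 / (2 * fieldK μ T d p) : ℝ) : ℂ) * d p) =
        ((θ p * wt p ^ 2 / (2 * K p) : ℝ) : ℂ) * (conj (u p) * d p) by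
          rw [← hKdef]; push_cast; ring, Complex.re_ofReal_mul]
    have e3 : (conj ((θ p : ℂ) * u p) * u p).re = θ p * ‖u p‖ ^ 2 := by
      rw [map_mul, Complex.conj_ofReal, mul_assoc, Complex.conj_mul', ← Complex.ofReal_pow,
        ← Complex.ofReal_mul, Complex.ofReal_re]
    have e4 : θ p * wt p ^ 2 ≤ 2 * K p := by
      have : θ p ≤ 2 * K p / wt p ^ 2 := by rw [← hkK]; exact min_le_right _ _
      rwa [le_div_iff₀ (by positivity)] at this
    rw [mul_pow, mul_pow, e1, e2, e3]
    have e5 : θ p * wt p ^ 2 / (2 * K p) ≤ 1 := (div_le_one (by positivity)).2 e4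
    have e6 : (wt p ^ 2 * (‖d p‖ ^ 2 + 2 * θ p * (conj (u p) * d p).re + θ p ^ 2 * ‖u p‖ ^ 2) -
        wt p ^ 2 * ‖d p‖ ^ 2) / (4 * K p) = θ p * wt p ^ 2 / (2 * K p) * (conj (u p) * d p).re +
        θ p * wt p ^ 2 / (2 * K p) * (1 / 2 * (θ p * ‖u p‖ ^ 2)) := by
      field_simp; ring
    rw [e6]
    have e7 : 0 ≤ 1 / 2 * (θ p * ‖u p‖ ^ 2) := by have := hθ0 p; positivity
    have := mul_le_of_le_one_left e7 e5
    linarith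
  -- The subgradient inequality and the quadratic upper bound give ⟨v,u⟩ ≤ ½⟨v,u⟩. Since θ > 0
  -- almost everywhere, u = 0 follows.
  have h3 : (inner ℂ v u).re ≤ 0 := by
    have h4 : (inner ℂ v u).re = (inner ℂ v f).re - (inner ℂ v (dualField hT μ d)).re := by
      rw [hu, inner_sub_right, Complex.sub_re]
    linarith
  rw [hv, re_inner_mulOp] at h3
  have hnn : 0 ≤ fun p => θ p * ‖u p‖ ^ 2 := fun p => mul_nonneg (hθ0 p) (sq_nonneg _)
  have h5 := (integral_eq_zero_iff_of_nonneg hnn (integrable_mul_norm_sq hθm hθC u)).1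
    (le_antisymm h3 (integral_nonneg hnn))
  rw [← sub_eq_zero, ← hu]
  refine Lp.ext ?_
  filter_upwards [h5, ae_fieldK_pos hT μ d, Lp.coeFn_zero ℂ 2 (volume : Measure R3)] with p h6 hK h7
  rw [h7]
  have hkp : 0 < k p := by
    have := hK0 (-p)
    change 0 < K p at hK
    simp only [hk]; linarith
  have hθp : 0 < θ p := lt_min one_pos (div_pos (by linarith) (pow_pos (wt_pos p) 2))
  have h8 : ‖u p‖ ^ 2 = 0 := by
    rcases mul_eq_zero.1 h6 with h9 | h9
    · exact absurd h9 hθp.ne'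
    · exact h9
  simpa using h8

end Dual

/-- A pair wave function whose Fourier transform is bounded by `1/2` belongs to an admissible
state. -/
theorem exists_admissible {f : L2} (hf : IsEven f) (h : ∀ᵐ p : R3, ‖hatL2 (bessel f) p‖ ≤ 1 / 2) :
    ∃ γ : R3 → ℝ, (γ, bessel f) ∈ admissible := by
  set a := hatL2 (bessel f) with ha
  have ham : AEStronglyMeasurable a volume := (memLp_hatL2 _).aestronglyMeasurable
  have hae : ∀ᵐ p : R3, a (-p) = a p := by
    have h1 : IsEven (hatEquiv (bessel f)) := (isEven_hatEquiv_iff _).2 ((isEven_bessel_iff f).2 hf)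
    have h2 := hatEquiv_ae (bessel f)
    filter_upwards [h1, h2, ae_neg h2] with p h3 h4 h5
    rw [ha, ← h4, ← h5, h3]
  -- The smaller root of γ(1-γ) = |α̂|². It is at most 2|α̂|², so α ∈ H¹ makes it integrable against
  -- 1+p².
  refine ⟨fun p => (1 - Real.sqrt (1 - 4 * ‖a p‖ ^ 2)) / 2, ?_, memH1_bessel f,
    (isEven_bessel_iff f).2 hf, ?_⟩
  · have hm : AEStronglyMeasurable
        (fun p : R3 => (1 + ‖p‖ ^ 2) * ((1 - Real.sqrt (1 - 4 * ‖a p‖ ^ 2)) / 2)) volume := by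
      refine (by fun_prop : Continuous fun p : R3 => 1 + ‖p‖ ^ 2).aestronglyMeasurable.mul ?_
      have hc : Continuous fun z : ℂ => (1 - Real.sqrt (1 - 4 * ‖z‖ ^ 2)) / 2 := by fun_prop
      exact hc.comp_aestronglyMeasurable ham
    refine ((integrable_norm_sq f).const_mul 2).mono' hm ?_
    filter_upwards [h, hatL2_bessel f] with p hp hb
    have h4 : 4 * ‖a p‖ ^ 2 ≤ 1 := by nlinarith [norm_nonneg (a p)]
    have hs0 := Real.sqrt_nonneg (1 - 4 * ‖a p‖ ^ 2)
    have hs := Real.sq_sqrt (by linarith : 0 ≤ 1 - 4 * ‖a p‖ ^ 2)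
    have hs1 : Real.sqrt (1 - 4 * ‖a p‖ ^ 2) ≤ 1 :=
      Real.sqrt_le_one.2 (by nlinarith [sq_nonneg ‖a p‖])
    have hf2 : ‖f p‖ ^ 2 = (1 + ‖p‖ ^ 2) * ‖a p‖ ^ 2 := by
      rw [← wt_sq, ← mul_pow, ← norm_wt_mul, ha, hb, mul_inv_cancel_left₀ (wt_ne p)]
    rw [Real.norm_of_nonneg (mul_nonneg (by positivity) (by linarith)), hf2]
    have h5 : (1 - Real.sqrt (1 - 4 * ‖a p‖ ^ 2)) / 2 ≤ 2 * ‖a p‖ ^ 2 := by nlinarith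
    have h6 := mul_le_mul_of_nonneg_left h5 (by positivity : 0 ≤ 1 + ‖p‖ ^ 2)
    linarith
  · filter_upwards [h, hae] with p hp hpe
    have h4 : 4 * ‖a p‖ ^ 2 ≤ 1 := by nlinarith [norm_nonneg (a p)]
    have hs0 := Real.sqrt_nonneg (1 - 4 * ‖a p‖ ^ 2)
    have hs := Real.sq_sqrt (by linarith : 0 ≤ 1 - 4 * ‖a p‖ ^ 2)
    have hs1 : Real.sqrt (1 - 4 * ‖a p‖ ^ 2) ≤ 1 :=
      Real.sqrt_le_one.2 (by nlinarith [sq_nonneg ‖a p‖])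
    set g := (1 - Real.sqrt (1 - 4 * ‖a p‖ ^ 2)) / 2 with hg
    have hg0 : 0 ≤ g := by rw [hg]; linarith
    have hg1 : 0 ≤ 1 - g := by rw [hg]; linarith
    have hgg : ‖a p‖ ^ 2 ≤ g * (1 - g) := by rw [hg]; nlinarith
    have e : stateMatrix (fun p => (1 - Real.sqrt (1 - 4 * ‖a p‖ ^ 2)) / 2) (bessel f) p =
        !![(g : ℂ), a p; conj (a p), ((1 - g : ℝ) : ℂ)] := by
      simp only [stateMatrix, hpe, ← ha, ← hg]
      push_cast; rfl
    rw [e]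
    refine ⟨posSemidef_fin_two hg0 hg1 hgg, ?_⟩
    have e2 : (1 - !![(g : ℂ), a p; conj (a p), ((1 - g : ℝ) : ℂ)] : Matrix (Fin 2) (Fin 2) ℂ) =
        !![((1 - g : ℝ) : ℂ), -a p; conj (-a p), (g : ℂ)] := by
      ext i j
      fin_cases i <;> fin_cases j <;> simp
    rw [e2]
    exact posSemidef_fin_two hg1 hg0 (by rw [norm_neg]; linarith)

/-- If the normal state is unstable, the BCS gap equation has a non-trivial solution. -/
theorem exists_gapEquation_of_lt {V : R3 → ℝ} (hV : MemLp V (3 / 2) volume)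
    (hVe : ∀ᵐ x : R3, V (-x) = V x) {T : ℝ} (hT : 0 ≤ T) (μ : ℝ) {s : (R3 → ℝ) × L2}
    (hs : s ∈ admissible)
    (hlt : freeEnergy V μ T s < freeEnergy V μ T (normalGamma μ T, 0)) :
    ∃ s ∈ admissible, s.2 ≠ 0 ∧ gapFunction hV s.2 ≠ 0 ∧ GapEquation hV μ T (gapFunction hV s.2) := by
  obtain ⟨f₀, hf₀⟩ := exists_bessel_eq hs.2.1
  rw [freeEnergy_normal V hT] at hlt
  set x₀ : L2 × ℝ := (f₀, freeEnergy V μ T s - (∫ p, normalDensity μ T p) - potQuad V f₀) with hx₀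
  -- The duality bound over all even g says precisely that the unstable state defines a point of the
  -- epigraph, where the functional is negative.
  have hx₀E : x₀ ∈ dualEpi μ T := by
    refine ⟨(isEven_bessel_iff _).1 (hf₀ ▸ hs.2.2.1), fun g hg => ?_⟩
    have := le_freeEnergy V hT μ hs hf₀ hg
    simp only [hx₀]; linarith
  have hx₀v : x₀.2 + potQuad V x₀.1 < 0 := by simp only [hx₀]; linarith
  obtain ⟨M, hM⟩ := exists_norm_le_of_kin hV hT μ (x₀.2 + potQuad V x₀.1)
    fun R => ∫ p, ballInd R p * wt p ^ 2
  obtain ⟨x, hx, hmin⟩ := exists_minimizer hV hx₀E (fun y hy => dualEpi_nonneg μ hy)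
    (fun F m f m₀ h => dualEpi_closed μ h) (M := M) (fun y hy hle => hM y.1
      (by linarith [kin_le_of_mem_dualEpi hT μ hy]) (ball_le_of_mem_dualEpi hT μ hy))
  have hxneg : x.2 + potQuad V x.1 < 0 := (hmin x₀ hx₀E).trans_lt hx₀v
  set f := x.1 with hf
  -- Minus the derivative of ∫V|α|² at the minimizer; the weighted field is -Δ.
  set d : L2 := (-2 : ℂ) • vOp hV f with hd
  have hde : IsEven d := isEven_smul _ (isEven_vOp hV hVe hx.1)
  have hdi (g : L2) : (inner ℂ d g).re = -2 * (inner ℂ (vOp hV f) g).re := by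
    rw [hd, inner_smul_left]; simp
  -- The variational inequality at the dual point of d reads x.2 + W(d) ≤ Re⟨d,f⟩. Added to Re⟨g,f⟩
  -- - W(g) ≤ x.2 it makes f a subgradient of W at d.
  have hfd : f = dualField hT μ d := by
    refine eq_dualField hT μ hde hx.1 fun g hg => ?_
    have h1 := variational_inequality hV hx hmin (dualField_mem_dualEpi hT μ hde)
    have h2 := hx.2 g hg
    have h3 := hdi f
    have h4 := hdi (dualField hT μ d)
    simp only [inner_sub_right, Complex.sub_re] at h1
    rw [inner_sub_left, Complex.sub_re]
    linarith
  set Δ := gapFunction hV (bessel f) with hΔ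
  have hdΔ : ∀ᵐ p : R3, (wt p : ℂ) * d p = -Δ p := by
    filter_upwards [vOp_ae hV f, Lp.coeFn_smul (-2 : ℂ) (vOp hV f)] with p h1 h2
    rw [hd, h2, Pi.smul_apply, h1, smul_eq_mul, hΔ, gapFunction_bessel]
    have := wt_ne p
    field_simp
  have hα : ∀ᵐ p : R3, hatL2 (bessel f) p = -(Δ p / (2 * KDelta μ T Δ p : ℝ)) := by
    filter_upwards [hatL2_bessel f, hdΔ, dualField_ae hT μ d] with p h1 h2 h3
    have h4 : fieldK μ T d p = KDelta μ T Δ p := by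
      rw [fieldK, h2, KDelta_eq, quasiK, quasiE, norm_neg]; rfl
    have hw := wt_ne p
    rw [h1, hfd, h3, h4, ← neg_div, ← h2]
    push_cast
    field_simp
  have hαh : ∀ᵐ p : R3, ‖hatL2 (bessel f) p‖ ≤ 1 / 2 := by
    filter_upwards [hα] with p hp
    have h1 := norm_le_quasiK hT μ p (Δ p)
    have h2 : 0 ≤ 2 * quasiK μ T p (Δ p) := mul_nonneg zero_le_two (thermal_nonneg hT _)
    rw [hp, norm_neg, norm_div, KDelta_eq, Complex.norm_real, Real.norm_of_nonneg h2]
    refine div_le_of_le_mul₀ h2 (by norm_num) ?_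
    linarith
  obtain ⟨γ, hγ⟩ := exists_admissible hx.1 hαh
  -- At f = 0 the functional is x.2 ≥ 0, whereas the minimum is negative.
  have hα0 : bessel f ≠ 0 := fun h => by
    have h1 : potQuad V f = 0 := by
      rw [potQuad_eq_re hV, bessel_injective (h.trans (map_zero bessel).symm), inner_zero_right,
        Complex.zero_re]
    linarith [dualEpi_nonneg μ hx]
  refine ⟨(γ, bessel f), hγ, hα0, fun h => hα0 ?_, fun p => ?_⟩
  · refine L2_ext_hat ?_
    filter_upwards [hα, hatL2_zero] with p h1 h2
    change Δ = 0 at h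
    rw [h1, h2, h]; simp
  · have h1 : (fun q => Δ q / (KDelta μ T Δ q : ℂ)) =ᵐ[volume]
        fun q => (-2 : ℂ) * hatL2 (bessel f) q := by
      filter_upwards [hα] with q hq
      rw [hq]; push_cast
      -- Where K vanishes, both quotients are zero by the convention for division.
      by_cases h0 : (KDelta μ T Δ q : ℂ) = 0
      · simp [h0]
      · field_simp
    change Δ p = -(_ * convHatV hV (fun q => Δ q / (KDelta μ T Δ q : ℂ)) p)
    rw [convHatV_congr hV h1]
    have h2 : convHatV hV (fun q => (-2 : ℂ) * hatL2 (bessel f) q) p =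
        -2 * convHatV hV (hatL2 (bessel f)) p := by
      unfold convHatV
      rw [← integral_const_mul]
      congr 1 with q; ring
    rw [h2, hΔ, gapFunction]
    ring

end Minimizer

/-! ### From the gap equation to a negative eigenvalue -/

section Eigenvalue

open Filter Topology

/-- The quadratic form of `K_T^0 + V`. -/
noncomputable def linQuad (V : R3 → ℝ) (μ T : ℝ) (f : L2) : ℝ :=
  (∫ p, kinRatio μ T p * ‖f p‖ ^ 2) + potQuad V f

/-- The bounded operator representing `K_T^0 + V` in the coordinates given by `bessel`. -/
noncomputable def linOp {V : R3 → ℝ} (hV : MemLp V (3 / 2) volume) (μ : ℝ) {T : ℝ} (hT : 0 ≤ T) :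
    L2 →L[ℂ] L2 := kinOp μ hT + vOp hV

variable {V : R3 → ℝ} (hV : MemLp V (3 / 2) volume) (μ : ℝ) {T : ℝ} (hT : 0 ≤ T)

theorem linQuad_eq (f : L2) : linQuad V μ T f = (inner ℂ (linOp hV μ hT f) f).re := by
  rw [linQuad, linOp, add_apply, inner_add_left, Complex.add_re, kinOp,
    re_inner_mulOp, potQuad_eq_re hV]

theorem inner_linOp_left (f g : L2) :
    inner ℂ (linOp hV μ hT f) g = inner ℂ f (linOp hV μ hT g) := by
  rw [linOp, add_apply, add_apply, inner_add_left,
    inner_add_right, inner_vOp, inner_vOp_right, kinOp, inner_mulOp_left]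

theorem linForm_bessel (h f : L2) :
    linForm V μ T (bessel h) (bessel f) = inner ℂ h (linOp hV μ hT f) := by
  rw [linOp, add_apply, inner_add_right, inner_vOp_right, linForm, potForm]
  congr 1
  rw [inner_eq_integral]
  refine integral_congr_ae ?_
  filter_upwards [hatL2_bessel h, hatL2_bessel f, kinOp_ae μ hT f] with p h1 h2 h3
  rw [h1, h2, h3, map_mul, map_inv₀, Complex.conj_ofReal, kinRatio]
  push_cast; ring

include hV hT in
theorem linQuad_smul (c : ℂ) (f : L2) : linQuad V μ T (c • f) = ‖c‖ ^ 2 * linQuad V μ T f := by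
  rw [linQuad_eq hV μ hT, linQuad_eq hV μ hT, map_smul, inner_smul_left, inner_smul_right,
    ← mul_assoc, Complex.conj_mul', ← Complex.ofReal_pow, Complex.re_ofReal_mul]

include hV hT in
theorem linQuad_add_smul (f h : L2) (t : ℝ) : linQuad V μ T (f + (t : ℂ) • h) =
    linQuad V μ T f + 2 * t * (inner ℂ (linOp hV μ hT f) h).re + t ^ 2 * linQuad V μ T h := by
  have hs : (inner ℂ (linOp hV μ hT h) f).re = (inner ℂ (linOp hV μ hT f) h).re := by
    rw [inner_linOp_left, ← inner_conj_symm, Complex.conj_re]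
  rw [linQuad_eq hV μ hT, linQuad_eq hV μ hT, linQuad_eq hV μ hT, map_add, map_smul,
    inner_add_left, inner_add_right, inner_add_right, inner_smul_left, inner_smul_right,
    inner_smul_left, inner_smul_right, Complex.conj_ofReal]
  simp only [Complex.add_re, Complex.re_ofReal_mul, hs]
  ring

theorem norm_sq_add_smul {E : Type*} [NormedAddCommGroup E] [InnerProductSpace ℂ E] (f h : E)
    (t : ℝ) : ‖f + (t : ℂ) • h‖ ^ 2 = ‖f‖ ^ 2 + 2 * t * (inner ℂ f h).re + t ^ 2 * ‖h‖ ^ 2 := by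
  rw [@norm_add_sq ℂ, inner_smul_right, norm_smul, Complex.norm_real, mul_pow, Real.norm_eq_abs,
    sq_abs]
  simp only [RCLike.re_eq_complex_re, Complex.re_ofReal_mul]
  ring

theorem isEven_linOp (hVe : ∀ᵐ x : R3, V (-x) = V x) {f : L2} (hf : IsEven f) :
    IsEven (linOp hV μ hT f) := by
  rw [linOp, add_apply]
  exact isEven_add (isEven_kinOp μ hT hf) (isEven_vOp hV hVe hf)

/-- The epigraph of the kinetic energy on normalized even functions. -/
def kinEpi : Set (L2 × ℝ) :=
  {x | IsEven x.1 ∧ ‖bessel x.1‖ ≤ 1 ∧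
    ∀ h : L2, 2 * (inner ℂ (kinOp μ hT h) x.1).re - (inner ℂ (kinOp μ hT h) h).re ≤ x.2}

theorem kin_eq (f : L2) : (inner ℂ (kinOp μ hT f) f).re = ∫ p, kinRatio μ T p * ‖f p‖ ^ 2 := by
  rw [kinOp, re_inner_mulOp]

theorem kin_nonneg (f : L2) : 0 ≤ (inner ℂ (kinOp μ hT f) f).re := by
  rw [kin_eq]
  exact integral_nonneg fun p => mul_nonneg (kinRatio_nonneg hT μ p) (sq_nonneg _)

/-- Expanding ⟨K(f-h), f-h⟩ ≥ 0 writes the nonnegative form as a supremum of affine functions, which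
is what weak closedness needs. -/
theorem mem_kinEpi {f : L2} (hf : IsEven f) (h1 : ‖bessel f‖ ≤ 1) :
    (f, (inner ℂ (kinOp μ hT f) f).re) ∈ kinEpi μ hT := by
  refine ⟨hf, h1, fun h => ?_⟩
  have h2 := kin_nonneg μ hT (f - h)
  have hs : (inner ℂ (kinOp μ hT f) h).re = (inner ℂ (kinOp μ hT h) f).re := by
    rw [kinOp, inner_mulOp_left, ← inner_conj_symm, Complex.conj_re]
  rw [map_sub, inner_sub_left, inner_sub_right, inner_sub_right] at h2
  simp only [Complex.sub_re] at h2
  simp only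
  linarith

theorem kin_le_of_mem_kinEpi {x : L2 × ℝ} (hx : x ∈ kinEpi μ hT) :
    (inner ℂ (kinOp μ hT x.1) x.1).re ≤ x.2 := by linarith [hx.2.2 x.1]

theorem kinEpi_closed {F : ℕ → L2} {m : ℕ → ℝ} {f : L2} {m₀ : ℝ}
    (h : ∀ n, (F n, m n) ∈ kinEpi μ hT) (hF : WeakTendsto F f) (hm : Tendsto m atTop (𝓝 m₀)) :
    (f, m₀) ∈ kinEpi μ hT := by
  refine ⟨hF.isEven fun n => (h n).1, (hF.map bessel).norm_le fun n => (h n).2.1, fun g => ?_⟩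
  exact le_of_tendsto_of_tendsto' ((((Complex.continuous_re.tendsto _).comp
    (hF (kinOp μ hT g))).const_mul 2).sub_const _) hm fun n => (h n).2.2 g

/-- On the ball the weight 1+p² is at most 1+R², so low momenta are controlled by the L² norm of α.
-/
theorem ball_le_norm_bessel (R : ℝ) (f : L2) :
    ∫ p, ballInd R p * ‖f p‖ ^ 2 ≤ (1 + R ^ 2) * ‖bessel f‖ ^ 2 := by
  have hi : Integrable (fun p => (wt p)⁻¹ ^ 2 * ‖f p‖ ^ 2) volume :=
    integrable_mul_norm_sq (measurable_inv_wt.pow_const 2) (C := 1) (fun p => by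
      rw [abs_pow]; exact pow_le_one₀ (abs_nonneg _) (abs_inv_wt_le p)) f
  rw [norm_sq_bessel, ← integral_const_mul]
  refine integral_mono (integrable_mul_norm_sq (measurable_ballInd R) (abs_ballInd_le R) f)
    (hi.const_mul _) fun p => ?_
  simp only [ballInd, ← mul_assoc]
  refine mul_le_mul_of_nonneg_right ?_ (sq_nonneg _)
  split_ifs with h
  · rw [inv_pow, ← div_eq_mul_inv, le_div_iff₀ (pow_pos (wt_pos p) 2), one_mul, wt_sq]
    gcongr
  · positivity

include hV hT in
/-- A negative value of the quadratic form on even functions yields a negative eigenvalue. -/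
theorem hasNegativeEigenvalue_of_linQuad_neg (hVe : ∀ᵐ x : R3, V (-x) = V x) {b : L2}
    (hb : IsEven b) (hq : linQuad V μ T b < 0) : HasNegativeEigenvalue V μ T := by
  have hnorm (f : L2) (hf : bessel f ≠ 0) :
      ‖bessel (((‖bessel f‖⁻¹ : ℝ) : ℂ) • f)‖ = 1 := by
    rw [map_smul, norm_smul, Complex.norm_real, norm_inv, norm_norm,
      inv_mul_cancel₀ (norm_ne_zero_iff.2 hf)]
  have hne (f : L2) (hf : linQuad V μ T f < 0) : bessel f ≠ 0 := fun h => by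
    have h0 : f = 0 := bessel_injective (h.trans (map_zero bessel).symm)
    rw [linQuad_eq hV μ hT, h0, inner_zero_right, Complex.zero_re] at hf
    exact lt_irrefl _ hf
  set b₁ := ((‖bessel b‖⁻¹ : ℝ) : ℂ) • b with hb₁
  have hb₁e : IsEven b₁ := isEven_smul _ hb
  have hb₁q : linQuad V μ T b₁ < 0 := by
    rw [hb₁, linQuad_smul hV μ hT, Complex.norm_real, norm_inv, norm_norm]
    exact mul_neg_of_pos_of_neg (by have := norm_pos_iff.2 (hne b hq); positivity) hq
  have hx₀ := mem_kinEpi μ hT hb₁e (hnorm b (hne b hq)).le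
  obtain ⟨M, hM⟩ := exists_norm_le_of_kin hV hT μ
    ((inner ℂ (kinOp μ hT b₁) b₁).re + potQuad V b₁) fun R => 1 + R ^ 2
  obtain ⟨x, hx, hmin⟩ := exists_minimizer hV hx₀
    (fun y hy => (kin_nonneg μ hT y.1).trans (kin_le_of_mem_kinEpi μ hT hy))
    (fun F m f m₀ h => kinEpi_closed μ hT h) (M := M) (fun y hy hle => hM y.1
      (by
        have h1 := kin_le_of_mem_kinEpi μ hT hy
        rw [kin_eq] at h1
        exact (add_le_add_left h1 _).trans hle)
      (fun R => (ball_le_norm_bessel R y.1).trans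
        (mul_le_of_le_one_right (by positivity) (pow_le_one₀ (norm_nonneg _) hy.2.1))))
  set ψ := x.1 with hψ
  have hmin' (y : L2) (hy : IsEven y) (hy1 : ‖bessel y‖ ≤ 1) :
      linQuad V μ T ψ ≤ linQuad V μ T y := by
    have h1 := hmin _ (mem_kinEpi μ hT hy hy1)
    have h2 := kin_le_of_mem_kinEpi μ hT hx
    rw [linQuad, linQuad, ← kin_eq μ hT, ← kin_eq μ hT]
    simp only at h1
    linarith
  set e := linQuad V μ T ψ with he
  have he0 : e < 0 := (hmin' b₁ hb₁e (hnorm b (hne b hq)).le).trans_lt hb₁q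
  -- By homogeneity the minimum over the unit ball bounds the form below by e‖α‖² on all even
  -- functions.
  have hlow (y : L2) (hy : IsEven y) : e * ‖bessel y‖ ^ 2 ≤ linQuad V μ T y := by
    by_cases h0 : bessel y = 0
    · rw [bessel_injective (h0.trans (map_zero bessel).symm), linQuad_eq hV μ hT]
      simp
    · have h1 := hmin' _ (isEven_smul _ hy) (hnorm y h0).le
      rw [linQuad_smul hV μ hT, Complex.norm_real, norm_inv, norm_norm, inv_pow,
        ← div_eq_inv_mul, le_div_iff₀ (pow_pos (norm_pos_iff.2 h0) 2)] at h1
      exact h1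
  -- The lower bound at ψ itself reads e‖α‖² ≤ e; as e < 0, the constraint is saturated.
  have hψ1 : ‖bessel ψ‖ ^ 2 = 1 := by
    refine le_antisymm (pow_le_one₀ (norm_nonneg _) hx.2.1) ?_
    have := hlow ψ hx.1
    nlinarith
  have hre (h : L2) (hh : IsEven h) :
      0 ≤ (inner ℂ (linOp hV μ hT ψ) h - e * inner ℂ (bessel ψ) (bessel h)).re := by
    have h1 : 0 ≤ 2 * (inner ℂ (linOp hV μ hT ψ) h - e * inner ℂ (bessel ψ) (bessel h)).re := by
      refine nonneg_of_forall_quadratic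
        (b := linQuad V μ T h - e * ‖bessel h‖ ^ 2) fun t _ _ => ?_
      have h2 := hlow _ (isEven_add hx.1 (isEven_smul (t : ℂ) hh))
      rw [linQuad_add_smul hV μ hT, map_add, map_smul, norm_sq_add_smul, hψ1, ← he] at h2
      rw [Complex.sub_re, Complex.re_ofReal_mul]
      linarith
    linarith
  have heq (h : L2) (hh : IsEven h) :
      inner ℂ (linOp hV μ hT ψ) h = e * inner ℂ (bessel ψ) (bessel h) := by
    -- Complex multiples of h test every phase; c = -z̄ forces z = 0.
    have key (c : ℂ) : 0 ≤
        (c * (inner ℂ (linOp hV μ hT ψ) h - e * inner ℂ (bessel ψ) (bessel h))).re := by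
      have := hre (c • h) (isEven_smul c hh)
      rwa [map_smul, inner_smul_right, inner_smul_right, mul_left_comm, ← mul_sub] at this
    set z := inner ℂ (linOp hV μ hT ψ) h - e * inner ℂ (bessel ψ) (bessel h) with hz
    have h1 := key (-conj z)
    rw [neg_mul, Complex.conj_mul', ← Complex.ofReal_pow, ← Complex.ofReal_neg,
      Complex.ofReal_re] at h1
    have h2 : ‖z‖ = 0 := by nlinarith [norm_nonneg z]
    exact sub_eq_zero.1 (norm_eq_zero.1 h2)
  -- Odd test functions contribute nothing, because the operator preserves evenness; symmetrizing h
  -- gives the equation on all of H¹.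
  have hall (h : L2) : inner ℂ (linOp hV μ hT ψ) h = e * inner ℂ (bessel ψ) (bessel h) := by
    have h1 : IsEven (h + reflect h) := by
      rw [isEven_iff, map_add, reflect_reflect, add_comm]
    have h2 := heq _ h1
    have h3 : inner ℂ (linOp hV μ hT ψ) (reflect h) = inner ℂ (linOp hV μ hT ψ) h := by
      rw [← inner_reflect, (isEven_iff _).1 (isEven_linOp hV μ hT hVe hx.1)]
    have h4 : inner ℂ (bessel ψ) (bessel (reflect h)) = inner ℂ (bessel ψ) (bessel h) := by
      rw [bessel_reflect, ← inner_reflect,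
        (isEven_iff _).1 ((isEven_bessel_iff ψ).2 hx.1)]
    rw [map_add, inner_add_right, inner_add_right, h3, h4] at h2
    linear_combination h2 / 2
  refine ⟨e, he0, bessel ψ, hne ψ he0, (isEven_bessel_iff ψ).2 hx.1, memH1_bessel ψ, fun φ hφ => ?_⟩
  obtain ⟨h, rfl⟩ := exists_bessel_eq hφ
  rw [linForm_bessel hV μ hT, inner_smul_right, ← inner_conj_symm h, hall, map_mul,
    Complex.conj_ofReal, inner_conj_symm]

include hT in
/-- A non-trivial solution of the gap equation yields a negative eigenvalue. -/
theorem hasNegativeEigenvalue_of_gapEquation (hVe : ∀ᵐ x : R3, V (-x) = V x) {α : L2}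
    (hα : MemH1 α) (hαe : IsEven α) (h0 : gapFunction hV α ≠ 0)
    (hgap : GapEquation hV μ T (gapFunction hV α)) : HasNegativeEigenvalue V μ T := by
  obtain ⟨f, rfl⟩ := exists_bessel_eq hα
  set Δ := gapFunction hV (bessel f) with hΔ
  have hf : IsEven f := (isEven_bessel_iff f).1 hαe
  set d : L2 := (2 : ℂ) • vOp hV f with hd
  have hde : IsEven d := isEven_smul _ (isEven_vOp hV hVe hf)
  have hdΔ : ∀ᵐ p : R3, (wt p : ℂ) * d p = Δ p := by
    filter_upwards [vOp_ae hV f, Lp.coeFn_smul (2 : ℂ) (vOp hV f)] with p h1 h2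
    rw [hd, h2, Pi.smul_apply, h1, smul_eq_mul, hΔ, gapFunction_bessel]
    have := wt_ne p
    field_simp
  -- The test function has transform Δ/K_T^Δ. It need not be proportional to the given α, which is
  -- related to Δ only through V.
  set b : L2 := (2 : ℂ) • dualField hT μ d with hb
  have hbe : IsEven b := isEven_smul _ (isEven_dualField hT μ hde)
  have hba : ∀ᵐ p : R3, b p = ((wt p ^ 2 / fieldK μ T d p : ℝ) : ℂ) * d p := by
    filter_upwards [dualField_ae hT μ d, Lp.coeFn_smul (2 : ℂ) (dualField hT μ d)] with p h1 h2
    rw [hb, h2, Pi.smul_apply, h1, smul_eq_mul]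
    push_cast; ring
  have hbh : hatL2 (bessel b) =ᵐ[volume] fun q => Δ q / (KDelta μ T Δ q : ℂ) := by
    filter_upwards [hatL2_bessel b, hba, hdΔ] with p h1 h2 h3
    have h4 : fieldK μ T d p = KDelta μ T Δ p := by rw [fieldK, h3, KDelta_eq]
    have hw := wt_ne p
    rw [h1, h2, h4, ← h3]
    push_cast
    field_simp
  have hΔb (p : R3) : Δ p = -hatL1 (fun x => (V x : ℂ) * bessel b x) p := by
    rw [hgap p, ← convHatV_congr hV hbh, ← cFour_mul_convHatV hV]
  have hvb : ∀ᵐ p : R3, vOp hV b p = -d p := by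
    filter_upwards [vOp_ae hV b, hdΔ] with p h1 h2
    have hw := wt_ne p
    rw [h1, ← neg_eq_iff_eq_neg.2 (hΔb p), ← h2]
    field_simp
  refine hasNegativeEigenvalue_of_linQuad_neg hV μ hT hVe hbe ?_
  -- The integrand of the form is K_T^0|Δ|²/(K_T^Δ)² - |Δ|²/K_T^Δ.
  have hpt : ∀ᵐ p : R3, kinRatio μ T p * ‖b p‖ ^ 2 + (conj (vOp hV b p) * b p).re =
      -((fieldK μ T d p - KZero μ T p) * (wt p ^ 2 * ‖d p‖ ^ 2) / fieldK μ T d p ^ 2) := by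
    filter_upwards [hba, hvb, ae_fieldK_pos hT μ d] with p h1 h2 hK
    have hw := (wt_pos p).ne'
    have e1 : (conj (-d p) * (((wt p ^ 2 / fieldK μ T d p : ℝ) : ℂ) * d p)).re =
        -(wt p ^ 2 / fieldK μ T d p * ‖d p‖ ^ 2) := by
      rw [map_neg, neg_mul, mul_left_comm, Complex.conj_mul', ← Complex.ofReal_pow,
        ← Complex.ofReal_mul, ← Complex.ofReal_neg, Complex.ofReal_re]
    rw [h2, h1, e1, norm_mul, Complex.norm_real, Real.norm_of_nonneg (by positivity), kinRatio]
    field_simp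
    ring
  have hi1 := integrable_mul_norm_sq (measurable_kinRatio μ T) (abs_kinRatio_le hT μ) b
  have hi2 := integrable_re_conj_mul (vOp hV b) b
  have hq : linQuad V μ T b =
      ∫ p, (kinRatio μ T p * ‖b p‖ ^ 2 + (conj (vOp hV b p) * b p).re) := by
    rw [linQuad, potQuad_eq_re hV, re_inner_eq_integral, integral_add hi1 hi2]
  set G : R3 → ℝ := fun p =>
    (fieldK μ T d p - KZero μ T p) * (wt p ^ 2 * ‖d p‖ ^ 2) / fieldK μ T d p ^ 2 with hG
  have hG0 : 0 ≤ G := fun p => by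
    have := KZero_le_quasiK hT μ p ((wt p : ℂ) * d p)
    exact div_nonneg (mul_nonneg (sub_nonneg.2 this) (by positivity)) (sq_nonneg _)
  have hGi : Integrable G volume :=
    ((hi1.add hi2).neg).congr (by
      filter_upwards [hpt] with p hp
      rw [Pi.neg_apply, Pi.add_apply, hp, neg_neg])
  rw [hq, integral_congr_ae hpt, integral_neg, neg_lt_zero]
  refine lt_of_le_of_ne (integral_nonneg hG0) fun h => h0 ?_
  have hGz := (integral_eq_zero_iff_of_nonneg hG0 hGi).1 h.symm
  -- If the form vanished, strict monotonicity of K would force d = 0, hence b = 0, and then Δ = 0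
  -- at every p by the pointwise gap equation.
  have hb0 : b = 0 := by
    refine Lp.ext ?_
    filter_upwards [hba, hGz, ae_fieldK_pos hT μ d, Lp.coeFn_zero ℂ 2 (volume : Measure R3)]
      with p h1 h2 hK h3
    rw [h3, h1]
    by_cases hdp : d p = 0
    · simp [hdp]
    · exfalso
      have h4 := KZero_lt_quasiK hT μ p (mul_ne_zero (wt_ne p) hdp)
      have h5 : 0 < G p := by
        have := norm_pos_iff.2 hdp
        have := wt_pos p
        have h6 : 0 < fieldK μ T d p - KZero μ T p := sub_pos.2 h4
        simp only [hG]
        positivity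
      exact h5.ne' h2
  funext p
  rw [hΔb p, hb0, map_zero, ← cFour_mul_integral, Pi.zero_apply, neg_eq_zero]
  refine mul_eq_zero_of_right _ (integral_eq_zero_of_ae ?_)
  filter_upwards [Lp.coeFn_zero ℂ 2 (volume : Measure R3)] with x hx
  rw [hx]; simp

end Eigenvalue

/-! ### From a negative eigenvalue to instability of the normal state -/

section Instability

open Filter Topology

variable {V : R3 → ℝ} (hV : MemLp V (3 / 2) volume) (μ : ℝ) {T : ℝ} (hT : 0 ≤ T)

/-- The momentum distribution of the thermal state with pairing field `(1 + p²)^{1/2} d(p)`. -/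
noncomputable def fieldGamma (μ T : ℝ) (d : L2) (p : R3) : ℝ :=
  (1 - (‖p‖ ^ 2 - μ) / fieldK μ T d p) / 2

include hT in
theorem hatL2_bessel_dualField (d : L2) : ∀ᵐ p : R3,
    hatL2 (bessel (dualField hT μ d)) p = (wt p : ℂ) * d p / (2 * fieldK μ T d p : ℝ) := by
  filter_upwards [hatL2_bessel (dualField hT μ d), dualField_ae hT μ d] with p h1 h2
  have hw := wt_ne p
  rw [h1, h2]
  push_cast
  field_simp

include hT in
theorem stateMatrix_field {d : L2} (hd : IsEven d) : ∀ᵐ p : R3, 0 < fieldK μ T d p ∧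
    stateMatrix (fieldGamma μ T d) (bessel (dualField hT μ d)) p =
      !![(fieldGamma μ T d p : ℂ), (wt p : ℂ) * d p / (2 * fieldK μ T d p : ℝ);
        conj ((wt p : ℂ) * d p / (2 * fieldK μ T d p : ℝ)), ((1 - fieldGamma μ T d p : ℝ) : ℂ)] := by
  filter_upwards [hatL2_bessel_dualField μ hT d, ae_fieldK_pos hT μ d, fieldK_neg (T := T) μ hd]
    with p h1 hK h2
  refine ⟨hK, ?_⟩
  have h3 : fieldGamma μ T d (-p) = fieldGamma μ T d p := by
    rw [fieldGamma, h2, norm_neg, fieldGamma]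
  rw [stateMatrix, h1, h3, Complex.ofReal_sub, Complex.ofReal_one]

theorem measurable_fieldGamma (d : L2) : Measurable (fieldGamma μ T d) := by
  have h := measurable_fieldK (T := T) μ d
  unfold fieldGamma
  fun_prop

include hT in
theorem fieldGamma_mem_Icc (d : L2) {p : R3} (hK : 0 < fieldK μ T d p) :
    0 ≤ fieldGamma μ T d p ∧ fieldGamma μ T d p ≤ 1 := by
  have h1 := (abs_xi_le_quasiE μ p ((wt p : ℂ) * d p)).trans (quasiE_le_quasiK hT μ p _)
  have h2 : |(‖p‖ ^ 2 - μ) / fieldK μ T d p| ≤ 1 := by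
    rw [abs_div, abs_of_pos hK, div_le_one hK]; exact h1
  have h3 := abs_le.1 h2
  unfold fieldGamma
  constructor <;> linarith [h3.1, h3.2]

include hT in
-- Where the field vanishes the state is the normal one, so a momentum cutoff on d makes γ
-- integrable against 1+p².
theorem integrable_fieldGamma {d : L2} {R : ℝ} (hR : ∀ᵐ p : R3, R < ‖p‖ → d p = 0) :
    Integrable (fun p => (1 + ‖p‖ ^ 2) * fieldGamma μ T d p) volume := by
  have hm : AEStronglyMeasurable (fun p : R3 => (1 + ‖p‖ ^ 2) * fieldGamma μ T d p) volume :=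
    ((by fun_prop : Measurable fun p : R3 => 1 + ‖p‖ ^ 2).mul
      (measurable_fieldGamma μ d)).aestronglyMeasurable
  refine ((integrable_normalGamma hT μ).add
    ((integrable_ballInd R).const_mul (1 + R ^ 2))).mono' hm ?_
  filter_upwards [hR, ae_fieldK_pos hT μ d, ae_KZero_pos hT μ] with p h1 hK hK0
  have h2 := fieldGamma_mem_Icc μ hT d hK
  have h3 := normalGamma_nonneg μ T p
  rw [Real.norm_of_nonneg (mul_nonneg (by positivity) h2.1), Pi.add_apply]
  by_cases h : ‖p‖ ≤ R
  · have h4 : 1 + ‖p‖ ^ 2 ≤ 1 + R ^ 2 := by gcongr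
    simp only [ballInd, h, if_true]
    have h5 : 0 ≤ (1 + ‖p‖ ^ 2) * normalGamma μ T p := by positivity
    have h6 : (1 + ‖p‖ ^ 2) * fieldGamma μ T d p ≤ 1 + ‖p‖ ^ 2 :=
      mul_le_of_le_one_right (by positivity) h2.2
    linarith
  · have h4 : fieldGamma μ T d p = normalGamma μ T p := by
      rw [normalGamma_eq hT μ p hK0, fieldGamma, fieldK, h1 (not_le.1 h), mul_zero, quasiK_zero]
      rfl
    simp [ballInd, h, h4]

include hT in
-- The matrix condition |α̂|² ≤ γ(1-γ) becomes ξ² + |Δ|² ≤ K², that is, E ≤ K.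
theorem field_mem_admissible {d : L2} (hd : IsEven d) {R : ℝ}
    (hR : ∀ᵐ p : R3, R < ‖p‖ → d p = 0) :
    (fieldGamma μ T d, bessel (dualField hT μ d)) ∈ admissible := by
  refine ⟨integrable_fieldGamma μ hT hR, memH1_bessel _,
    (isEven_bessel_iff _).2 (isEven_dualField hT μ hd), ?_⟩
  filter_upwards [stateMatrix_field μ hT hd] with p hp
  obtain ⟨hK, h1⟩ := hp
  rw [h1]
  set z : ℂ := (wt p : ℂ) * d p / (2 * fieldK μ T d p : ℝ) with hz
  set g := fieldGamma μ T d p with hg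
  have h2 := fieldGamma_mem_Icc μ hT d hK
  have hzg : ‖z‖ ^ 2 ≤ g * (1 - g) := by
    have h3 := quasiE_le_quasiK hT μ p ((wt p : ℂ) * d p)
    have h4 := quasiE_sq μ p ((wt p : ℂ) * d p)
    have h5 := pow_le_pow_left₀ (quasiE_nonneg μ p _) h3 2
    change _ ≤ fieldK μ T d p ^ 2 at h5
    rw [hz, norm_div, Complex.norm_real, Real.norm_of_nonneg (by positivity), div_pow, hg,
      fieldGamma, div_le_iff₀ (by positivity)]
    have h6 : (1 - (‖p‖ ^ 2 - μ) / fieldK μ T d p) / 2 *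
        (1 - (1 - (‖p‖ ^ 2 - μ) / fieldK μ T d p) / 2) * (2 * fieldK μ T d p) ^ 2 =
        fieldK μ T d p ^ 2 - (‖p‖ ^ 2 - μ) ^ 2 := by
      field_simp; ring
    rw [h6]
    linarith
  refine ⟨posSemidef_fin_two h2.1 (sub_nonneg.2 h2.2) hzg, ?_⟩
  have e2 : (1 - !![(g : ℂ), z; conj z, ((1 - g : ℝ) : ℂ)] : Matrix (Fin 2) (Fin 2) ℂ) =
      !![((1 - g : ℝ) : ℂ), -z; conj (-z), (g : ℂ)] := by
    ext i j
    fin_cases i <;> fin_cases j <;> simp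
  rw [e2]
  exact posSemidef_fin_two (sub_nonneg.2 h2.2) h2.1 (by rw [norm_neg]; linarith)

theorem re_conj_mul_dualField (d : L2) : ∀ᵐ p : R3, (conj (d p) * dualField hT μ d p).re =
    ‖(wt p : ℂ) * d p‖ ^ 2 / (2 * fieldK μ T d p) := by
  filter_upwards [dualField_ae hT μ d] with p h1
  rw [h1, mul_left_comm, Complex.conj_mul', ← Complex.ofReal_pow, ← Complex.ofReal_mul,
    Complex.ofReal_re, norm_wt_mul]
  ring

/-- The free energy of the thermal state with a given pairing field. -/
theorem freeEnergy_field (V : R3 → ℝ) {d : L2} (hd : IsEven d) {R : ℝ}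
    (hR : ∀ᵐ p : R3, R < ‖p‖ → d p = 0) :
    freeEnergy V μ T (fieldGamma μ T d, bessel (dualField hT μ d)) =
      (∫ p, normalDensity μ T p) + potQuad V (dualField hT μ d) +
        ((inner ℂ d (dualField hT μ d)).re - condensation μ T d) := by
  have hξ : Integrable (fun p => (‖p‖ ^ 2 - μ) * fieldGamma μ T d p) volume :=
    integrable_xi_mul (integrable_fieldGamma μ hT hR) (by fun_prop) (abs_xi_le μ)
  have hH := integrable_normalDensity hT μ
  have hW := integrable_pairEnergy hT μ d
  have hI := integrable_re_conj_mul d (dualField hT μ d)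
  have hS : T * entropy (fieldGamma μ T d) (bessel (dualField hT μ d)) =
      (∫ p, (‖p‖ ^ 2 - μ) * fieldGamma μ T d p) - (∫ p, normalDensity μ T p) +
        condensation μ T d - (inner ℂ d (dualField hT μ d)).re := by
    have e := integral_sub' ((hξ.sub hH).add hW) hI
    rw [integral_add' (hξ.sub hH) hW, integral_sub' hξ hH, ← condensation,
      ← re_inner_eq_integral] at e
    rw [← e, entropy, ← integral_const_mul]
    refine integral_congr_ae ?_
    filter_upwards [stateMatrix_field μ hT hd, re_conj_mul_dualField μ hT d] with p hp h2
    obtain ⟨hK, h1⟩ := hp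
    simp only [Pi.add_apply, Pi.sub_apply]
    have h3 := mul_trace_negMulLog_thermal hT μ p ((wt p : ℂ) * d p) hK (a := fieldGamma μ T d p)
      (z := (wt p : ℂ) * d p / (2 * fieldK μ T d p : ℝ)) rfl rfl
    rw [h1, h2, h3, quasiE_sq, normalDensity,
      pairEnergy, fieldGamma, fieldK]
    change 0 < quasiK μ T p ((wt p : ℂ) * d p) at hK
    field_simp
    ring
  have hv : ∫ x, ‖bessel (dualField hT μ d) x‖ ^ 2 * V x = potQuad V (dualField hT μ d) := rfl
  rw [freeEnergy]
  simp only
  rw [hS, hv]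
  ring

/-- Concavity of the pressure in |d|², compared with zero field. The energy excess of the thermal
state is therefore at most ∫V|α|² + ½Re⟨d,f⟩. -/
theorem half_inner_le_condensation (d : L2) :
    (inner ℂ d (dualField hT μ d)).re / 2 ≤ condensation μ T d := by
  rw [re_inner_eq_integral, ← integral_div, condensation]
  refine integral_mono_ae ((integrable_re_conj_mul _ _).div_const 2) (integrable_pairEnergy hT μ d) ?_
  filter_upwards [re_conj_mul_dualField μ hT d, ae_fieldK_pos hT μ d] with p h1 hK
  have h2 := pairEnergy_sub_le hT μ p hK 0
  rw [pairEnergy_zero, norm_zero] at h2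
  rw [h1]
  change 0 - _ ≤ (0 ^ 2 - _) / (4 * fieldK μ T d p) at h2
  have h3 : ‖(wt p : ℂ) * d p‖ ^ 2 / (2 * fieldK μ T d p) / 2 =
      -((0 ^ 2 - ‖(wt p : ℂ) * d p‖ ^ 2) / (4 * fieldK μ T d p)) := by
    field_simp; ring
  linarith

theorem continuousAt_thermal (T : ℝ) {e : ℝ} (he : e ≠ 0) : ContinuousAt (thermal T) e := by
  by_cases hT : T = 0
  · have : thermal T = fun e => |e| := by funext e; rw [hT, thermal_zero_left]
    rw [this]; exact continuous_abs.continuousAt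
  · have h1 : thermal T =ᶠ[𝓝 e] fun e => e / Real.tanh (e / (2 * T)) := by
      filter_upwards [isOpen_ne.mem_nhds he] with x hx
      have hx' : x ≠ 0 := hx
      simp [thermal, hT, hx']
    refine ContinuousAt.congr ?_ h1.symm
    refine continuousAt_id.div (continuous_tanh.continuousAt.comp (by fun_prop)) ?_
    have h2 : e / (2 * T) ≠ 0 := div_ne_zero he (mul_ne_zero two_ne_zero hT)
    rcases lt_or_gt_of_ne h2 with h | h
    · have := tanh_pos (neg_pos.2 h)
      rw [Real.tanh_neg] at this
      exact (neg_pos.1 this).ne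
    · exact (tanh_pos h).ne'

/-- The trial pairing field built from a pair wave function. -/
noncomputable def trialField (g : L2) (n : ℕ) : L2 :=
  (((2 / ((n : ℝ) + 1) : ℝ)) : ℂ) • ballProj ((n : ℝ) + 1) (kinOp μ hT g)

theorem trialField_ae (g : L2) (n : ℕ) : ∀ᵐ p : R3, trialField μ hT g n p =
    ((2 / ((n : ℝ) + 1) * (ballInd ((n : ℝ) + 1) p * kinRatio μ T p) : ℝ) : ℂ) * g p := by
  filter_upwards [kinOp_ae μ hT g, mulOp_ae (measurable_ballInd ((n : ℝ) + 1))
    (abs_ballInd_le ((n : ℝ) + 1)) (kinOp μ hT g),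
    Lp.coeFn_smul (((2 / ((n : ℝ) + 1) : ℝ)) : ℂ) (ballProj ((n : ℝ) + 1) (kinOp μ hT g))]
    with p h1 h2 h3
  rw [trialField, h3, Pi.smul_apply, ballProj, h2, h1, smul_eq_mul]
  push_cast; ring

theorem isEven_trialField {g : L2} (hg : IsEven g) (n : ℕ) : IsEven (trialField μ hT g n) :=
  isEven_smul _ (isEven_ballProj _ (isEven_kinOp μ hT hg))

theorem trialField_support (g : L2) (n : ℕ) :
    ∀ᵐ p : R3, (n : ℝ) + 1 < ‖p‖ → trialField μ hT g n p = 0 := by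
  filter_upwards [trialField_ae μ hT g n] with p h1 h2
  rw [h1]
  simp [ballInd, not_le.2 h2]

/-- After multiplication by (n+1)² the integrand is that of the kinetic energy of g times 1_{|p| ≤
n+1} K_T^0/K_T^Δ ≤ 1. -/
theorem inner_trialField_le (g : L2) (n : ℕ) :
    ((n : ℝ) + 1) ^ 2 * ((inner ℂ (trialField μ hT g n) (dualField hT μ (trialField μ hT g n))).re
      / 2) ≤ ∫ p, kinRatio μ T p * ‖g p‖ ^ 2 := by
  set d := trialField μ hT g n with hd
  rw [re_inner_eq_integral, ← integral_div, ← integral_const_mul]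
  refine integral_mono_ae (((integrable_re_conj_mul _ _).div_const 2).const_mul _)
    (integrable_mul_norm_sq (measurable_kinRatio μ T) (abs_kinRatio_le hT μ) g) ?_
  filter_upwards [re_conj_mul_dualField μ hT d, ae_KZero_pos hT μ, trialField_ae μ hT g n]
    with p h1 hK h2
  have hKK := KZero_le_quasiK hT μ p ((wt p : ℂ) * d p)
  change _ ≤ fieldK μ T d p at hKK
  have hF := hK.trans_le hKK
  have hn : (0 : ℝ) < (n : ℝ) + 1 := by positivity
  have hk := kinRatio_nonneg hT μ p
  have hw := wt_pos p
  have hb : (ballInd ((n : ℝ) + 1) p) ^ 2 ≤ 1 := by unfold ballInd; split_ifs <;> simp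
  rw [h1, norm_wt_mul, h2, norm_mul, Complex.norm_real, Real.norm_eq_abs]
  have e : ((n : ℝ) + 1) ^ 2 * ((wt p * (|2 / ((n : ℝ) + 1) * (ballInd ((n : ℝ) + 1) p *
      kinRatio μ T p)| * ‖g p‖)) ^ 2 / (2 * fieldK μ T d p) / 2) =
      ballInd ((n : ℝ) + 1) p ^ 2 * (KZero μ T p / fieldK μ T d p) *
        (kinRatio μ T p * ‖g p‖ ^ 2) := by
    rw [← kinRatio_mul μ T p, mul_pow, mul_pow, sq_abs]
    field_simp
  rw [e]
  refine mul_le_of_le_one_left (by positivity) ?_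
  exact mul_le_one₀ hb (by positivity) ((div_le_one hF).2 hKK)

/-- The rescaled pair functions are Gₙ g with multiplier Gₙ = 1_{|p| ≤ n+1} K_T^0/K_T^Δ between 0
and 1. Off the Fermi surface the field tends to zero, so Gₙ → 1, and dominated convergence applies.
-/
theorem tendsto_trial (g : L2) : Tendsto
    (fun n : ℕ => (((n : ℝ) + 1 : ℝ) : ℂ) • dualField hT μ (trialField μ hT g n)) atTop (𝓝 g) := by
  set G : ℕ → R3 → ℝ := fun n p =>
    ballInd ((n : ℝ) + 1) p * (KZero μ T p / fieldK μ T (trialField μ hT g n) p) with hG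
  have hGm (n : ℕ) : Measurable (G n) := (measurable_ballInd _).mul
    ((measurable_KZero μ T).div (measurable_fieldK μ _))
  have hG01 (n : ℕ) (p : R3) : 0 ≤ G n p ∧ G n p ≤ 1 := by
    have h1 := KZero_le_quasiK hT μ p ((wt p : ℂ) * trialField μ hT g n p)
    have h2 := KZero_nonneg hT μ p
    have h3 : 0 ≤ KZero μ T p / fieldK μ T (trialField μ hT g n) p :=
      div_nonneg h2 (h2.trans h1)
    have h4 : KZero μ T p / fieldK μ T (trialField μ hT g n) p ≤ 1 := div_le_one_of_le₀ h1 (h2.trans h1)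
    simp only [hG, ballInd]
    split_ifs <;> simp [h3, h4]
  have hGlim : ∀ᵐ p : R3, Tendsto (fun n => G n p) atTop (𝓝 1) := by
    filter_upwards [ae_xi_ne_zero μ, ae_all_iff.2 fun n => trialField_ae μ hT g n] with p hξ hd
    have hK : 0 < KZero μ T p := thermal_pos hT hξ
    have h1 : Tendsto (fun n : ℕ => (wt p : ℂ) * trialField μ hT g n p) atTop (𝓝 0) := by
      refine squeeze_zero_norm (a := fun n : ℕ => wt p * (2 * (1 / ((n : ℝ) + 1)) *
        kinRatio μ T p * ‖g p‖)) (fun n => ?_) ?_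
      · have hn : (0 : ℝ) < (n : ℝ) + 1 := by positivity
        have hk := kinRatio_nonneg hT μ p
        have hw := wt_pos p
        rw [norm_wt_mul, hd n, norm_mul, Complex.norm_real, Real.norm_eq_abs, abs_mul, abs_mul,
          abs_of_nonneg hk, abs_of_pos (by positivity : (0 : ℝ) < 2 / ((n : ℝ) + 1))]
        have := abs_ballInd_le ((n : ℝ) + 1) p
        rw [mul_one_div]
        refine mul_le_mul_of_nonneg_left (mul_le_mul_of_nonneg_right (mul_le_mul_of_nonneg_left
          (mul_le_of_le_one_left hk this) (by positivity)) (norm_nonneg _)) hw.le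
      · have := (((tendsto_one_div_add_atTop_nhds_zero_nat (𝕜 := ℝ)).const_mul 2).mul_const
          (kinRatio μ T p)).mul_const ‖g p‖
        simpa using this.const_mul (wt p)
    have h2 : Tendsto (fun n : ℕ => fieldK μ T (trialField μ hT g n) p) atTop (𝓝 (KZero μ T p)) := by
      rw [← quasiK_zero]
      have hE : Continuous (quasiE μ p) := by unfold quasiE; fun_prop
      have hc : ContinuousAt (quasiK μ T p) 0 := by
        refine ContinuousAt.comp (g := thermal T) (continuousAt_thermal T ?_) hE.continuousAt
        have : 0 < quasiE μ p 0 := (abs_pos.2 hξ).trans_le (abs_xi_le_quasiE μ p 0)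
        exact this.ne'
      exact hc.tendsto.comp h1
    have h3 := (tendsto_const_nhds (x := KZero μ T p)).div h2 hK.ne'
    rw [div_self hK.ne'] at h3
    refine h3.congr' ?_
    obtain ⟨N, hN⟩ := exists_nat_ge ‖p‖
    filter_upwards [eventually_ge_atTop N] with n hn
    have : ‖p‖ ≤ (n : ℝ) + 1 := by
      have : (N : ℝ) ≤ n := by exact_mod_cast hn
      linarith
    simp [hG, ballInd, this]
  have hsq : Tendsto (fun n : ℕ =>
      ‖(((n : ℝ) + 1 : ℝ) : ℂ) • dualField hT μ (trialField μ hT g n) - g‖ ^ 2) atTop (𝓝 0) := by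
    have e (n : ℕ) : ‖(((n : ℝ) + 1 : ℝ) : ℂ) • dualField hT μ (trialField μ hT g n) - g‖ ^ 2 =
        ∫ p, (G n p - 1) ^ 2 * ‖g p‖ ^ 2 := by
      rw [norm_sq_eq_integral]
      refine integral_congr_ae ?_
      filter_upwards [Lp.coeFn_sub ((((n : ℝ) + 1 : ℝ) : ℂ) • dualField hT μ (trialField μ hT g n)) g,
        Lp.coeFn_smul (((n : ℝ) + 1 : ℝ) : ℂ) (dualField hT μ (trialField μ hT g n)),
        dualField_ae hT μ (trialField μ hT g n), trialField_ae μ hT g n,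
        ae_fieldK_pos hT μ (trialField μ hT g n)] with p h1 h2 h3 h4 hK
      have h5 : ((((n : ℝ) + 1 : ℝ) : ℂ) • dualField hT μ (trialField μ hT g n) - g) p =
          ((G n p - 1 : ℝ) : ℂ) * g p := by
        have e2 : G n p = ((n : ℝ) + 1) * (wt p ^ 2 / (2 * fieldK μ T (trialField μ hT g n) p) *
            (2 / ((n : ℝ) + 1) * (ballInd ((n : ℝ) + 1) p * kinRatio μ T p))) := by
          have hn : (n : ℝ) + 1 ≠ 0 := by positivity
          simp only [hG]
          rw [← kinRatio_mul μ T p]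
          field_simp
        rw [h1, Pi.sub_apply, h2, Pi.smul_apply, h3, h4, smul_eq_mul, e2]
        push_cast; ring
      rw [h5, norm_mul, mul_pow, Complex.norm_real, Real.norm_eq_abs, sq_abs]
    simp only [e]
    rw [← integral_zero R3 ℝ]
    refine tendsto_integral_of_dominated_convergence (fun p => ‖g p‖ ^ 2) (fun n => ?_)
      (integrable_norm_sq g) (fun n => Eventually.of_forall fun p => ?_) ?_
    · exact (((hGm n).sub_const 1).pow_const 2).aestronglyMeasurable.mul
        ((Lp.aestronglyMeasurable g).norm.pow 2)
    · have h1 := hG01 n p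
      rw [Real.norm_of_nonneg (by positivity)]
      exact mul_le_of_le_one_left (sq_nonneg _) (by nlinarith [h1.1, h1.2])
    · filter_upwards [hGlim] with p hp
      simpa using ((hp.sub_const 1).pow 2).mul_const (‖g p‖ ^ 2)
  rw [tendsto_iff_norm_sub_tendsto_zero]
  have h1 := (Real.continuous_sqrt.tendsto _).comp hsq
  simpa [Function.comp_def, Real.sqrt_sq] using h1

include hV hT in
/-- A negative value of the quadratic form on even functions makes the normal state unstable. -/
theorem exists_freeEnergy_lt {g : L2} (hg : IsEven g) (hq : linQuad V μ T g < 0) :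
    ∃ s ∈ admissible, freeEnergy V μ T s < freeEnergy V μ T (normalGamma μ T, 0) := by
  have h1 := (((continuous_potQuad hV).tendsto g).comp (tendsto_trial μ hT g)).const_add
    (∫ p, kinRatio μ T p * ‖g p‖ ^ 2)
  -- Strong continuity of the potential energy keeps the kinetic energy of g plus the potential
  -- energy of the rescaled trial function negative for some n; dividing by (n+1)² then gives the
  -- sign of the energy excess.
  obtain ⟨n, hn⟩ := (h1.eventually_lt_const hq).exists
  set d := trialField μ hT g n with hd
  have hde := isEven_trialField μ hT hg n
  have hR := trialField_support μ hT g n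
  refine ⟨_, field_mem_admissible μ hT hde hR, ?_⟩
  rw [freeEnergy_field μ hT V hde hR, freeEnergy_normal V hT]
  have h2 := inner_trialField_le μ hT g n
  have h3 := half_inner_le_condensation μ hT d
  have h4 : potQuad V ((((n : ℝ) + 1 : ℝ) : ℂ) • dualField hT μ d) =
      ((n : ℝ) + 1) ^ 2 * potQuad V (dualField hT μ d) := by
    rw [potQuad_eq_re hV, potQuad_eq_re hV, map_smul, inner_smul_left, inner_smul_right,
      Complex.conj_ofReal, Complex.re_ofReal_mul, Complex.re_ofReal_mul]
    ring
  simp only [Function.comp_apply] at hn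
  rw [← hd] at hn h2
  rw [h4] at hn
  have h5 : ((n : ℝ) + 1) ^ 2 * (potQuad V (dualField hT μ d) +
      (inner ℂ d (dualField hT μ d)).re / 2) < 0 := by linarith
  have h6 : potQuad V (dualField hT μ d) + (inner ℂ d (dualField hT μ d)).re / 2 < 0 := by
    by_contra! h
    have : 0 ≤ ((n : ℝ) + 1) ^ 2 * (potQuad V (dualField hT μ d) +
      (inner ℂ d (dualField hT μ d)).re / 2) := by positivity
    linarith
  rw [← hd]
  linarith

include hV hT in
theorem exists_linQuad_neg (h : HasNegativeEigenvalue V μ T) :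
    ∃ g : L2, IsEven g ∧ linQuad V μ T g < 0 := by
  obtain ⟨e, he, ψ, hψ, hψe, hψ1, hform⟩ := h
  obtain ⟨g, rfl⟩ := exists_bessel_eq hψ1
  refine ⟨g, (isEven_bessel_iff g).1 hψe, ?_⟩
  have h1 := hform _ hψ1
  rw [linForm_bessel hV μ hT, ← inner_linOp_left, inner_smul_right,
    inner_self_eq_norm_sq_to_K] at h1
  rw [linQuad_eq hV μ hT, h1, Complex.re_ofReal_mul]
  have h2 : 0 < ‖bessel g‖ ^ 2 := pow_pos (norm_pos_iff.2 hψ) 2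
  have h3 : (((‖bessel g‖ : ℝ) : ℂ) ^ 2).re = ‖bessel g‖ ^ 2 := by
    rw [← Complex.ofReal_pow, Complex.ofReal_re]
  change e * (((‖bessel g‖ : ℝ) : ℂ) ^ 2).re < 0
  rw [h3]
  exact mul_neg_of_neg_of_pos he h2

end Instability

end BCS

/-! ### The equivalence of instability, gap equation and negative eigenvalue -/

theorem theorem3p2 (V : BCS.R3 → ℝ) (hV : MeasureTheory.MemLp V (3 / 2) MeasureTheory.volume)
    (hVeven : ∀ᵐ x : BCS.R3 ∂MeasureTheory.volume, V (-x) = V x)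
    (μ T : ℝ) (hT : 0 ≤ T) :
    List.TFAE [
      sInf ((fun s => (BCS.freeEnergy V μ T s : EReal)) '' BCS.admissible) <
        (BCS.freeEnergy V μ T (BCS.normalGamma μ T, 0) : EReal),
      ∃ s ∈ BCS.admissible, s.2 ≠ 0 ∧ BCS.gapFunction hV s.2 ≠ 0 ∧
        BCS.GapEquation hV μ T (BCS.gapFunction hV s.2),
      BCS.HasNegativeEigenvalue V μ T] := by
  tfae_have 1 → 2 := fun h => by
    -- In the extended reals the strict inequality means that some state has lower energy; the
    -- infimum need be neither finite nor attained.
    obtain ⟨_, ⟨s, hs, rfl⟩, hlt⟩ := sInf_lt_iff.1 h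
    exact BCS.exists_gapEquation_of_lt hV hVeven hT μ hs (EReal.coe_lt_coe_iff.1 hlt)
  tfae_have 2 → 3 := fun ⟨s, hs, _, h0, hgap⟩ =>
    BCS.hasNegativeEigenvalue_of_gapEquation hV μ hT hVeven hs.2.1 hs.2.2.1 h0 hgap
  tfae_have 3 → 1 := fun h => by
    obtain ⟨g, hg, hq⟩ := BCS.exists_linQuad_neg hV μ hT h
    obtain ⟨s, hs, hlt⟩ := BCS.exists_freeEnergy_lt hV μ hT hg hq
    exact sInf_lt_iff.2 ⟨_, ⟨s, hs, rfl⟩, EReal.coe_lt_coe_iff.2 hlt⟩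
  tfae_finish
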